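/- Theorem 1.4. Let $C\subset[0,1]$ be the ternary Cantor set and let $a:\mathbb R\to[0,1]$ be the Cantor staircase on $[0,1]$, extended by $a(\tau)=0$ for $\tau\le 0$ and $a(\tau)=1$ for $\tau\ge 1$. Let $\mathbb H=\mathbb R^3$ be the Heisenberg group with $(x,y,z)(x',y',z')=(x+x',y+y',z+z'+\tfrac12(xy'-x'y))$, and let $X=\partial_x-\tfrac y2\partial_z$, $Y=\partial_y+\tfrac x2\partial_z$. There is exactly one function $f:\mathbb R^2\to\mathbb R$, $(y,t)\mapsto f(y,t)$, with $f\bigl(s,\tfrac12a(\tau)s^2+\tau\bigr)=a(\tau)s$ for all $s,\tau\in\mathbb R$, and it has the following properties. (i) $f\in W^{1,2}_{loc}(\mathbb R^2)$; $f$ is $C^1$-intrinsic, i.e. $f$ is continuous and the intrinsic gradient $\nabla^ff=\partial_yf+f\,\partial_tf$ (as a distribution, $\partial_yf+\partial_t(f^2/2)$) is a continuous function; and $f$ is locally Lipschitz on $\mathbb R^2\setminus(\{0\}\times C)$. (ii) $f$ is stable: for every $\varphi\in C^\infty_c(\mathbb R^2)$ the area $A(\varepsilon)=\int_{\operatorname{spt}\varphi}\sqrt{1+(\nabla^{f+\varepsilon\varphi}(f+\varepsilon\varphi))^2}\,dy\,dt$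 is finite for small $|\varepsilon|$ and twice differentiable at $\varepsilon=0$, with $A'(0)=0$ and $A''(0)\ge 0$. (iii) The intrinsic graph $\Gamma_f=\{(0,y,t)(f(y,t),0,0):(y,t)\in\mathbb R^2\}$ is not an intrinsic plane, i.e. not a coset of a two-dimensional connected Lie subgroup of $\mathbb H$. (iv) $\Gamma_f$ is locally area minimizing in $\Omega=\mathbb H\setminus\{(0,0,z):z\in C\}$: with $G_f=\{(0,y,t)(\xi,0,0):\xi\le f(y,t)\}$, every $p\in\Omega$ has an open neighborhood $U\subset\Omega$ such that $P(G_f;U)<\infty$ and $P(G_f;U)\le P(F;U)$ for every measurable $F\subset\mathbb H$ whose symmetric difference with $G_f$ is relatively compact in $U$. Here $P(G;U)=\sup\int_G(X\psi_1+Y\psi_2)\,d\mathcal L^3$ over $\psi_1,\psi_2\in C^\infty_c(U)$ with $\psi_1^2+\psi_2^2\le1$. -/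

import Mathlib

open MeasureTheory Filter Topology Set
open scoped ContDiff

/-! ### The Cantor staircase on the real line -/

/-- The classical piecewise affine approximations of the Cantor staircase, extended to the whole
line by `0` and `1`.  On `[0, 1/3]`, `[1/3, 2/3]`, `[2/3, 1]` the recursion reads
`a_n(3x) / 2`, `1 / 2`, `(1 + a_n(3x - 2)) / 2`, because `a_n` is `0` on `(-∞, 0]` and `1` on
`[1, ∞)`. -/
noncomputable def staircaseApprox : ℕ → ℝ → ℝ
  | 0, x => max 0 (min x 1)
  | n + 1, x => (staircaseApprox n (3 * x) + staircaseApprox n (3 * x - 2)) / 2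

/-- The Cantor staircase, equal to `0` on `(-∞, 0]` and to `1` on `[1, ∞)`. -/
noncomputable def cantorStaircase (x : ℝ) : ℝ :=
  limUnder atTop (fun n => staircaseApprox n x)

theorem staircaseApprox_of_nonpos (n : ℕ) {x : ℝ} (hx : x ≤ 0) : staircaseApprox n x = 0 := by
  induction n generalizing x with
  | zero => simp [staircaseApprox, hx]
  | succ n ih =>
    simp only [staircaseApprox]
    rw [ih (by linarith), ih (by linarith)]
    norm_num

theorem staircaseApprox_of_one_le (n : ℕ) {x : ℝ} (hx : 1 ≤ x) : staircaseApprox n x = 1 := by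
  induction n generalizing x with
  | zero => simp [staircaseApprox, hx]
  | succ n ih =>
    simp only [staircaseApprox]
    rw [ih (by linarith), ih (by linarith)]
    norm_num

theorem dist_staircaseApprox_succ (n : ℕ) (x : ℝ) :
    dist (staircaseApprox n x) (staircaseApprox (n + 1) x) ≤ 1 * (1 / 2 : ℝ) ^ n := by
  induction n generalizing x with
  | zero =>
    have h (y : ℝ) : 0 ≤ staircaseApprox 0 y ∧ staircaseApprox 0 y ≤ 1 := by
      simp [staircaseApprox]
    have h0 := h x
    have h1 := h (3 * x)
    have h2 := h (3 * x - 2)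
    have e : staircaseApprox (0 + 1) x
        = (staircaseApprox 0 (3 * x) + staircaseApprox 0 (3 * x - 2)) / 2 := rfl
    rw [Real.dist_eq, abs_le, e]
    constructor <;> norm_num <;> linarith
  | succ n ih =>
    have e (m : ℕ) : staircaseApprox (m + 1) x
        = (staircaseApprox m (3 * x) + staircaseApprox m (3 * x - 2)) / 2 := rfl
    have h1 := ih (3 * x)
    have h2 := ih (3 * x - 2)
    rw [Real.dist_eq, abs_le] at h1 h2 ⊢
    rw [e n, e (n + 1), pow_succ]
    rcases le_total x (1 / 2) with hx | hx
    · rw [staircaseApprox_of_nonpos n (x := 3 * x - 2) (by linarith),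
        staircaseApprox_of_nonpos (n + 1) (x := 3 * x - 2) (by linarith)]
      constructor <;> linarith [h1.1, h1.2]
    · rw [staircaseApprox_of_one_le n (x := 3 * x) (by linarith),
        staircaseApprox_of_one_le (n + 1) (x := 3 * x) (by linarith)]
      constructor <;> linarith [h2.1, h2.2]

/-- The limit defining the Cantor staircase exists. -/
theorem tendsto_staircaseApprox (x : ℝ) :
    Tendsto (fun n => staircaseApprox n x) atTop (𝓝 (cantorStaircase x)) :=
  (cauchySeq_of_le_geometric (1 / 2) 1 (by norm_num)
    (fun n => dist_staircaseApprox_succ n x)).tendsto_limUnder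

theorem cantorStaircase_of_nonpos {x : ℝ} (hx : x ≤ 0) : cantorStaircase x = 0 :=
  tendsto_nhds_unique (tendsto_staircaseApprox x)
    (by simp [staircaseApprox_of_nonpos _ hx])

theorem cantorStaircase_of_one_le {x : ℝ} (hx : 1 ≤ x) : cantorStaircase x = 1 :=
  tendsto_nhds_unique (tendsto_staircaseApprox x)
    (by simp [staircaseApprox_of_one_le _ hx])

/-- `f` is a function on the `(y, t)`-plane whose intrinsic graph is the graphical strip of `a`. -/
def IsGraphicalStrip (a : ℝ → ℝ) (f : ℝ × ℝ → ℝ) : Prop :=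
  ∀ s τ : ℝ, f (s, a τ * s ^ 2 / 2 + τ) = a τ * s

/-! ### Test functions, weak derivatives, Sobolev spaces -/

/-- `φ ∈ C_c^∞(Ω)`, for an open subset `Ω` of a normed space. -/
def IsTestFunction {E : Type*} [NormedAddCommGroup E] [NormedSpace ℝ E]
    (Ω : Set E) (φ : E → ℝ) : Prop :=
  ContDiff ℝ ∞ φ ∧ HasCompactSupport φ ∧ tsupport φ ⊆ Ω

/-- `g` is the weak derivative of `f` in the direction `v` on the plane. -/
def HasWeakDeriv (v : ℝ × ℝ) (f g : ℝ × ℝ → ℝ) : Prop :=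
  LocallyIntegrable f ∧ LocallyIntegrable g ∧
    ∀ φ : ℝ × ℝ → ℝ, IsTestFunction univ φ →
      ∫ p, f p * fderiv ℝ φ p v = - ∫ p, g p * φ p

open Classical in
/-- A representative of the weak derivative (unique almost everywhere); `0` if there is none. -/
noncomputable def weakDeriv (v : ℝ × ℝ) (f : ℝ × ℝ → ℝ) : ℝ × ℝ → ℝ :=
  if h : ∃ g, HasWeakDeriv v f g then h.choose else 0

/-- `u ∈ L^p_loc` of the plane. -/
def MemLpLoc (p : ENNReal) (u : ℝ × ℝ → ℝ) : Prop :=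
  ∀ K : Set (ℝ × ℝ), IsCompact K → MemLp u p (volume.restrict K)

/-- `f ∈ W^{1,p}_loc` of the plane. -/
def MemW1pLoc (p : ENNReal) (f : ℝ × ℝ → ℝ) : Prop :=
  MemLpLoc p f ∧ ∃ g₁ g₂ : ℝ × ℝ → ℝ,
    HasWeakDeriv (1, 0) f g₁ ∧ HasWeakDeriv (0, 1) f g₂ ∧ MemLpLoc p g₁ ∧ MemLpLoc p g₂

/-! ### Intrinsic gradient, area functional, first and second variation -/

/-- The intrinsic gradient `∇^f f = ∂_y f + f ∂_t f` of `f ∈ W^{1,1}_loc`. -/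
noncomputable def intrinsicGrad (f : ℝ × ℝ → ℝ) (p : ℝ × ℝ) : ℝ :=
  weakDeriv (1, 0) f p + f p * weakDeriv (0, 1) f p

/-- `f` is `C^1`-intrinsic: `f` is continuous and `∇^f f` is continuous, where for a continuous
function `f` the intrinsic gradient is the distribution `∂_y f + ∂_t (f ^ 2 / 2)`; it is
`∂_y f + f ∂_t f` if moreover `f ∈ W^{1,1}_loc`. -/
def IsIntrinsicC1 (f : ℝ × ℝ → ℝ) : Prop :=
  Continuous f ∧ ∃ g : ℝ × ℝ → ℝ, Continuous g ∧
    ∀ φ : ℝ × ℝ → ℝ, IsTestFunction univ φ →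
      ∫ p, (f p * fderiv ℝ φ p (1, 0) + f p ^ 2 / 2 * fderiv ℝ φ p (0, 1)) = - ∫ p, g p * φ p

/-- The area density `√(1 + (∇^f f)²)`. -/
noncomputable def areaDensity (f : ℝ × ℝ → ℝ) (p : ℝ × ℝ) : ℝ :=
  √(1 + intrinsicGrad f p ^ 2)

/-- The graph area functional (meaningful when the area density is integrable on `E`). -/
noncomputable def graphArea (f : ℝ × ℝ → ℝ) (E : Set (ℝ × ℝ)) : ℝ :=
  ∫ p in E, areaDensity f p

/-- The area of the perturbed graph, `ε ↦ A_{f + ε φ}(spt φ)`. -/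
noncomputable def perturbedArea (f φ : ℝ × ℝ → ℝ) (ε : ℝ) : ℝ :=
  graphArea (fun p => f p + ε * φ p) (tsupport φ)

/-- `f ∈ W^{1,1}_loc` is stationary: for every test function the perturbed areas are finite for
small `ε`, and the first variation exists and vanishes. -/
def IsStationaryGraph (f : ℝ × ℝ → ℝ) : Prop :=
  MemW1pLoc 1 f ∧ ∀ φ : ℝ × ℝ → ℝ, IsTestFunction univ φ →
    (∀ᶠ ε in 𝓝 (0 : ℝ),
      IntegrableOn (areaDensity (fun p => f p + ε * φ p)) (tsupport φ)) ∧
    HasDerivAt (perturbedArea f φ) 0 0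

/-- `f` is stable: it is stationary, and for every test function the second variation exists and
is nonnegative. -/
def IsStableGraph (f : ℝ × ℝ → ℝ) : Prop :=
  IsStationaryGraph f ∧ ∀ φ : ℝ × ℝ → ℝ, IsTestFunction univ φ →
    (∀ᶠ ε in 𝓝 (0 : ℝ), DifferentiableAt ℝ (perturbedArea f φ) ε) ∧
    ∃ c : ℝ, HasDerivAt (deriv (perturbedArea f φ)) c 0 ∧ 0 ≤ c

/-! ### The Heisenberg group: graphs, planes, perimeter -/

/-- The group operation of the Heisenberg group, realized on `ℝ³` in exponential coordinates
`(x, y, z)`. The identity is `0` and the inverse of `p` is `-p`. -/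
noncomputable def heisMul (p q : ℝ × ℝ × ℝ) : ℝ × ℝ × ℝ :=
  (p.1 + q.1, p.2.1 + q.2.1, p.2.2 + q.2.2 + (p.1 * q.2.1 - q.1 * p.2.1) / 2)

/-- The intrinsic graph `Γ_f = {(0, y, t) * (f (y, t), 0, 0)}`. -/
def intrinsicGraph (f : ℝ × ℝ → ℝ) : Set (ℝ × ℝ × ℝ) :=
  {q | ∃ y t : ℝ, q = heisMul (0, y, t) (f (y, t), 0, 0)}

/-- The intrinsic subgraph `G_f = {(0, y, t) * (ξ, 0, 0) : ξ ≤ f (y, t)}`. -/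
def intrinsicSubgraph (f : ℝ × ℝ → ℝ) : Set (ℝ × ℝ × ℝ) :=
  {q | ∃ y t ξ : ℝ, ξ ≤ f (y, t) ∧ q = heisMul (0, y, t) (ξ, 0, 0)}

/-- Intrinsic planes: cosets of two-dimensional (connected) Lie subgroups. In exponential
coordinates such a subgroup is a two-dimensional linear subspace closed under the group
operation (it is then also closed under the inversion `p ↦ -p`). -/
def IsIntrinsicPlane (S : Set (ℝ × ℝ × ℝ)) : Prop :=
  ∃ V : Submodule ℝ (ℝ × ℝ × ℝ), Module.finrank ℝ V = 2 ∧
    (∀ v ∈ V, ∀ w ∈ V, heisMul v w ∈ V) ∧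
    ∃ p : ℝ × ℝ × ℝ, S = heisMul p '' (V : Set (ℝ × ℝ × ℝ))

/-- The horizontal derivative along `X = ∂_x - (y / 2) ∂_z`. -/
noncomputable def horizX (ψ : ℝ × ℝ × ℝ → ℝ) (p : ℝ × ℝ × ℝ) : ℝ :=
  fderiv ℝ ψ p (1, 0, -p.2.1 / 2)

/-- The horizontal derivative along `Y = ∂_y + (x / 2) ∂_z`. -/
noncomputable def horizY (ψ : ℝ × ℝ × ℝ → ℝ) (p : ℝ × ℝ × ℝ) : ℝ :=
  fderiv ℝ ψ p (0, 1, p.1 / 2)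

/-- The sub-Riemannian perimeter of a measurable set `G` in an open set `Ω`. The choice `ψ = 0`
shows that the supremum is nonnegative, so `ENNReal.ofReal` does not change it. -/
noncomputable def perimeter (G Ω : Set (ℝ × ℝ × ℝ)) : ENNReal :=
  sSup {r : ENNReal | ∃ ψ₁ ψ₂ : ℝ × ℝ × ℝ → ℝ,
    IsTestFunction Ω ψ₁ ∧ IsTestFunction Ω ψ₂ ∧ (∀ p, ψ₁ p ^ 2 + ψ₂ p ^ 2 ≤ 1) ∧
    r = ENNReal.ofReal (∫ p in G, (horizX ψ₁ p + horizY ψ₂ p))}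

/-- `G` is a perimeter minimizer in the open set `Ω`: no (Lebesgue) measurable competitor that
differs from `G` only in a relatively compact subset of `Ω` has smaller perimeter in `Ω`. -/
def IsPerimeterMinimizer (G Ω : Set (ℝ × ℝ × ℝ)) : Prop :=
  NullMeasurableSet G ∧
  ∀ F : Set (ℝ × ℝ × ℝ), NullMeasurableSet F →
    IsCompact (closure ((G \ F) ∪ (F \ G))) → closure ((G \ F) ∪ (F \ G)) ⊆ Ω →
    perimeter G Ω ≤ perimeter F Ω

/-- `G` is a local perimeter minimizer in the open set `Ω`. The neighborhood is required to carry
finite perimeter, since minimality would be void where the perimeter of `G` is infinite because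
of its behavior near the boundary or at infinity. -/
def IsLocalPerimeterMinimizer (G Ω : Set (ℝ × ℝ × ℝ)) : Prop :=
  ∀ p ∈ Ω, ∃ U : Set (ℝ × ℝ × ℝ), IsOpen U ∧ p ∈ U ∧ U ⊆ Ω ∧
    perimeter G U ≠ ⊤ ∧ IsPerimeterMinimizer G U

/-! ### Smooth approximations of the Cantor staircase -/

/-! Write a for the staircase and S(x) = √(1 + x²). In coordinates (x, y, z) the surface is x = a(z)
y, a union of horizontal lines, which become the parabolas t = a(τ) y²/2 + τ in the (y, t)-plane.
With m = y²/2 these are the characteristics of Burgers' equation u_m + u u_t = 0 with initial values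
a. Since a is continuous, bounded and nondecreasing, for m ≥ 0 the characteristics neither cross nor
leave gaps. So f = y α, with slope α(y, t) = u(y²/2, t), is the only candidate, and it is
continuous.

Two facts about α carry the analysis. First, ∂_y B(α) + ∂_t (y M(α)) = 0 whenever M'(x) = x B'(x)
(`conservation_law`); this is the chain rule for smooth staircases and survives the uniform limit.
The choice B = id yields ∇^f f = α. Second, for y ≠ 0 one has α = 2 (t - τ) / y², where the foot τ
is nondecreasing in t. As the Cantor set is null, ∂_t τ = 0 almost everywhere on {τ ∈ C}, while α is
locally constant on {τ ∉ C}. Hence β = ∂_t α equals 2 / y² or 0 (`ae_hasDerivAt_stripSlope`), and y²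
β² = 2 β. On each vertical line with y ≠ 0, β has mass at most 1, because α has values in [0, 1].
Thus f_t = y β is locally in L², and so is f_y = α - f f_t.

Stability: the intrinsic gradient of f + ε φ is α + ε P + ε² φ φ_t, where P = D φ + y β φ and D =
∂_y + f ∂_t. The first variation ∫ S'(α) P vanishes by the law with B = S', M = -1/S and an
integration by parts in t. In the second variation, y² β² = 2 β and another integration by parts in
t leave the integral of S''(α) (D φ)² + S''(α) β D(y φ²). The density S''(α) β = ∂_t S'(α) is
transported along the parabolas (`integral_slopeDeriv_mul_stripTransport`), so the last term
integrates to zero and a nonnegative one remains (`integral_second_variation_nonneg`).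

Minimality: the subgraph is {x ≤ a(z) y} (`intrinsicSubgraph_stripFun`). Replace a by smooth
staircases; near each point of Ω their graphs have divergence-free unit normal extensions, or miss
the neighborhood (`exists_calibrated_nhd`). The extension is constant near an axis point off C, and
is again given by a Burgers solution where y ≠ 0. The fields need not converge: L¹ convergence of
the subgraphs and bounds on the cut-off fields suffice to reach the limit
(`isPerimeterMinimizer_of_calibrations`). -/

theorem staircaseApprox_mem_Icc (n : ℕ) (x : ℝ) : staircaseApprox n x ∈ Icc (0 : ℝ) 1 := by
  induction n generalizing x with
  | zero => simp [staircaseApprox]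
  | succ n ih =>
    have h1 := ih (3 * x)
    have h2 := ih (3 * x - 2)
    simp only [staircaseApprox, mem_Icc] at *
    constructor <;> linarith

theorem cantorStaircase_mem_Icc (x : ℝ) : cantorStaircase x ∈ Icc (0 : ℝ) 1 :=
  isClosed_Icc.mem_of_tendsto (tendsto_staircaseApprox x)
    (Eventually.of_forall fun n => staircaseApprox_mem_Icc n x)

theorem cantorStaircase_eq (x : ℝ) :
    cantorStaircase x = (cantorStaircase (3 * x) + cantorStaircase (3 * x - 2)) / 2 := by
  refine tendsto_nhds_unique ((tendsto_add_atTop_iff_nat 1).2 (tendsto_staircaseApprox x)) ?_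
  simp only [staircaseApprox]
  exact ((tendsto_staircaseApprox _).add (tendsto_staircaseApprox _)).div_const 2

/-- Smooth nondecreasing approximations of the Cantor staircase. -/
noncomputable def smoothStaircase : ℕ → ℝ → ℝ
  | 0, x => Real.smoothTransition x
  | n + 1, x => (smoothStaircase n (3 * x) + smoothStaircase n (3 * x - 2)) / 2

theorem smoothStaircase_of_nonpos (n : ℕ) {x : ℝ} (hx : x ≤ 0) : smoothStaircase n x = 0 := by
  induction n generalizing x with
  | zero => simpa [smoothStaircase] using hx
  | succ n ih =>
    simp only [smoothStaircase]
    rw [ih (by linarith), ih (by linarith)]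
    norm_num

theorem smoothStaircase_of_one_le (n : ℕ) {x : ℝ} (hx : 1 ≤ x) : smoothStaircase n x = 1 := by
  induction n generalizing x with
  | zero => simpa [smoothStaircase] using hx
  | succ n ih =>
    simp only [smoothStaircase]
    rw [ih (by linarith), ih (by linarith)]
    norm_num

theorem smoothStaircase_mem_Icc (n : ℕ) (x : ℝ) : smoothStaircase n x ∈ Icc (0 : ℝ) 1 := by
  induction n generalizing x with
  | zero => exact ⟨Real.smoothTransition.nonneg x, Real.smoothTransition.le_one x⟩
  | succ n ih =>
    have h1 := ih (3 * x)
    have h2 := ih (3 * x - 2)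
    simp only [smoothStaircase, mem_Icc] at *
    constructor <;> linarith

theorem smoothStaircase_monotone (n : ℕ) : Monotone (smoothStaircase n) := by
  induction n with
  | zero => exact fun x y h => Real.smoothTransition.monotone h
  | succ n ih =>
    intro x y h
    have h1 := ih (show 3 * x ≤ 3 * y by linarith)
    have h2 := ih (show 3 * x - 2 ≤ 3 * y - 2 by linarith)
    simp only [smoothStaircase]
    linarith

theorem smoothStaircase_contDiff (n : ℕ) : ContDiff ℝ ∞ (smoothStaircase n) := by
  induction n with
  | zero => exact Real.smoothTransition.contDiff
  | succ n ih =>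
    have h1 : ContDiff ℝ ∞ (fun x : ℝ => smoothStaircase n (3 * x)) := ih.comp (by fun_prop)
    have h2 : ContDiff ℝ ∞ (fun x : ℝ => smoothStaircase n (3 * x - 2)) := ih.comp (by fun_prop)
    exact (h1.add h2).div_const 2

theorem exists_lipschitz_smoothStaircase (n : ℕ) :
    ∃ L : ℝ, 0 < L ∧ ∀ x y, x ≤ y → smoothStaircase n y - smoothStaircase n x ≤ L * (y - x) := by
  induction n with
  | zero =>
    obtain ⟨K, hK⟩ : ∃ K : NNReal, LipschitzOnWith K Real.smoothTransition (Icc 0 1) :=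
      (Real.smoothTransition.contDiff (n := 1)).contDiffOn.exists_lipschitzOnWith one_ne_zero
        (convex_Icc 0 1) isCompact_Icc
    refine ⟨K + 1, by positivity, fun x y hxy => ?_⟩
    -- The transition function is constant outside [0, 1], so its Lipschitz bound on that interval
    -- is global.
    have hp : ∀ x, smoothStaircase 0 x = Real.smoothTransition (projIcc (0 : ℝ) 1 zero_le_one x) :=
      fun x => (Real.smoothTransition.projIcc (x := x)).symm
    rw [hp, hp]
    have h := hK.dist_le_mul _ (projIcc (0 : ℝ) 1 zero_le_one y).2 _
      (projIcc (0 : ℝ) 1 zero_le_one x).2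
    have h2 : dist (projIcc (0 : ℝ) 1 zero_le_one y : ℝ) (projIcc (0 : ℝ) 1 zero_le_one x)
        ≤ y - x := by
      have := abs_projIcc_sub_projIcc (a := (0 : ℝ)) (b := 1) (c := y) (d := x) zero_le_one
      rw [Real.dist_eq]
      exact this.trans (le_of_eq (abs_of_nonneg (by linarith)))
    rw [Real.dist_eq] at h
    have h3 := mul_le_mul_of_nonneg_left h2 K.2
    have := le_abs_self (Real.smoothTransition (projIcc (0 : ℝ) 1 zero_le_one y : ℝ) -
      Real.smoothTransition (projIcc (0 : ℝ) 1 zero_le_one x : ℝ))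
    simp only [NNReal.val_eq_coe] at h3
    nlinarith
  | succ n ih =>
    obtain ⟨L, hL, h⟩ := ih
    refine ⟨3 * L, by positivity, fun x y hxy => ?_⟩
    have h1 := h (3 * x) (3 * y) (by linarith)
    have h2 := h (3 * x - 2) (3 * y - 2) (by linarith)
    simp only [smoothStaircase]
    linarith

/-- At every x one of the two branches of the recursion lies in a region where both functions are
the same constant; only the other contributes, with a factor 1/2. -/
theorem abs_smoothStaircase_sub_le (n : ℕ) (x : ℝ) :
    |smoothStaircase n x - cantorStaircase x| ≤ (1 / 2 : ℝ) ^ n := by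
  induction n generalizing x with
  | zero =>
    have h1 := smoothStaircase_mem_Icc 0 x
    have h2 := cantorStaircase_mem_Icc x
    rw [abs_le, pow_zero]
    constructor <;> linarith [h1.1, h1.2, h2.1, h2.2]
  | succ n ih =>
    have h1 := ih (3 * x)
    have h2 := ih (3 * x - 2)
    rw [abs_le] at h1 h2 ⊢
    rw [cantorStaircase_eq, smoothStaircase, pow_succ]
    rcases le_total x (1 / 2) with hx | hx
    · rw [smoothStaircase_of_nonpos n (x := 3 * x - 2) (by linarith),
        cantorStaircase_of_nonpos (x := 3 * x - 2) (by linarith)]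
      constructor <;> linarith [h1.1, h1.2]
    · rw [smoothStaircase_of_one_le n (x := 3 * x) (by linarith),
        cantorStaircase_of_one_le (x := 3 * x) (by linarith)]
      constructor <;> linarith [h2.1, h2.2]

theorem tendsto_smoothStaircase (x : ℝ) :
    Tendsto (fun n => smoothStaircase n x) atTop (𝓝 (cantorStaircase x)) := by
  rw [tendsto_iff_dist_tendsto_zero]
  exact squeeze_zero (fun _ => dist_nonneg) (fun n => abs_smoothStaircase_sub_le n x)
    (tendsto_pow_atTop_nhds_zero_of_lt_one (by norm_num) (by norm_num))

theorem cantorStaircase_monotone : Monotone cantorStaircase := fun x y h =>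
  le_of_tendsto_of_tendsto' (tendsto_smoothStaircase x) (tendsto_smoothStaircase y)
    fun n => smoothStaircase_monotone n h

theorem cantorStaircase_continuous : Continuous cantorStaircase := by
  refine TendstoUniformly.continuous (F := smoothStaircase) (p := atTop) ?_
    (Frequently.of_forall fun n => (smoothStaircase_contDiff n).continuous)
  rw [Metric.tendstoUniformly_iff]
  intro ε hε
  have := tendsto_pow_atTop_nhds_zero_of_lt_one (r := (1 / 2 : ℝ)) (by norm_num) (by norm_num)
  filter_upwards [this.eventually_lt_const hε] with n hn x
  rw [dist_comm]
  exact (abs_smoothStaircase_sub_le n x).trans_lt hn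

/-- The two recursions agree and differ only in their seed on [0, 1]; after n steps the seed is
visible only on the n-th stage of the Cantor construction. -/
theorem smoothStaircase_eq_of_notMem {n : ℕ} {x : ℝ} (hx : x ∉ preCantorSet n) :
    smoothStaircase n x = cantorStaircase x := by
  induction n generalizing x with
  | zero =>
    rw [preCantorSet_zero, mem_Icc, not_and_or, not_le, not_le] at hx
    rcases hx with hx | hx
    · rw [smoothStaircase_of_nonpos 0 hx.le, cantorStaircase_of_nonpos hx.le]
    · rw [smoothStaircase_of_one_le 0 hx.le, cantorStaircase_of_one_le hx.le]
  | succ n ih =>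
    rw [preCantorSet_succ, mem_union, not_or] at hx
    rw [cantorStaircase_eq, smoothStaircase, ih, ih]
    · exact fun h => hx.2 ⟨3 * x - 2, h, by ring⟩
    · exact fun h => hx.1 ⟨3 * x, h, by ring⟩

theorem eventually_cantorStaircase_eq_of_notMem_pre {n : ℕ} {x : ℝ} (hx : x ∉ preCantorSet n) :
    ∀ᶠ x' in 𝓝 x, cantorStaircase x' = cantorStaircase x := by
  induction n generalizing x with
  | zero =>
    rw [preCantorSet_zero, mem_Icc, not_and_or, not_le, not_le] at hx
    rcases hx with hx | hx
    · filter_upwards [Iio_mem_nhds hx] with x' hx'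
      rw [cantorStaircase_of_nonpos (le_of_lt hx'), cantorStaircase_of_nonpos hx.le]
    · filter_upwards [Ioi_mem_nhds hx] with x' hx'
      rw [cantorStaircase_of_one_le (le_of_lt hx'), cantorStaircase_of_one_le hx.le]
  | succ n ih =>
    rw [preCantorSet_succ, mem_union, not_or] at hx
    have h1 := ih (x := 3 * x) fun h => hx.1 ⟨3 * x, h, by ring⟩
    have h2 := ih (x := 3 * x - 2) fun h => hx.2 ⟨3 * x - 2, h, by ring⟩
    have c1 : Tendsto (fun x' : ℝ => 3 * x') (𝓝 x) (𝓝 (3 * x)) := by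
      apply Continuous.tendsto; fun_prop
    have c2 : Tendsto (fun x' : ℝ => 3 * x' - 2) (𝓝 x) (𝓝 (3 * x - 2)) := by
      apply Continuous.tendsto (f := fun x' : ℝ => 3 * x' - 2); fun_prop
    filter_upwards [c1.eventually h1, c2.eventually h2] with x' e1 e2
    rw [cantorStaircase_eq x', cantorStaircase_eq x, e1, e2]

/-- Off the Cantor set, the staircase and all but finitely many of its smooth approximations are
equal to one and the same constant on some neighborhood. -/
theorem exists_eventually_smoothStaircase_eq {x : ℝ} (hx : x ∉ cantorSet) :
    ∃ N, ∀ᶠ x' in 𝓝 x, cantorStaircase x' = cantorStaircase x ∧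
      ∀ n ≥ N, smoothStaircase n x' = cantorStaircase x := by
  obtain ⟨N, hN⟩ : ∃ N, x ∉ preCantorSet N := by
    by_contra! h
    exact hx (mem_iInter.2 h)
  refine ⟨N, ?_⟩
  filter_upwards [eventually_cantorStaircase_eq_of_notMem_pre hN,
    (isClosed_preCantorSet N).isOpen_compl.mem_nhds hN] with x' h1 h2
  refine ⟨h1, fun n hn => ?_⟩
  rw [smoothStaircase_eq_of_notMem fun h => h2 (preCantorSet_antitone hn h), h1]

/-- Self-similarity: C is covered by two copies of itself scaled by 1/3, so its finite measure is at
most 2/3 of itself. -/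
theorem volume_cantorSet : volume cantorSet = 0 := by
  have hfin : volume cantorSet ≠ ⊤ := isCompact_cantorSet.measure_lt_top.ne
  have h1 : volume ((fun x : ℝ => x / 3) '' cantorSet) = ENNReal.ofReal (1 / 3) * volume cantorSet := by
    have := Measure.addHaar_image_homothety (volume : Measure ℝ) 0 (1 / 3 : ℝ) cantorSet
    have e : (fun x : ℝ => x / 3) = AffineMap.homothety (0 : ℝ) (1 / 3 : ℝ) := by
      ext x; simp [AffineMap.homothety_apply]; ring
    rw [e, this]; simp
  have h2 : volume ((fun x : ℝ => (2 + x) / 3) '' cantorSet)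
      = ENNReal.ofReal (1 / 3) * volume cantorSet := by
    have := Measure.addHaar_image_homothety (volume : Measure ℝ) 1 (1 / 3 : ℝ) cantorSet
    have e : (fun x : ℝ => (2 + x) / 3) = AffineMap.homothety (1 : ℝ) (1 / 3 : ℝ) := by
      ext x; simp [AffineMap.homothety_apply]; ring
    rw [e, this]; simp
  have h : volume cantorSet ≤ ENNReal.ofReal (2 / 3) * volume cantorSet := by
    calc volume cantorSet = volume (((fun x : ℝ => x / 3) '' cantorSet) ∪
          ((fun x : ℝ => (2 + x) / 3) '' cantorSet)) := by
          rw [← cantorSet_eq_union_halves]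
      _ ≤ _ := measure_union_le _ _
      _ = ENNReal.ofReal (2 / 3) * volume cantorSet := by
          rw [h1, h2, ← add_mul, ← ENNReal.ofReal_add (by norm_num) (by norm_num)]
          norm_num
  have h' := ENNReal.toReal_mono (ENNReal.mul_ne_top ENNReal.ofReal_ne_top hfin) h
  rw [ENNReal.toReal_mul, ENNReal.toReal_ofReal (by norm_num)] at h'
  have := ENNReal.toReal_nonneg (a := volume cantorSet)
  exact ((ENNReal.toReal_eq_zero_iff _).1 (by linarith)).resolve_right hfin

/-! ### Burgers' equation with nondecreasing initial values -/

/-- Continuous nondecreasing functions with values in `[0, 1]`. -/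
structure IsProfile (a : ℝ → ℝ) : Prop where
  mono : Monotone a
  cont : Continuous a
  mem : ∀ x, a x ∈ Icc (0 : ℝ) 1

theorem isProfile_cantorStaircase : IsProfile cantorStaircase :=
  ⟨cantorStaircase_monotone, cantorStaircase_continuous, cantorStaircase_mem_Icc⟩

theorem isProfile_smoothStaircase (n : ℕ) : IsProfile (smoothStaircase n) :=
  ⟨smoothStaircase_monotone n, (smoothStaircase_contDiff n).continuous, smoothStaircase_mem_Icc n⟩

/-- The foot `τ` of the characteristic `m ↦ τ + m * a τ` through `p = (m, ℓ)`. -/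
noncomputable def foot (a : ℝ → ℝ) (p : ℝ × ℝ) : ℝ :=
  Function.invFun (fun τ => τ + p.1 * a τ) p.2

/-- The solution of Burgers' equation `u_m + u * u_ℓ = 0` with initial values `a`. -/
noncomputable def burgers (a : ℝ → ℝ) (p : ℝ × ℝ) : ℝ := a (foot a p)

namespace IsProfile

variable {a b : ℝ → ℝ}

theorem strictMono_characteristic (ha : IsProfile a) {m : ℝ} (hm : 0 ≤ m) :
    StrictMono (fun τ => τ + m * a τ) := fun x y h => by
  have := mul_le_mul_of_nonneg_left (ha.mono h.le) hm
  simp only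
  linarith

theorem surjective_characteristic (ha : IsProfile a) (m : ℝ) :
    Function.Surjective (fun τ => τ + m * a τ) := by
  have hb : ∀ x, |m * a x| ≤ |m| := fun x => by
    rw [abs_mul]
    exact mul_le_of_le_one_right (abs_nonneg m)
      (abs_le.2 ⟨by linarith [(ha.mem x).1], (ha.mem x).2⟩)
  refine Continuous.surjective (by have := ha.cont; fun_prop) ?_ ?_
  · exact tendsto_atTop_add_right_of_le _ (-|m|) tendsto_id fun x => (abs_le.1 (hb x)).1
  · exact tendsto_atBot_add_right_of_ge _ (|m|) tendsto_id fun x => (abs_le.1 (hb x)).2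

/-- Surjectivity of the characteristic map needs only that a is continuous and bounded, so no sign
of m is required here, in contrast to `foot_eq`. -/
theorem foot_add (ha : IsProfile a) (p : ℝ × ℝ) : foot a p + p.1 * burgers a p = p.2 :=
  Function.invFun_eq (f := fun τ => τ + p.1 * a τ) (ha.surjective_characteristic p.1 p.2)

theorem foot_eq (ha : IsProfile a) {m : ℝ} (hm : 0 ≤ m) (τ : ℝ) : foot a (m, τ + m * a τ) = τ :=
  Function.leftInverse_invFun (ha.strictMono_characteristic hm).injective τ

theorem burgers_mem (ha : IsProfile a) (p : ℝ × ℝ) : burgers a p ∈ Icc (0 : ℝ) 1 := ha.mem _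

theorem abs_burgers_le (ha : IsProfile a) (p : ℝ × ℝ) : |burgers a p| ≤ 1 :=
  abs_le.2 ⟨by linarith [(ha.burgers_mem p).1], (ha.burgers_mem p).2⟩

/-- If the foot of p is the larger one, monotonicity of a makes the slope at p the larger one too.
The term with the slope difference then has a favorable sign, and no modulus of continuity of a
enters. -/
theorem foot_sub_le (ha : IsProfile a) {p q : ℝ × ℝ} (hp : 0 ≤ p.1) :
    foot a p - foot a q ≤ |p.2 - q.2| + |p.1 - q.1| := by
  have h1 := ha.foot_add p
  have h2 := ha.foot_add q
  rcases le_total (foot a p) (foot a q) with h | h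
  · linarith [abs_nonneg (p.2 - q.2), abs_nonneg (p.1 - q.1)]
  · have h3 : burgers a q ≤ burgers a p := ha.mono h
    have h4 := mul_le_mul_of_nonneg_left h3 hp
    have h5 := le_abs_self (p.2 - q.2)
    have h6 : (q.1 - p.1) * burgers a q ≤ |p.1 - q.1| := by
      refine (le_abs_self _).trans ?_
      rw [abs_mul, abs_sub_comm]
      exact mul_le_of_le_one_right (abs_nonneg _) (ha.abs_burgers_le q)
    linarith

theorem abs_foot_sub_le (ha : IsProfile a) {p q : ℝ × ℝ} (hp : 0 ≤ p.1) (hq : 0 ≤ q.1) :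
    |foot a p - foot a q| ≤ |p.2 - q.2| + |p.1 - q.1| := by
  refine abs_le.2 ⟨?_, ha.foot_sub_le hp⟩
  have := ha.foot_sub_le (p := q) (q := p) hq
  rw [abs_sub_comm q.2, abs_sub_comm q.1] at this
  linarith

theorem continuousOn_foot (ha : IsProfile a) : ContinuousOn (foot a) {p | 0 ≤ p.1} := by
  have : LipschitzOnWith 2 (foot a) {p | 0 ≤ p.1} := by
    refine LipschitzOnWith.of_dist_le_mul fun p hp q hq => ?_
    have h := ha.abs_foot_sub_le hp hq
    rw [Prod.dist_eq, Real.dist_eq, Real.dist_eq, Real.dist_eq, NNReal.coe_ofNat]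
    linarith [le_max_left |p.1 - q.1| |p.2 - q.2|, le_max_right |p.1 - q.1| |p.2 - q.2|]
  exact this.continuousOn

theorem foot_le_foot (ha : IsProfile a) {m x y : ℝ} (hm : 0 ≤ m) (h : x ≤ y) :
    foot a (m, x) ≤ foot a (m, y) := by
  have h1 := ha.foot_add (m, x)
  have h2 := ha.foot_add (m, y)
  refine (ha.strictMono_characteristic hm).le_iff_le.1 ?_
  simp only [burgers] at h1 h2 ⊢
  linarith

/-- A comparison principle: at a given point a larger slope means a foot further left, so u_a =
a(τ_a) ≤ a(τ_b) ≤ b(τ_b) + ε. It carries uniform convergence of the initial values over to the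
solutions. -/
theorem burgers_sub_le (ha : IsProfile a) (hb : IsProfile b) {ε : ℝ} (hε : 0 ≤ ε)
    (h : ∀ x, |a x - b x| ≤ ε) {p : ℝ × ℝ} (hp : 0 ≤ p.1) : burgers a p - burgers b p ≤ ε := by
  rcases le_total (burgers a p) (burgers b p) with h0 | h0
  · linarith
  · have h1 := ha.foot_add p
    have h2 := hb.foot_add p
    have h3 := mul_le_mul_of_nonneg_left h0 hp
    have h4 : burgers a p ≤ a (foot b p) := ha.mono (by linarith)
    have h5 := (abs_le.1 (h (foot b p))).2
    simp only [burgers] at *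
    linarith

theorem abs_burgers_sub_le (ha : IsProfile a) (hb : IsProfile b) {ε : ℝ} (hε : 0 ≤ ε)
    (h : ∀ x, |a x - b x| ≤ ε) {p : ℝ × ℝ} (hp : 0 ≤ p.1) : |burgers a p - burgers b p| ≤ ε := by
  refine abs_le.2 ⟨?_, ha.burgers_sub_le hb hε h hp⟩
  have := hb.burgers_sub_le ha hε (fun x => by rw [abs_sub_comm]; exact h x) hp
  linarith

/-- Smoothness of the solution up to and across the initial time, and the equation. -/
theorem contDiffAt_burgers_and_eq (ha : IsProfile a) (hs : ContDiff ℝ ∞ a) {L : ℝ} (hL : 0 < L)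
    (hl : ∀ x y, x ≤ y → a y - a x ≤ L * (y - x)) {p : ℝ × ℝ} (hp : 0 ≤ p.1) :
    ContDiffAt ℝ ∞ (burgers a) p ∧
      fderiv ℝ (burgers a) p (1, 0) + burgers a p * fderiv ℝ (burgers a) p (0, 1) = 0 := by
  -- The Lipschitz bound delays crossing for negative times too. Points with m = 0 thereby become
  -- interior, which is what smoothness of the slope across y = 0 requires.
  have hmono : ∀ m : ℝ, -(1 / L) < m → StrictMono (fun τ => τ + m * a τ) := fun m hm x y h => by
    rcases le_total 0 m with h0 | h0
    · exact ha.strictMono_characteristic h0 h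
    · have h1 := hl x y h.le
      have h2 := ha.mono h.le
      have h3 : -m * L < 1 := by
        have := mul_lt_mul_of_pos_right hm hL
        field_simp at this
        linarith
      have h4 : -m * (a y - a x) ≤ -m * (L * (y - x)) :=
        mul_le_mul_of_nonneg_left h1 (by linarith)
      have h5 : (-m * L) * (y - x) < 1 * (y - x) :=
        mul_lt_mul_of_pos_right h3 (by linarith)
      simp only
      nlinarith
  have hfoot : ∀ m : ℝ, -(1 / L) < m → ∀ τ, foot a (m, τ + m * a τ) = τ := fun m hm τ =>
    Function.leftInverse_invFun (hmono m hm).injective τ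
  have hL' : -(1 / L) < 0 := by rw [neg_lt_zero]; positivity
  let Φ : ℝ × ℝ → ℝ × ℝ := fun q => (q.1, q.2 + q.1 * a q.2)
  have hΦ : ContDiff ℝ ∞ Φ := by
    have : ContDiff ℝ ∞ (fun q : ℝ × ℝ => a q.2) := hs.comp contDiff_snd
    exact contDiff_fst.prodMk (contDiff_snd.add (contDiff_fst.mul this))
  set τ := foot a p with hτ
  set c := 1 + p.1 * deriv a τ with hc
  have hcpos : 0 < c := by
    have : 0 ≤ deriv a τ := ha.mono.deriv_nonneg
    positivity
  have hda : HasDerivAt a (deriv a τ) τ := (hs.differentiable (by simp) τ).hasDerivAt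
  -- The derivative of `Φ` at (m, τ) is triangular with diagonal 1, c, and c > 0 because a' ≥ 0 and
  -- m ≥ 0; the inverse function theorem applies.
  let e : (ℝ × ℝ) ≃L[ℝ] (ℝ × ℝ) := ContinuousLinearEquiv.equivOfInverse
    ((ContinuousLinearMap.fst ℝ ℝ ℝ).prod
      (a τ • ContinuousLinearMap.fst ℝ ℝ ℝ + c • ContinuousLinearMap.snd ℝ ℝ ℝ))
    ((ContinuousLinearMap.fst ℝ ℝ ℝ).prod
      ((-(a τ) / c) • ContinuousLinearMap.fst ℝ ℝ ℝ + (1 / c) • ContinuousLinearMap.snd ℝ ℝ ℝ))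
    (fun q => by
      ext
      · simp
      · simp; field_simp; ring)
    (fun q => by
      ext
      · simp
      · simp; field_simp; ring)
  have hderiv : HasFDerivAt Φ (e : (ℝ × ℝ) →L[ℝ] (ℝ × ℝ)) (p.1, τ) := by
    have h2 : HasFDerivAt (fun q : ℝ × ℝ => a q.2)
        (deriv a τ • ContinuousLinearMap.snd ℝ ℝ ℝ) (p.1, τ) :=
      HasDerivAt.comp_hasFDerivAt (f := Prod.snd) (p.1, τ) hda hasFDerivAt_snd
    have h3 := hasFDerivAt_fst (𝕜 := ℝ) (E := ℝ) (F := ℝ) (p := (p.1, τ))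
    have h4 := h3.prodMk ((hasFDerivAt_snd (𝕜 := ℝ) (E := ℝ) (F := ℝ) (p := (p.1, τ))).add
      (h3.mul h2))
    refine h4.congr_fderiv ?_
    ext <;> simp [e, hc]
  have hcd : ContDiffAt ℝ ∞ Φ (p.1, τ) := hΦ.contDiffAt
  have hΦp : Φ (p.1, τ) = p := Prod.ext rfl (ha.foot_add p)
  let g := hcd.localInverse hderiv (by simp)
  have hg : ContDiffAt ℝ ∞ g (Φ (p.1, τ)) := hcd.to_localInverse hderiv (by simp)
  have hgi : ∀ᶠ q in 𝓝 (Φ (p.1, τ)), Φ (g q) = q :=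
    (hcd.toOpenPartialHomeomorph Φ hderiv (by simp)).eventually_right_inverse'
      (hcd.mem_toOpenPartialHomeomorph_source hderiv (by simp))
  rw [hΦp] at hg hgi
  have hpos : ∀ᶠ q : ℝ × ℝ in 𝓝 p, -(1 / L) < q.1 :=
    continuous_fst.continuousAt.eventually (lt_mem_nhds (by linarith))
  have hev : burgers a =ᶠ[𝓝 p] fun q => a (g q).2 := by
    filter_upwards [hgi, hpos] with q h1 h2
    have e1 : (Φ (g q)).1 = q.1 := by rw [h1]
    have e2 : (Φ (g q)).2 = q.2 := by rw [h1]
    simp only [Φ] at e1 e2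
    have := hfoot q.1 h2 (g q).2
    rw [e1] at e2
    rw [e2] at this
    rw [burgers, ← this]
  have hcd' : ContDiffAt ℝ ∞ (burgers a) p :=
    ((hs.contDiffAt.comp (x := p) (hg.snd))).congr_of_eventuallyEq hev
  refine ⟨hcd', ?_⟩
  have hd : HasFDerivAt (burgers a) (fderiv ℝ (burgers a) p) p :=
    (hcd'.differentiableAt (by simp)).hasFDerivAt
  -- The solution is constant along its characteristic; differentiating this at p gives the
  -- equation.
  have hcurve : HasDerivAt (fun m : ℝ => (m, τ + m * a τ)) (1, a τ) p.1 := by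
    have := (hasDerivAt_id p.1).prodMk (((hasDerivAt_id p.1).mul_const (a τ)).const_add τ)
    simpa using this
  have hd' : HasFDerivAt (burgers a) (fderiv ℝ (burgers a) p) (p.1, τ + p.1 * a τ) := by
    rw [show (p.1, τ + p.1 * a τ) = p from hΦp]; exact hd
  have hcomp := hd'.comp_hasDerivAt p.1 hcurve
  have hconst : HasDerivAt (burgers a ∘ fun m : ℝ => (m, τ + m * a τ)) 0 p.1 := by
    refine (hasDerivAt_const p.1 (a τ)).congr_of_eventuallyEq ?_
    filter_upwards [lt_mem_nhds (show -(1 / L) < p.1 by linarith)] with m hm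
    simp only [Function.comp, burgers, hfoot m hm]
  have hu := hcomp.unique hconst
  have : ((1 : ℝ), a τ) = (1, 0) + burgers a p • ((0 : ℝ), (1 : ℝ)) := by
    simp [burgers, ← hτ]
  rw [this, map_add, map_smul, smul_eq_mul] at hu
  exact hu

end IsProfile

theorem contDiffAt_burgers_smoothStaircase (n : ℕ) {p : ℝ × ℝ} (hp : 0 ≤ p.1) :
    ContDiffAt ℝ ∞ (burgers (smoothStaircase n)) p := by
  obtain ⟨L, hL, hl⟩ := exists_lipschitz_smoothStaircase n
  exact ((isProfile_smoothStaircase n).contDiffAt_burgers_and_eq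
    (smoothStaircase_contDiff n) hL hl hp).1

theorem fderiv_burgers_smoothStaircase (n : ℕ) {p : ℝ × ℝ} (hp : 0 ≤ p.1) :
    fderiv ℝ (burgers (smoothStaircase n)) p (1, 0) +
      burgers (smoothStaircase n) p * fderiv ℝ (burgers (smoothStaircase n)) p (0, 1) = 0 := by
  obtain ⟨L, hL, hl⟩ := exists_lipschitz_smoothStaircase n
  exact ((isProfile_smoothStaircase n).contDiffAt_burgers_and_eq
    (smoothStaircase_contDiff n) hL hl hp).2

theorem abs_burgers_smoothStaircase_sub_le (n : ℕ) {p : ℝ × ℝ} (hp : 0 ≤ p.1) :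
    |burgers (smoothStaircase n) p - burgers cantorStaircase p| ≤ (1 / 2) ^ n :=
  (isProfile_smoothStaircase n).abs_burgers_sub_le isProfile_cantorStaircase (by positivity)
    (abs_smoothStaircase_sub_le n) hp

/-! ### Test functions -/

namespace IsTestFunction

variable {E : Type*} [NormedAddCommGroup E] [NormedSpace ℝ E] {Ω : Set E} {φ ψ : E → ℝ}

theorem continuous (h : IsTestFunction Ω φ) : Continuous φ := h.1.continuous

theorem differentiable (h : IsTestFunction Ω φ) : Differentiable ℝ φ :=
  h.1.differentiable (by simp)

theorem toUniv (h : IsTestFunction Ω φ) : IsTestFunction univ φ := ⟨h.1, h.2.1, subset_univ _⟩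

theorem of_compactSupport (h : ContDiff ℝ ∞ φ) (h' : HasCompactSupport φ) :
    IsTestFunction univ φ := ⟨h, h', subset_univ _⟩

theorem fderiv_apply (h : IsTestFunction Ω φ) (v : E) :
    IsTestFunction Ω (fun p => fderiv ℝ φ p v) :=
  ⟨(h.1.fderiv_right (by simp)).clm_apply contDiff_const, h.2.1.fderiv_apply ℝ v,
    (tsupport_fderiv_apply_subset ℝ v).trans h.2.2⟩

theorem mul_left (h : IsTestFunction Ω φ) {g : E → ℝ} (hg : ContDiff ℝ ∞ g) :
    IsTestFunction Ω (fun p => g p * φ p) :=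
  ⟨hg.mul h.1, h.2.1.mul_left, (tsupport_mul_subset_right).trans h.2.2⟩

theorem continuous_fderiv_apply (h : IsTestFunction Ω φ) {V : E → E} (hV : Continuous V) :
    Continuous (fun p => fderiv ℝ φ p (V p)) :=
  (h.1.continuous_fderiv (by simp)).clm_apply hV

theorem hasCompactSupport_fderiv_apply (h : IsTestFunction Ω φ) (V : E → E) :
    HasCompactSupport (fun p => fderiv ℝ φ p (V p)) :=
  h.2.1.of_isClosed_subset (isClosed_tsupport _) (closure_minimal (fun p hp => by
    by_contra h'
    exact hp (by simp [fderiv_of_notMem_tsupport ℝ h'])) (isClosed_tsupport _))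

variable [MeasurableSpace E] [BorelSpace E] {μ : Measure E} [IsFiniteMeasureOnCompacts μ]

theorem integrable_mul (h : IsTestFunction Ω φ) {g : E → ℝ} (hg : Continuous g) :
    Integrable (fun p => g p * φ p) μ :=
  (hg.mul h.continuous).integrable_of_hasCompactSupport h.2.1.mul_left

theorem integrable_mul_fderiv (h : IsTestFunction Ω φ) {g : E → ℝ} (hg : Continuous g)
    {V : E → E} (hV : Continuous V) : Integrable (fun p => g p * fderiv ℝ φ p (V p)) μ :=
  (hg.mul (h.continuous_fderiv_apply hV)).integrable_of_hasCompactSupport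
    (h.hasCompactSupport_fderiv_apply V).mul_left

theorem integral_mul_fderiv [FiniteDimensional ℝ E] {ν : Measure E} [ν.IsAddHaarMeasure]
    (h : IsTestFunction Ω φ) {g : E → ℝ} (hg : ContDiff ℝ 1 g) (v : E) :
    ∫ p, g p * fderiv ℝ φ p v ∂ν = - ∫ p, fderiv ℝ g p v * φ p ∂ν :=
  integral_mul_fderiv_eq_neg_fderiv_mul_of_integrable
    (h.integrable_mul ((hg.continuous_fderiv one_ne_zero).clm_apply continuous_const))
    (h.integrable_mul_fderiv hg.continuous continuous_const) (h.integrable_mul hg.continuous)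
    (fun x _ => hg.differentiable one_ne_zero x) (fun x _ => h.differentiable x)

end IsTestFunction

/-! ### The slope of the strip and its conservation laws -/

/-- The intrinsic gradient of the graphical strip of `a`: it is constant along the parabolas
`s ↦ (s, a τ * s ^ 2 / 2 + τ)`. -/
noncomputable def stripSlope (a : ℝ → ℝ) (p : ℝ × ℝ) : ℝ := burgers a (p.1 ^ 2 / 2, p.2)

/-- The function whose intrinsic graph is the graphical strip of `a`. -/
noncomputable def stripFun (a : ℝ → ℝ) (p : ℝ × ℝ) : ℝ := p.1 * stripSlope a p

namespace IsProfile

variable {a : ℝ → ℝ}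

theorem continuous_stripFoot (ha : IsProfile a) :
    Continuous (fun p : ℝ × ℝ => foot a (p.1 ^ 2 / 2, p.2)) :=
  ha.continuousOn_foot.comp_continuous (by fun_prop) fun p => by
    show 0 ≤ p.1 ^ 2 / 2
    positivity

theorem continuous_stripSlope (ha : IsProfile a) : Continuous (stripSlope a) :=
  ha.cont.comp ha.continuous_stripFoot

theorem continuous_stripFun (ha : IsProfile a) : Continuous (stripFun a) :=
  continuous_fst.mul ha.continuous_stripSlope

theorem stripSlope_mem (ha : IsProfile a) (p : ℝ × ℝ) : stripSlope a p ∈ Icc (0 : ℝ) 1 :=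
  ha.burgers_mem _

end IsProfile

theorem contDiff_stripSlope (n : ℕ) : ContDiff ℝ ∞ (stripSlope (smoothStaircase n)) := by
  rw [contDiff_iff_contDiffAt]
  intro p
  have h := contDiffAt_burgers_smoothStaircase n (p := (p.1 ^ 2 / 2, p.2))
    (by show 0 ≤ p.1 ^ 2 / 2; positivity)
  have hg : ContDiffAt ℝ ∞ (fun p : ℝ × ℝ => (p.1 ^ 2 / 2, p.2)) p := by fun_prop
  exact h.comp p hg

theorem fderiv_stripSlope (n : ℕ) (p : ℝ × ℝ) :
    fderiv ℝ (stripSlope (smoothStaircase n)) p (1, 0) +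
      p.1 * stripSlope (smoothStaircase n) p * fderiv ℝ (stripSlope (smoothStaircase n)) p (0, 1)
        = 0 := by
  have hp : 0 ≤ ((p.1 ^ 2 / 2, p.2) : ℝ × ℝ).1 := by show 0 ≤ p.1 ^ 2 / 2; positivity
  have h := fderiv_burgers_smoothStaircase n hp
  have hd := ((contDiffAt_burgers_smoothStaircase n hp).differentiableAt (by simp)).hasFDerivAt
  have hg : HasFDerivAt (fun p : ℝ × ℝ => (p.1 ^ 2 / 2, p.2))
      ((p.1 • ContinuousLinearMap.fst ℝ ℝ ℝ).prod (ContinuousLinearMap.snd ℝ ℝ ℝ)) p := by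
    refine HasFDerivAt.prodMk ?_ hasFDerivAt_snd
    have := ((hasFDerivAt_fst (𝕜 := ℝ) (E := ℝ) (F := ℝ) (p := p)).pow 2).mul_const (1 / 2)
    simp only [mul_one_div] at this
    refine this.congr_fderiv ?_
    ext <;> simp
    try ring
  have hc := hd.comp p hg
  have hc' : fderiv ℝ (stripSlope (smoothStaircase n)) p = _ := hc.fderiv
  rw [hc']
  have e1 : ((p.1, 0) : ℝ × ℝ) = p.1 • (1, 0) := by simp
  simp only [ContinuousLinearMap.comp_apply, ContinuousLinearMap.prod_apply,
    _root_.smul_apply, ContinuousLinearMap.coe_fst', ContinuousLinearMap.coe_snd',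
    smul_eq_mul, mul_one, mul_zero, e1, map_smul]
  simp only [stripSlope]
  linear_combination p.1 * h

theorem abs_stripSlope_smoothStaircase_sub_le (n : ℕ) (p : ℝ × ℝ) :
    |stripSlope (smoothStaircase n) p - stripSlope cantorStaircase p| ≤ (1 / 2) ^ n :=
  abs_burgers_smoothStaircase_sub_le n (by show 0 ≤ p.1 ^ 2 / 2; positivity)

theorem tendsto_stripSlope (p : ℝ × ℝ) :
    Tendsto (fun n => stripSlope (smoothStaircase n) p) atTop (𝓝 (stripSlope cantorStaircase p)) := by
  rw [tendsto_iff_dist_tendsto_zero]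
  exact squeeze_zero (fun _ => dist_nonneg) (fun n => abs_stripSlope_smoothStaircase_sub_le n p)
    (tendsto_pow_atTop_nhds_zero_of_lt_one (by norm_num) (by norm_num))

/-- After integration by parts the integrand is b(α) φ times α_y + y α α_t, which vanishes by
`fderiv_stripSlope`. -/
theorem conservation_law_smooth (n : ℕ) {B M b : ℝ → ℝ} (hB : ContDiff ℝ 1 B) (hM : ContDiff ℝ 1 M)
    (hB' : ∀ x, HasDerivAt B (b x) x) (hM' : ∀ x, HasDerivAt M (x * b x) x)
    {φ : ℝ × ℝ → ℝ} (hφ : IsTestFunction univ φ) :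
    ∫ p : ℝ × ℝ, (B (stripSlope (smoothStaircase n) p) * fderiv ℝ φ p (1, 0) +
      p.1 * M (stripSlope (smoothStaircase n) p) * fderiv ℝ φ p (0, 1)) = 0 := by
  set α := stripSlope (smoothStaircase n) with hα
  have hαs : ContDiff ℝ 1 α := (contDiff_stripSlope n).of_le (by simp)
  have h1 : ContDiff ℝ 1 (fun p => B (α p)) := hB.comp hαs
  have h2 : ContDiff ℝ 1 (fun p : ℝ × ℝ => p.1 * M (α p)) := contDiff_fst.mul (hM.comp hαs)
  rw [integral_add (hφ.integrable_mul_fderiv h1.continuous continuous_const)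
    (hφ.integrable_mul_fderiv h2.continuous continuous_const),
    hφ.integral_mul_fderiv h1, hφ.integral_mul_fderiv h2, ← neg_add, neg_eq_zero,
    ← integral_add (hφ.integrable_mul ((h1.continuous_fderiv one_ne_zero).clm_apply continuous_const))
      (hφ.integrable_mul ((h2.continuous_fderiv one_ne_zero).clm_apply continuous_const))]
  refine (integral_congr_ae (Eventually.of_forall fun p => ?_)).trans (integral_zero _ _)
  have hd : HasFDerivAt α (fderiv ℝ α p) p := (hαs.differentiable one_ne_zero p).hasFDerivAt
  have e1 : fderiv ℝ (fun p => B (α p)) p = b (α p) • fderiv ℝ α p :=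
    ((hB' (α p)).comp_hasFDerivAt p hd).fderiv
  have e2 : HasFDerivAt (fun p => M (α p)) ((α p * b (α p)) • fderiv ℝ α p) p :=
    (hM' (α p)).comp_hasFDerivAt p hd
  have e3 : fderiv ℝ (fun p : ℝ × ℝ => p.1 * M (α p)) p = _ := ((hasFDerivAt_fst (𝕜 := ℝ) (E := ℝ) (F := ℝ) (p := p)).mul e2).fderiv
  have := fderiv_stripSlope n p
  rw [← hα] at this
  simp only [e1, e3]
  simp
  linear_combination b (α p) * φ p * this

/-- The conservation laws `∂_y B(α) + ∂_t (y M(α)) = 0`, where `M' (x) = x * B' (x)`, for the slope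
`α` of the graphical strip of the Cantor staircase. -/
theorem conservation_law {B M b : ℝ → ℝ} (hB : ContDiff ℝ 1 B) (hM : ContDiff ℝ 1 M)
    (hB' : ∀ x, HasDerivAt B (b x) x) (hM' : ∀ x, HasDerivAt M (x * b x) x)
    {φ : ℝ × ℝ → ℝ} (hφ : IsTestFunction univ φ) :
    ∫ p : ℝ × ℝ, (B (stripSlope cantorStaircase p) * fderiv ℝ φ p (1, 0) +
      p.1 * M (stripSlope cantorStaircase p) * fderiv ℝ φ p (0, 1)) = 0 := by
  obtain ⟨c, hc⟩ := isCompact_Icc.exists_bound_of_continuousOn (s := Icc (0 : ℝ) 1)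
    hB.continuous.continuousOn
  obtain ⟨d, hd⟩ := isCompact_Icc.exists_bound_of_continuousOn (s := Icc (0 : ℝ) 1)
    hM.continuous.continuousOn
  -- No derivative of the slope occurs in the weak form, so pointwise convergence and the bounds of
  -- B and M on [0, 1] suffice.
  have hlim := tendsto_integral_of_dominated_convergence (μ := (volume : Measure (ℝ × ℝ)))
    (F := fun n p => B (stripSlope (smoothStaircase n) p) * fderiv ℝ φ p (1, 0) +
      p.1 * M (stripSlope (smoothStaircase n) p) * fderiv ℝ φ p (0, 1))
    (f := fun p => B (stripSlope cantorStaircase p) * fderiv ℝ φ p (1, 0) +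
      p.1 * M (stripSlope cantorStaircase p) * fderiv ℝ φ p (0, 1))
    (fun p => |c * fderiv ℝ φ p (1, 0)| + |p.1 * d * fderiv ℝ φ p (0, 1)|) ?_ ?_ ?_ ?_
  · refine tendsto_nhds_unique hlim ?_
    simp only [conservation_law_smooth _ hB hM hB' hM' hφ, tendsto_const_nhds_iff]
  · intro n
    have hα := (isProfile_smoothStaircase n).continuous_stripSlope
    exact ((hφ.integrable_mul_fderiv (hB.continuous.comp hα) continuous_const).add
      (hφ.integrable_mul_fderiv (continuous_fst.mul (hM.continuous.comp hα))
        continuous_const)).aestronglyMeasurable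
  · exact (hφ.integrable_mul_fderiv continuous_const continuous_const).abs.add
      (hφ.integrable_mul_fderiv (g := fun p => p.1 * d) (by fun_prop) continuous_const).abs
  · refine fun n => Eventually.of_forall fun p => (norm_add_le _ _).trans ?_
    have hα := (isProfile_smoothStaircase n).stripSlope_mem p
    have h1 := (hc _ hα).trans (le_abs_self c)
    have h2 := (hd _ hα).trans (le_abs_self d)
    simp only [Real.norm_eq_abs, abs_mul] at h1 h2 ⊢
    gcongr
  · refine Eventually.of_forall fun p => ?_
    have := tendsto_stripSlope p
    exact (((hB.continuous.tendsto _).comp this).mul_const _).add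
      ((((hM.continuous.tendsto _).comp this).const_mul _).mul_const _)

/-! ### The vertical derivative of the slope -/

/-- The part of the plane covered by the parabolas that start in the Cantor set. -/
def stripCantor : Set (ℝ × ℝ) :=
  {p | foot cantorStaircase (p.1 ^ 2 / 2, p.2) ∈ cantorSet}

theorem isClosed_stripCantor : IsClosed stripCantor :=
  isClosed_cantorSet.preimage isProfile_cantorStaircase.continuous_stripFoot

/-- The derivative in `t` of the slope of the graphical strip of the Cantor staircase. -/
noncomputable def slopeDeriv : ℝ × ℝ → ℝ := stripCantor.indicator fun p => 2 / p.1 ^ 2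

theorem measurable_slopeDeriv : Measurable slopeDeriv :=
  Measurable.indicator (by fun_prop) isClosed_stripCantor.measurableSet

theorem slopeDeriv_nonneg (p : ℝ × ℝ) : 0 ≤ slopeDeriv p :=
  indicator_nonneg (fun p _ => by positivity) p

/-- The identity y² β² = 2 β makes β quadratic at no cost: it gives both f_t ∈ L²_loc and the
cancellation in the second variation. On y = 0 it holds because division by zero gives 0. -/
theorem sq_mul_slopeDeriv_sq (p : ℝ × ℝ) : p.1 ^ 2 * slopeDeriv p ^ 2 = 2 * slopeDeriv p := by
  by_cases hp : p ∈ stripCantor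
  · simp only [slopeDeriv, indicator_of_mem hp]
    rcases eq_or_ne p.1 0 with h | h
    · simp [h]
    · field_simp
  · simp [slopeDeriv, indicator_of_notMem hp]

theorem stripSlope_cantor_eventually_eq {p : ℝ × ℝ} (hp : p ∉ stripCantor) :
    ∀ᶠ q in 𝓝 p, stripSlope cantorStaircase q = stripSlope cantorStaircase p := by
  obtain ⟨N, hN⟩ := exists_eventually_smoothStaircase_eq hp
  filter_upwards [isProfile_cantorStaircase.continuous_stripFoot.continuousAt.eventually hN]
    with q hq using hq.1

theorem IsProfile.stripSlope_eq {a : ℝ → ℝ} (ha : IsProfile a) {y : ℝ} (hy : y ≠ 0) (t : ℝ) :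
    stripSlope a (y, t) = (t - foot a (y ^ 2 / 2, t)) * (2 / y ^ 2) := by
  have := ha.foot_add (y ^ 2 / 2, t)
  have e : t - foot a (y ^ 2 / 2, t) = y ^ 2 / 2 * burgers a (y ^ 2 / 2, t) := by
    simp only at this
    linarith
  rw [e, stripSlope]
  field_simp

theorem IsProfile.stripSlope_mono {a : ℝ → ℝ} (ha : IsProfile a) (y : ℝ) :
    Monotone fun t => stripSlope a (y, t) :=
  fun _ _ h => ha.mono (ha.foot_le_foot (by positivity) h)

/-- In α = 2 (t - τ) / y² both α and τ are nondecreasing in t, so the increment of α is at most that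
of t times 2 / y². -/
theorem IsProfile.lipschitz_stripSlope {a : ℝ → ℝ} (ha : IsProfile a) {y : ℝ} (hy : y ≠ 0) :
    LipschitzWith (2 / y ^ 2).toNNReal fun t => stripSlope a (y, t) := by
  refine LipschitzWith.of_dist_le_mul fun s t => ?_
  rw [Real.coe_toNNReal _ (by positivity)]
  wlog h : s ≤ t generalizing s t
  · rw [dist_comm, dist_comm s t]; exact this t s (le_of_not_ge h)
  have h1 := ha.stripSlope_mono y h
  have h2 := ha.foot_le_foot (m := y ^ 2 / 2) (by positivity) h
  simp only at h1
  rw [dist_comm, dist_comm s t, Real.dist_eq, Real.dist_eq, abs_of_nonneg (by linarith),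
    abs_of_nonneg (by linarith), ha.stripSlope_eq hy, ha.stripSlope_eq hy, mul_comm (2 / y ^ 2),
    ← sub_mul]
  exact mul_le_mul_of_nonneg_right (by linarith) (by positivity)

/-- Over the Cantor set the foot has zero derivative almost everywhere, so α = 2 (t - τ) / y² has
derivative 2 / y² there; elsewhere α is locally constant. -/
theorem ae_hasDerivAt_stripSlope {y : ℝ} (hy : y ≠ 0) :
    ∀ᵐ t : ℝ, HasDerivAt (fun t => stripSlope cantorStaircase (y, t)) (slopeDeriv (y, t)) t := by
  have ha := isProfile_cantorStaircase
  set τ : ℝ → ℝ := fun t => foot cantorStaircase (y ^ 2 / 2, t) with hτ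
  have hmono : Monotone τ := fun _ _ h => ha.foot_le_foot (by positivity) h
  have hcont : Continuous τ :=
    ha.continuous_stripFoot.comp (f := fun t : ℝ => (y, t)) (by fun_prop)
  let S : Set ℝ := {t | DifferentiableAt ℝ τ t} ∩ τ ⁻¹' cantorSet
  have hS : MeasurableSet S := (measurableSet_of_differentiableAt ℝ τ).inter
    (isClosed_cantorSet.preimage hcont).measurableSet
  -- By the area formula for monotone functions, the integral of τ' over `S` is the measure of τ(S),
  -- a subset of the null Cantor set.
  have hvol : ∫⁻ t in S, ENNReal.ofReal (deriv τ t) = 0 := by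
    rw [lintegral_deriv_eq_volume_image_of_monotoneOn hS
      (fun t ht => ht.1.hasDerivAt.hasDerivWithinAt) (hmono.monotoneOn S)]
    exact measure_mono_null (image_subset_iff.2 inter_subset_right) volume_cantorSet
  rw [lintegral_eq_zero_iff (by fun_prop), EventuallyEq, ae_restrict_iff' hS] at hvol
  filter_upwards [hmono.ae_differentiableAt, hvol] with t hd h0
  by_cases ht : (y, t) ∈ stripCantor
  · have h1 : deriv τ t = 0 :=
      le_antisymm (ENNReal.ofReal_eq_zero.1 (h0 ⟨hd, ht⟩)) hmono.deriv_nonneg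
    have h2 : HasDerivAt τ 0 t := h1 ▸ hd.hasDerivAt
    have h3 := ((hasDerivAt_id t).sub h2).mul_const (2 / y ^ 2)
    simp only [slopeDeriv, indicator_of_mem ht]
    refine (h3.congr_deriv (by simp)).congr_of_eventuallyEq (Eventually.of_forall fun s => ?_)
    simp only [ha.stripSlope_eq hy, hτ, id, Pi.sub_apply]
  · simp only [slopeDeriv, indicator_of_notMem ht]
    refine (hasDerivAt_const t (stripSlope cantorStaircase (y, t))).congr_of_eventuallyEq ?_
    have hc : ContinuousAt (fun s : ℝ => (y, s)) t := by fun_prop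
    exact hc.eventually (stripSlope_cantor_eventually_eq ht)

theorem lintegral_slopeDeriv_le {y : ℝ} (hy : y ≠ 0) :
    ∫⁻ t, ENNReal.ofReal (slopeDeriv (y, t)) ≤ 1 := by
  have ha := isProfile_cantorStaircase
  have hmono := ha.stripSlope_mono y
  let S : Set ℝ := {t | DifferentiableAt ℝ (fun t => stripSlope cantorStaircase (y, t)) t}
  have hS : MeasurableSet S := measurableSet_of_differentiableAt ℝ _
  have hSu : (volume : Measure ℝ).restrict S = volume := by
    rw [Measure.restrict_eq_self_of_ae_mem]
    exact hmono.ae_differentiableAt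
  calc ∫⁻ t, ENNReal.ofReal (slopeDeriv (y, t))
      = ∫⁻ t, ENNReal.ofReal (deriv (fun t => stripSlope cantorStaircase (y, t)) t) := by
        refine lintegral_congr_ae ?_
        filter_upwards [ae_hasDerivAt_stripSlope hy] with t ht
        rw [ht.deriv]
    _ = ∫⁻ t in S, ENNReal.ofReal (deriv (fun t => stripSlope cantorStaircase (y, t)) t) := by
        rw [hSu]
    _ = volume ((fun t => stripSlope cantorStaircase (y, t)) '' S) :=
        lintegral_deriv_eq_volume_image_of_monotoneOn hS
          (fun t ht => (DifferentiableAt.hasDerivAt ht).hasDerivWithinAt) (hmono.monotoneOn S)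
    _ ≤ volume (Icc (0 : ℝ) 1) :=
        measure_mono (image_subset_iff.2 fun t _ => ha.stripSlope_mem (y, t))
    _ = 1 := by simp

/-- The bound 2 / y² is not integrable near y = 0; what works is Tonelli with mass at most 1 on each
vertical line y ≠ 0. -/
theorem integrableOn_slopeDeriv {R : ℝ} :
    IntegrableOn slopeDeriv (Icc (-R) R ×ˢ univ) := by
  refine ⟨measurable_slopeDeriv.aestronglyMeasurable, ?_⟩
  rw [hasFiniteIntegral_iff_ofReal (Eventually.of_forall slopeDeriv_nonneg), Measure.volume_eq_prod,
    ← Measure.prod_restrict, lintegral_prod _ measurable_slopeDeriv.ennreal_ofReal.aemeasurable]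
  calc ∫⁻ y in Icc (-R) R, ∫⁻ t in univ, ENNReal.ofReal (slopeDeriv (y, t))
      ≤ ∫⁻ y in Icc (-R) R, 1 := by
        refine lintegral_mono_ae (ae_restrict_of_ae ?_)
        filter_upwards [Measure.ae_ne volume (0 : ℝ)] with y hy
        rw [Measure.restrict_univ]
        exact lintegral_slopeDeriv_le hy
    _ < ⊤ := by simp

theorem integrable_slopeDeriv_mul {g : ℝ × ℝ → ℝ} (hg : Continuous g) (hc : HasCompactSupport g) :
    Integrable fun p => slopeDeriv p * g p := by
  obtain ⟨R, hR⟩ : ∃ R : ℝ, tsupport g ⊆ Icc (-R) R ×ˢ univ := by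
    obtain ⟨R, hR⟩ := hc.isCompact.isBounded.subset_closedBall 0
    refine ⟨R, fun p hp => ?_⟩
    have := hR hp
    rw [mem_closedBall_zero_iff, Prod.norm_def] at this
    exact ⟨abs_le.1 ((le_max_left _ _).trans this), mem_univ _⟩
  obtain ⟨c, hc'⟩ := hg.bounded_above_of_compact_support hc
  have h := (integrableOn_slopeDeriv (R := R)).mul_bdd (c := c) hg.aestronglyMeasurable
    (Eventually.of_forall hc')
  refine (integrableOn_iff_integrable_of_support_subset fun p hp => hR ?_).1 h
  exact subset_tsupport _ (right_ne_zero_of_mul hp)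

/-- Integration by parts in `t` for functions of the slope. -/
theorem integral_slope_mul_fderiv {h h' : ℝ → ℝ} (hh : ∀ x, HasDerivAt h (h' x) x)
    (hc : Continuous h') {ψ : ℝ × ℝ → ℝ} (hψ : IsTestFunction univ ψ) :
    ∫ p, h (stripSlope cantorStaircase p) * fderiv ℝ ψ p (0, 1) =
      - ∫ p, slopeDeriv p * (h' (stripSlope cantorStaircase p) * ψ p) := by
  have ha := isProfile_cantorStaircase
  have hα := ha.continuous_stripSlope
  have hhc : Continuous h := continuous_iff_continuousAt.2 fun x => (hh x).continuousAt
  have hi1 := hψ.integrable_mul_fderiv (μ := volume) (V := fun _ => ((0 : ℝ), (1 : ℝ)))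
    (hhc.comp hα) continuous_const
  have hi2 := integrable_slopeDeriv_mul ((hc.comp hα).mul hψ.continuous) hψ.2.1.mul_left
  simp only [Function.comp_apply, Pi.mul_apply] at hi1 hi2
  rw [Measure.volume_eq_prod] at hi1 hi2 ⊢
  rw [integral_prod _ hi1, integral_prod _ hi2, ← integral_neg]
  refine integral_congr_ae ?_
  filter_upwards [Measure.ae_ne volume (0 : ℝ)] with y hy
  obtain ⟨c, hc'⟩ := isCompact_Icc.exists_bound_of_continuousOn (s := Icc (0 : ℝ) 1)
    hc.continuousOn
  -- Only the range [0, 1] of the slope matters, so continuity of h' is enough for h(α(y, ·)) to be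
  -- Lipschitz; integration by parts for Lipschitz functions then applies on each line y ≠ 0.
  have hlip : LipschitzOnWith c.toNNReal h (Icc 0 1) :=
    (convex_Icc 0 1).lipschitzOnWith_of_nnnorm_hasDerivWithin_le
      (fun x _ => (hh x).hasDerivWithinAt) fun x hx => by
        rw [← NNReal.coe_le_coe, coe_nnnorm]
        exact (hc' x hx).trans (Real.le_coe_toNNReal c)
  have hl1 : LipschitzWith _ fun t => h (stripSlope cantorStaircase (y, t)) :=
    lipschitzOnWith_univ.1 (hlip.comp ((ha.lipschitz_stripSlope hy).lipschitzOnWith (s := univ))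
      fun t _ => ha.stripSlope_mem (y, t))
  have hψy : ContDiff ℝ 1 fun t => ψ (y, t) :=
    (hψ.1.of_le (by simp)).comp (contDiff_const.prodMk contDiff_id)
  have hcs : HasCompactSupport fun t => ψ (y, t) := by
    refine hψ.2.1.comp_isClosedEmbedding (g := fun t : ℝ => (y, t)) ?_
    exact (Isometry.of_dist_eq fun s t => by simp [Prod.dist_eq]).isClosedEmbedding
  obtain ⟨K, hl2⟩ := hψy.lipschitzWith_of_hasCompactSupport hcs one_ne_zero
  have key := hl1.integral_lineDeriv_mul_eq (μ := volume) hl2 hcs 1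
  have e1 : ∀ᵐ t : ℝ, lineDeriv ℝ (fun t => h (stripSlope cantorStaircase (y, t))) t 1 =
      slopeDeriv (y, t) * h' (stripSlope cantorStaircase (y, t)) := by
    filter_upwards [ae_hasDerivAt_stripSlope hy] with t ht
    have h0 : HasDerivAt (fun t => h (stripSlope cantorStaircase (y, t))) _ t := (hh _).comp t ht
    have h1 := h0.hasFDerivAt.hasLineDerivAt 1
    rw [HasLineDerivAt.lineDeriv h1]
    simp [mul_comm]
  have e2 : ∀ t : ℝ, lineDeriv ℝ (fun t => ψ (y, t)) t (-1) = - fderiv ℝ ψ (y, t) (0, 1) := by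
    intro t
    have h1 : HasDerivAt (fun t => ψ (y, t)) (fderiv ℝ ψ (y, t) (0, 1)) t :=
      (hψ.differentiable (y, t)).hasFDerivAt.comp_hasDerivAt t
        ((hasDerivAt_const t y).prodMk (hasDerivAt_id t))
    rw [HasLineDerivAt.lineDeriv (h1.hasFDerivAt.hasLineDerivAt (-1))]
    simp
  have e3 : ∫ t, slopeDeriv (y, t) * (h' (stripSlope cantorStaircase (y, t)) * ψ (y, t)) =
      ∫ t, lineDeriv ℝ (fun t => h (stripSlope cantorStaircase (y, t))) t 1 * ψ (y, t) := by
    refine integral_congr_ae ?_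
    filter_upwards [e1] with t ht
    rw [ht, mul_assoc]
  rw [e3, key, ← integral_neg]
  refine integral_congr_ae (Eventually.of_forall fun t => ?_)
  simp only [e2]
  ring

/-! ### The graphical strip as a function -/

theorem IsProfile.isGraphicalStrip_stripFun {a : ℝ → ℝ} (ha : IsProfile a) :
    IsGraphicalStrip a (stripFun a) := fun s τ => by
  have h := ha.foot_eq (m := s ^ 2 / 2) (by positivity) τ
  have e : τ + s ^ 2 / 2 * a τ = a τ * s ^ 2 / 2 + τ := by ring
  rw [e] at h
  rw [stripFun, stripSlope, burgers, h, mul_comm]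

/-- Every point of the plane lies on the parabola through its foot, so the defining relation
prescribes the value there. -/
theorem IsProfile.eq_stripFun {a : ℝ → ℝ} (ha : IsProfile a) {g : ℝ × ℝ → ℝ}
    (hg : IsGraphicalStrip a g) : g = stripFun a := by
  ext p
  have h := hg p.1 (foot a (p.1 ^ 2 / 2, p.2))
  have e := ha.foot_add (p.1 ^ 2 / 2, p.2)
  simp only [burgers] at e
  rw [show a (foot a (p.1 ^ 2 / 2, p.2)) * p.1 ^ 2 / 2 + foot a (p.1 ^ 2 / 2, p.2) = p.2 by
    linarith] at h
  rw [h, stripFun, stripSlope, burgers, mul_comm]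

theorem LipschitzOnWith.congr_of_eqOn {X Y : Type*} [PseudoEMetricSpace X] [PseudoEMetricSpace Y]
    {K : NNReal} {f g : X → Y} {s : Set X} (hf : LipschitzOnWith K f s) (h : EqOn g f s) :
    LipschitzOnWith K g s := fun x hx y hy => by
  rw [h hx, h hy]
  exact hf hx hy

/-- Here f = 2 (t - τ) / y, a smooth function of (y, t, τ) near y ≠ 0, and the foot is locally
Lipschitz even though a is not. -/
theorem exists_lipschitzOnWith_stripFun_of_ne {p : ℝ × ℝ} (hp : p.1 ≠ 0) :
    ∃ K, ∃ U ∈ 𝓝 p, LipschitzOnWith K (stripFun cantorStaircase) U := by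
  have ha := isProfile_cantorStaircase
  let g : ℝ × ℝ → ℝ × ℝ := fun q => (q.1 ^ 2 / 2, q.2)
  let τ : ℝ × ℝ → ℝ := fun q => foot cantorStaircase (g q)
  obtain ⟨K₁, U₁, hU₁, hl₁⟩ : ∃ K, ∃ U ∈ 𝓝 p, LipschitzOnWith K g U :=
    ContDiffAt.exists_lipschitzOnWith (by fun_prop)
  have hτ : LipschitzOnWith (2 * K₁) τ U₁ := by
    refine LipschitzOnWith.of_dist_le_mul fun q hq q' hq' => ?_
    have h1 := ha.abs_foot_sub_le (p := g q) (q := g q') (by simp only [g]; positivity)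
      (by simp only [g]; positivity)
    have h2 := hl₁.dist_le_mul q hq q' hq'
    rw [Prod.dist_eq (x := g q), Real.dist_eq, Real.dist_eq] at h2
    rw [Real.dist_eq, NNReal.coe_mul, NNReal.coe_ofNat]
    have h3 := le_max_left |(g q).1 - (g q').1| |(g q).2 - (g q').2|
    have h4 := le_max_right |(g q).1 - (g q').1| |(g q).2 - (g q').2|
    simp only [τ]
    linarith
  let F : (ℝ × ℝ) × ℝ → ℝ := fun r => 2 * (r.1.2 - r.2) / r.1.1
  obtain ⟨K₂, V, hV, hl₂⟩ : ∃ K, ∃ V ∈ 𝓝 (p, τ p), LipschitzOnWith K F V := by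
    refine ContDiffAt.exists_lipschitzOnWith (𝕂 := ℝ) ?_
    exact ContDiffAt.div (by fun_prop) (by fun_prop) hp
  have hpair := (LipschitzWith.id.lipschitzOnWith (s := U₁)).prodMk hτ
  have hc : ContinuousAt (fun q => (q, τ q)) p :=
    (continuous_id.prodMk ha.continuous_stripFoot).continuousAt
  refine ⟨_, (U₁ ∩ (fun q => (q, τ q)) ⁻¹' V) ∩ {q | q.1 ≠ 0},
    inter_mem (inter_mem hU₁ (hc hV)) (continuous_fst.continuousAt.eventually_ne hp),
    LipschitzOnWith.congr_of_eqOn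
      (hl₂.comp (hpair.mono (inter_subset_left.trans inter_subset_left)) fun q hq => hq.1.2)
      fun q hq => ?_⟩
  obtain ⟨y, t⟩ := q
  have hy : y ≠ 0 := hq.2
  simp only [Function.comp, F, stripFun, ha.stripSlope_eq hy, τ, g, id]
  field_simp

theorem locallyLipschitzOn_stripFun :
    LocallyLipschitzOn (({(0 : ℝ)} : Set ℝ) ×ˢ cantorSet)ᶜ (stripFun cantorStaircase) := by
  intro p hp
  suffices ∃ K, ∃ U ∈ 𝓝 p, LipschitzOnWith K (stripFun cantorStaircase) U by
    obtain ⟨K, U, hU, h⟩ := this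
    exact ⟨K, U, mem_nhdsWithin_of_mem_nhds hU, h⟩
  by_cases h0 : p.1 = 0
  -- On y = 0 the foot of (0, t) is t itself, which is off the Cantor set; the slope is then locally
  -- constant and f is linear near p.
  · have hp' : p ∉ stripCantor := fun h => hp ⟨h0, by
      have e := isProfile_cantorStaircase.foot_eq le_rfl p.2
      simp only [zero_mul, add_zero] at e
      simpa [stripCantor, h0, e] using h⟩
    have hl : LipschitzWith _ fun q : ℝ × ℝ => q.1 * stripSlope cantorStaircase p :=
      ((LinearMap.mulRight ℝ (stripSlope cantorStaircase p)).toContinuousLinearMap.comp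
        (ContinuousLinearMap.fst ℝ ℝ ℝ)).lipschitz
    refine ⟨_, _, stripSlope_cantor_eventually_eq hp',
      LipschitzOnWith.congr_of_eqOn hl.lipschitzOnWith fun q hq => ?_⟩
    rw [stripFun, show stripSlope cantorStaircase q = _ from hq]
  · exact exists_lipschitzOnWith_stripFun_of_ne h0

/-! ### Weak derivatives -/

theorem MemLpLoc.of_continuous {p : ENNReal} {u : ℝ × ℝ → ℝ} (hu : Continuous u) :
    MemLpLoc p u := fun K hK => by
  obtain ⟨c, hc⟩ := hK.exists_bound_of_continuousOn hu.continuousOn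
  have : IsFiniteMeasure (volume.restrict K) := ⟨by simpa using hK.measure_lt_top⟩
  exact MemLp.of_bound hu.aestronglyMeasurable c
    ((ae_restrict_iff' hK.measurableSet).2 (Eventually.of_forall hc))

theorem MemLpLoc.mono {p q : ENNReal} {u : ℝ × ℝ → ℝ} (hu : MemLpLoc q u) (h : p ≤ q) :
    MemLpLoc p u := fun K hK => by
  have : IsFiniteMeasure (volume.restrict K) := ⟨by simpa using hK.measure_lt_top⟩
  exact (hu K hK).mono_exponent h

theorem MemLpLoc.locallyIntegrable {p : ENNReal} {u : ℝ × ℝ → ℝ} (hu : MemLpLoc p u)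
    (h : 1 ≤ p) : LocallyIntegrable u :=
  locallyIntegrable_iff.2 fun K hK => memLp_one_iff_integrable.1 (hu.mono h K hK)

theorem MemW1pLoc.mono {p q : ENNReal} {u : ℝ × ℝ → ℝ} (hu : MemW1pLoc q u) (h : p ≤ q) :
    MemW1pLoc p u := by
  obtain ⟨h0, g₁, g₂, h1, h2, h3, h4⟩ := hu
  exact ⟨h0.mono h, g₁, g₂, h1, h2, h3.mono h, h4.mono h⟩

section WeakDeriv

variable {v : ℝ × ℝ} {f g f' g' φ : ℝ × ℝ → ℝ}

theorem integrable_mul_of_locallyIntegrable (hf : LocallyIntegrable f) (hφ : Continuous φ)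
    (hc : HasCompactSupport φ) : Integrable fun p => f p * φ p := by
  have := hf.integrable_smul_right_of_hasCompactSupport hφ hc
  simpa [mul_comm] using this

theorem HasWeakDeriv.add_const_mul (h : HasWeakDeriv v f f') (h' : HasWeakDeriv v g g') (ε : ℝ) :
    HasWeakDeriv v (fun p => f p + ε * g p) (fun p => f' p + ε * g' p) := by
  refine ⟨h.1.add (h'.1.smul ε), h.2.1.add (h'.2.1.smul ε), fun φ hφ => ?_⟩
  have hφ' := hφ.fderiv_apply v
  have i1 := integrable_mul_of_locallyIntegrable h.1 hφ'.continuous hφ'.2.1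
  have i2 := integrable_mul_of_locallyIntegrable h'.1 hφ'.continuous hφ'.2.1
  have i3 := integrable_mul_of_locallyIntegrable h.2.1 hφ.continuous hφ.2.1
  have i4 := integrable_mul_of_locallyIntegrable h'.2.1 hφ.continuous hφ.2.1
  simp only [add_mul, mul_assoc]
  rw [integral_add i1 (i2.const_mul ε), integral_add i3 (i4.const_mul ε), integral_const_mul,
    integral_const_mul, h.2.2 φ hφ, h'.2.2 φ hφ]
  ring

theorem IsTestFunction.hasWeakDeriv (hφ : IsTestFunction univ φ) (v : ℝ × ℝ) :
    HasWeakDeriv v φ (fun p => fderiv ℝ φ p v) := by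
  refine ⟨hφ.continuous.locallyIntegrable, (hφ.fderiv_apply v).continuous.locallyIntegrable,
    fun ψ hψ => hψ.integral_mul_fderiv (hφ.1.of_le (by simp)) v⟩

theorem HasWeakDeriv.ae_eq (h : HasWeakDeriv v f g) (h' : HasWeakDeriv v f g') : g =ᵐ[volume] g' := by
  refine ae_eq_of_integral_contDiff_smul_eq h.2.1 h'.2.1 fun φ h1 h2 => ?_
  have e1 := h.2.2 φ (.of_compactSupport h1 h2)
  have e2 := h'.2.2 φ (.of_compactSupport h1 h2)
  simp only [smul_eq_mul, mul_comm (φ _)]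
  linarith

theorem HasWeakDeriv.weakDeriv_ae_eq (h : HasWeakDeriv v f g) : weakDeriv v f =ᵐ[volume] g := by
  have hex : ∃ g, HasWeakDeriv v f g := ⟨g, h⟩
  rw [weakDeriv, dif_pos hex]
  exact hex.choose_spec.ae_eq h

end WeakDeriv

/-! ### Sobolev regularity of the graphical strip -/

theorem integrableOn_slopeDeriv_of_isCompact {K : Set (ℝ × ℝ)} (hK : IsCompact K) :
    IntegrableOn slopeDeriv K := by
  obtain ⟨R, hR⟩ := hK.isBounded.subset_closedBall 0
  refine (integrableOn_slopeDeriv (R := R)).mono_set fun p hp => ?_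
  have := hR hp
  rw [mem_closedBall_zero_iff, Prod.norm_def] at this
  exact ⟨abs_le.1 ((le_max_left _ _).trans this), mem_univ _⟩

/-- The square g² y² β² equals 2 g² β, which is locally integrable. -/
theorem memLpLoc_mul_slopeDeriv {g : ℝ × ℝ → ℝ} (hg : Continuous g) :
    MemLpLoc 2 fun p => g p * (p.1 * slopeDeriv p) := fun K hK => by
  have hm : Measurable fun p : ℝ × ℝ => g p * (p.1 * slopeDeriv p) :=
    hg.measurable.mul (measurable_fst.mul measurable_slopeDeriv)
  rw [memLp_two_iff_integrable_sq hm.aestronglyMeasurable]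
  have h : IntegrableOn (fun p => (2 * g p ^ 2) * slopeDeriv p) K :=
    (integrableOn_slopeDeriv_of_isCompact hK).continuousOn_mul (by fun_prop) hK
  refine h.congr (Eventually.of_forall fun p => ?_)
  simp only
  linear_combination (-g p ^ 2) * sq_mul_slopeDeriv_sq p

/-- The weak derivative in `t` of the graphical strip of the Cantor staircase. -/
noncomputable def stripDerivT (p : ℝ × ℝ) : ℝ := p.1 * slopeDeriv p

theorem fderiv_fst_mul {φ : ℝ × ℝ → ℝ} {p : ℝ × ℝ} (hφ : DifferentiableAt ℝ φ p) (v : ℝ × ℝ) :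
    fderiv ℝ (fun q : ℝ × ℝ => q.1 * φ q) p v = v.1 * φ p + p.1 * fderiv ℝ φ p v := by
  have h : fderiv ℝ (fun q : ℝ × ℝ => q.1 * φ q) p = _ :=
    ((hasFDerivAt_fst (𝕜 := ℝ) (E := ℝ) (F := ℝ) (p := p)).mul hφ.hasFDerivAt).fderiv
  rw [h]
  simp
  ring

theorem hasDerivAt_half_sq (x : ℝ) : HasDerivAt (fun x : ℝ => x ^ 2 / 2) x x := by
  simpa using (hasDerivAt_pow 2 x).div_const 2

theorem hasWeakDeriv_stripFun_snd :
    HasWeakDeriv (0, 1) (stripFun cantorStaircase) stripDerivT := by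
  refine ⟨isProfile_cantorStaircase.continuous_stripFun.locallyIntegrable, ?_, fun φ hφ => ?_⟩
  · have := memLpLoc_mul_slopeDeriv (continuous_const (y := (1 : ℝ)))
    simp only [one_mul] at this
    exact this.locallyIntegrable (by norm_num)
  · have h := integral_slope_mul_fderiv (h := id) (h' := fun _ => 1) hasDerivAt_id
      continuous_const (hφ.mul_left contDiff_fst)
    simp only [fderiv_fst_mul (hφ.differentiable _), id, zero_mul, zero_add, one_mul] at h
    simp only [stripFun, stripDerivT]
    refine (integral_congr_ae (Eventually.of_forall fun p => ?_)).trans (h.trans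
      (congrArg _ (integral_congr_ae (Eventually.of_forall fun p => ?_)))) <;> (try simp only) <;> ring

/-- This is the law with B = id, M = x²/2, tested against y φ; the derivative of the extra factor y
produces the source term α. -/
theorem integral_stripFun_conservation {φ : ℝ × ℝ → ℝ} (hφ : IsTestFunction univ φ) :
    ∫ p, (stripFun cantorStaircase p * fderiv ℝ φ p (1, 0) +
      stripFun cantorStaircase p ^ 2 / 2 * fderiv ℝ φ p (0, 1)) =
        - ∫ p, stripSlope cantorStaircase p * φ p := by
  have h := conservation_law (B := id) (M := fun x => x ^ 2 / 2) (b := fun _ => 1) contDiff_id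
    (by fun_prop) hasDerivAt_id (fun x => by simpa using hasDerivAt_half_sq x)
    (hφ.mul_left contDiff_fst)
  have hα := isProfile_cantorStaircase.continuous_stripSlope
  have hf := isProfile_cantorStaircase.continuous_stripFun
  rw [eq_neg_iff_add_eq_zero, ← integral_add _ (hφ.integrable_mul hα)]
  · refine Eq.trans ?_ h
    refine integral_congr_ae (Eventually.of_forall fun p => ?_)
    simp only [fderiv_fst_mul (hφ.differentiable _), id, stripFun]
    ring
  · exact (hφ.integrable_mul_fderiv hf continuous_const).add
      (hφ.integrable_mul_fderiv (g := fun p => stripFun cantorStaircase p ^ 2 / 2)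
        (by fun_prop) continuous_const)

theorem isIntrinsicC1_stripFun : IsIntrinsicC1 (stripFun cantorStaircase) :=
  ⟨isProfile_cantorStaircase.continuous_stripFun, _,
    isProfile_cantorStaircase.continuous_stripSlope, fun _ hφ => integral_stripFun_conservation hφ⟩

/-- The weak derivative in `y` of the graphical strip of the Cantor staircase. -/
noncomputable def stripDerivY (p : ℝ × ℝ) : ℝ :=
  stripSlope cantorStaircase p - stripFun cantorStaircase p * stripDerivT p

theorem memLpLoc_stripDerivT : MemLpLoc 2 stripDerivT := by
  have := memLpLoc_mul_slopeDeriv (continuous_const (y := (1 : ℝ)))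
  simp only [one_mul] at this
  exact this

theorem memLpLoc_stripDerivY : MemLpLoc 2 stripDerivY := fun K hK =>
  (MemLpLoc.of_continuous isProfile_cantorStaircase.continuous_stripSlope K hK).sub
    (memLpLoc_mul_slopeDeriv isProfile_cantorStaircase.continuous_stripFun K hK)

theorem hasWeakDeriv_stripFun_fst :
    HasWeakDeriv (1, 0) (stripFun cantorStaircase) stripDerivY := by
  have hα := isProfile_cantorStaircase.continuous_stripSlope
  have hf := isProfile_cantorStaircase.continuous_stripFun
  refine ⟨hf.locallyIntegrable, memLpLoc_stripDerivY.locallyIntegrable (by norm_num),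
    fun φ hφ => ?_⟩
  have h1 := integral_stripFun_conservation hφ
  -- The weak chain rule ∂_t (f²/2) = f f_t, obtained from h = x²/2 and the test function y² φ.
  have h2 := integral_slope_mul_fderiv hasDerivAt_half_sq continuous_id
    ((hφ.mul_left contDiff_fst).mul_left contDiff_fst)
  have h2' : ∫ p, stripFun cantorStaircase p ^ 2 / 2 * fderiv ℝ φ p (0, 1) =
      - ∫ p, stripFun cantorStaircase p * stripDerivT p * φ p := by
    refine (integral_congr_ae (Eventually.of_forall fun p => ?_)).trans (h2.trans
      (congrArg _ (integral_congr_ae (Eventually.of_forall fun p => ?_))))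
    · simp only [fderiv_fst_mul ((hφ.mul_left contDiff_fst).differentiable _),
        fderiv_fst_mul (hφ.differentiable _), stripFun]
      ring
    · simp only [stripFun, stripDerivT]
      ring
  have i1 := hφ.integrable_mul_fderiv (μ := volume) (V := fun _ => ((1 : ℝ), (0 : ℝ))) hf
    continuous_const
  have i2 := hφ.integrable_mul_fderiv (μ := volume) (V := fun _ => ((0 : ℝ), (1 : ℝ)))
    (g := fun p => stripFun cantorStaircase p ^ 2 / 2) (by fun_prop) continuous_const
  have i3 := hφ.integrable_mul (μ := volume) hα
  have i4 : Integrable fun p => stripFun cantorStaircase p * stripDerivT p * φ p :=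
    integrable_mul_of_locallyIntegrable
    ((memLpLoc_mul_slopeDeriv hf).locallyIntegrable (by norm_num)) hφ.continuous hφ.2.1
  rw [integral_add i1 i2, h2'] at h1
  simp only [stripDerivY, sub_mul]
  rw [integral_sub i3 i4]
  linarith

theorem memW1pLoc_stripFun : MemW1pLoc 2 (stripFun cantorStaircase) :=
  ⟨MemLpLoc.of_continuous isProfile_cantorStaircase.continuous_stripFun, _, _,
    hasWeakDeriv_stripFun_fst, hasWeakDeriv_stripFun_snd, memLpLoc_stripDerivY,
    memLpLoc_stripDerivT⟩

/-! ### The graphical strip is not an intrinsic plane -/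

theorem mem_intrinsicGraph_of_isGraphicalStrip {a : ℝ → ℝ} {f : ℝ × ℝ → ℝ}
    (hf : IsGraphicalStrip a f) (s τ : ℝ) : (a τ * s, s, τ) ∈ intrinsicGraph f := by
  refine ⟨s, a τ * s ^ 2 / 2 + τ, ?_⟩
  rw [hf s τ]
  simp only [heisMul, Prod.mk.injEq]
  refine ⟨by ring, by ring, by ring⟩

/-- The graph contains (0,0,0), (0,1,0), (0,0,1) and (1,1,1), because a(0) = 0 and a(1) = 1. Left
translations are affine, so these points cannot lie in a translate of a two-dimensional subspace. -/
theorem not_isIntrinsicPlane_of_isGraphicalStrip {f : ℝ × ℝ → ℝ}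
    (hf : IsGraphicalStrip cantorStaircase f) : ¬ IsIntrinsicPlane (intrinsicGraph f) := by
  rintro ⟨V, hdim, -, p, hS⟩
  have hmem : ∀ s τ, ∃ v ∈ V, heisMul p v = (cantorStaircase τ * s, s, τ) := fun s τ => by
    have := mem_intrinsicGraph_of_isGraphicalStrip hf s τ
    rwa [hS] at this
  have a0 : cantorStaircase 0 = 0 := cantorStaircase_of_nonpos le_rfl
  have a1 : cantorStaircase 1 = 1 := cantorStaircase_of_one_le le_rfl
  obtain ⟨v0, h0, e0⟩ := hmem 0 0
  obtain ⟨v1, h1, e1⟩ := hmem 1 0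
  obtain ⟨v2, h2, e2⟩ := hmem 0 1
  obtain ⟨v3, h3, e3⟩ := hmem 1 1
  simp only [a0, a1, heisMul, Prod.mk.injEq] at e0 e1 e2 e3
  have k1 : ((0, 1, -p.1 / 2) : ℝ × ℝ × ℝ) ∈ V := by
    convert V.sub_mem h1 h0 using 1
    ext <;> simp
    · linarith
    · linarith
    · linear_combination -(e1.2.2 - e0.2.2) + p.1 / 2 * (e1.2.1 - e0.2.1)
        - p.2.1 / 2 * (e1.1 - e0.1)
  have k2 : ((0, 0, 1) : ℝ × ℝ × ℝ) ∈ V := by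
    convert V.sub_mem h2 h0 using 1
    ext <;> simp
    · linarith
    · linarith
    · linear_combination -(e2.2.2 - e0.2.2) + p.1 / 2 * (e2.2.1 - e0.2.1)
        - p.2.1 / 2 * (e2.1 - e0.1)
  have k3 : ((1, 1, 1 + (p.2.1 - p.1) / 2) : ℝ × ℝ × ℝ) ∈ V := by
    convert V.sub_mem h3 h0 using 1
    ext <;> simp
    · linarith
    · linarith
    · linear_combination -(e3.2.2 - e0.2.2) + p.1 / 2 * (e3.2.1 - e0.2.1)
        - p.2.1 / 2 * (e3.1 - e0.1)
  have htop : V = ⊤ := by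
    refine eq_top_iff.2 fun q _ => ?_
    have := V.add_mem (V.add_mem (V.smul_mem q.1 k3) (V.smul_mem (q.2.1 - q.1) k1))
      (V.smul_mem (q.2.2 - q.1 * (1 + (p.2.1 - p.1) / 2) + (q.2.1 - q.1) * (p.1 / 2)) k2)
    convert this using 1
    ext <;> simp
    ring
  rw [htop, finrank_top] at hdim
  simp at hdim

/-! ### The area integrand -/

/-- The area integrand `√(1 + x²)`. -/
noncomputable def areaFun (x : ℝ) : ℝ := √(1 + x ^ 2)

/-- The derivative of the area integrand. -/
noncomputable def areaFun' (x : ℝ) : ℝ := x / areaFun x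

/-- The second derivative of the area integrand. -/
noncomputable def areaFun'' (x : ℝ) : ℝ := 1 / areaFun x ^ 3

theorem areaFun_pos (x : ℝ) : 0 < areaFun x := Real.sqrt_pos.2 (by positivity)

theorem areaFun_sq (x : ℝ) : areaFun x ^ 2 = 1 + x ^ 2 := Real.sq_sqrt (by positivity)

theorem one_le_areaFun (x : ℝ) : 1 ≤ areaFun x := by
  rw [areaFun, Real.one_le_sqrt]
  nlinarith [sq_nonneg x]

theorem abs_le_areaFun (x : ℝ) : |x| ≤ areaFun x :=
  Real.abs_le_sqrt (by linarith)

theorem areaFun_le (x : ℝ) : areaFun x ≤ 1 + |x| := by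
  rw [areaFun, Real.sqrt_le_left (by positivity)]
  nlinarith [abs_nonneg x, sq_abs x]

theorem contDiff_areaFun : ContDiff ℝ ∞ areaFun := by
  refine ContDiff.sqrt (by fun_prop) fun x => ?_
  positivity

theorem contDiff_areaFun' : ContDiff ℝ ∞ areaFun' :=
  contDiff_id.div contDiff_areaFun fun x => (areaFun_pos x).ne'

theorem continuous_areaFun'' : Continuous areaFun'' :=
  continuous_const.div (contDiff_areaFun.continuous.pow 3) fun x => (pow_pos (areaFun_pos x) 3).ne'

theorem hasDerivAt_areaFun (x : ℝ) : HasDerivAt areaFun (areaFun' x) x := by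
  have h := (((hasDerivAt_pow 2 x).const_add 1).sqrt (by positivity))
  refine h.congr_deriv ?_
  simp only [areaFun', areaFun]
  field_simp
  norm_num

theorem hasDerivAt_areaFun' (x : ℝ) : HasDerivAt areaFun' (areaFun'' x) x := by
  have h := (hasDerivAt_id x).div (hasDerivAt_areaFun x) (areaFun_pos x).ne'
  refine h.congr_deriv ?_
  have := areaFun_pos x
  have h2 := areaFun_sq x
  simp only [areaFun'', areaFun', id]
  field_simp
  linear_combination h2

/-- Thus M = -1/S is the flux that belongs to B = S' in `conservation_law`. -/
theorem hasDerivAt_neg_inv_areaFun (x : ℝ) :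
    HasDerivAt (fun x => -(areaFun x)⁻¹) (x * areaFun'' x) x := by
  have h := ((hasDerivAt_areaFun x).inv (areaFun_pos x).ne').neg
  refine h.congr_deriv ?_
  have := areaFun_pos x
  simp only [areaFun'', areaFun']
  field_simp

theorem abs_areaFun'_le (x : ℝ) : |areaFun' x| ≤ 1 := by
  rw [areaFun', abs_div, abs_of_pos (areaFun_pos x), div_le_one (areaFun_pos x)]
  exact abs_le_areaFun x

theorem areaFun''_nonneg (x : ℝ) : 0 ≤ areaFun'' x :=
  div_nonneg zero_le_one (pow_nonneg (areaFun_pos x).le 3)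

theorem areaFun''_le (x : ℝ) : areaFun'' x ≤ 1 := by
  rw [areaFun'', div_le_one (pow_pos (areaFun_pos x) 3)]
  exact one_le_pow₀ (one_le_areaFun x)

/-! ### Variations of the area -/

section Variation

variable {X : Type*} [MeasurableSpace X] {μ : Measure X} {u P Q : X → ℝ}

theorem memLp_perturbation (hu : MemLp u 2 μ) (hP : MemLp P 2 μ) (hQ : MemLp Q 2 μ) (ε : ℝ) :
    MemLp (fun x => u x + ε * P x + ε ^ 2 * Q x) 2 μ :=
  (hu.add (hP.const_mul ε)).add (hQ.const_mul (ε ^ 2))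

variable [IsFiniteMeasure μ]

theorem integrable_areaFun (hu : MemLp u 2 μ) : Integrable (fun x => areaFun (u x)) μ := by
  have h := (integrable_const (1 : ℝ)).add (hu.integrable one_le_two).abs
  refine h.mono' (contDiff_areaFun.continuous.comp_aestronglyMeasurable hu.1)
    (Eventually.of_forall fun x => ?_)
  rw [Real.norm_eq_abs, abs_of_pos (areaFun_pos _)]
  exact areaFun_le _

theorem hasDerivAt_perturbation (a b c ε : ℝ) :
    HasDerivAt (fun ε => a + ε * b + ε ^ 2 * c) (b + 2 * ε * c) ε := by
  have h := (((hasDerivAt_id ε).mul_const b).const_add a).add ((hasDerivAt_pow 2 ε).mul_const c)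
  refine h.congr_deriv ?_
  simp

theorem hasDerivAt_integral_areaFun (hu : MemLp u 2 μ) (hP : MemLp P 2 μ) (hQ : MemLp Q 2 μ)
    (ε : ℝ) :
    HasDerivAt (fun ε => ∫ x, areaFun (u x + ε * P x + ε ^ 2 * Q x) ∂μ)
      (∫ x, areaFun' (u x + ε * P x + ε ^ 2 * Q x) * (P x + 2 * ε * Q x) ∂μ) ε := by
  refine (hasDerivAt_integral_of_dominated_loc_of_deriv_le (Metric.ball_mem_nhds ε one_pos)
    (F' := fun ε x => areaFun' (u x + ε * P x + ε ^ 2 * Q x) * (P x + 2 * ε * Q x))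
    (bound := fun x => |P x| + 2 * (|ε| + 1) * |Q x|)
    (Eventually.of_forall fun ε => (integrable_areaFun (memLp_perturbation hu hP hQ ε)).1)
    (integrable_areaFun (memLp_perturbation hu hP hQ ε)) ?_ ?_ ?_ ?_).2
  · exact (contDiff_areaFun'.continuous.comp_aestronglyMeasurable
      (memLp_perturbation hu hP hQ ε).1).mul (hP.1.add (hQ.1.const_mul (2 * ε)))
  · refine Eventually.of_forall fun x δ hδ => ?_
    have h1 : |δ| ≤ |ε| + 1 := by
      rw [Metric.mem_ball, Real.dist_eq] at hδ
      have := abs_sub_abs_le_abs_sub δ ε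
      linarith
    rw [Real.norm_eq_abs, abs_mul]
    refine (mul_le_of_le_one_left (abs_nonneg _) (abs_areaFun'_le _)).trans ?_
    refine (abs_add_le _ _).trans ?_
    rw [abs_mul, abs_mul, abs_two]
    gcongr
  · exact (hP.integrable one_le_two).abs.add ((hQ.integrable one_le_two).abs.const_mul _)
  · exact Eventually.of_forall fun x δ _ =>
      (hasDerivAt_areaFun _).comp δ (hasDerivAt_perturbation (u x) (P x) (Q x) δ)

theorem hasDerivAt_integral_areaFun' (hu : MemLp u 2 μ) (hP : MemLp P 2 μ) (hQ : MemLp Q 2 μ) :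
    HasDerivAt
      (fun ε => ∫ x, areaFun' (u x + ε * P x + ε ^ 2 * Q x) * (P x + 2 * ε * Q x) ∂μ)
      (∫ x, (areaFun'' (u x) * P x ^ 2 + 2 * areaFun' (u x) * Q x) ∂μ) 0 := by
  have hm : ∀ ε : ℝ, AEStronglyMeasurable
      (fun x => areaFun' (u x + ε * P x + ε ^ 2 * Q x) * (P x + 2 * ε * Q x)) μ := fun ε =>
    (contDiff_areaFun'.continuous.comp_aestronglyMeasurable
      (memLp_perturbation hu hP hQ ε).1).mul (hP.1.add (hQ.1.const_mul (2 * ε)))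
  have h := (hasDerivAt_integral_of_dominated_loc_of_deriv_le (x₀ := (0 : ℝ)) (μ := μ)
    (Metric.ball_mem_nhds 0 one_pos)
    (F := fun ε x => areaFun' (u x + ε * P x + ε ^ 2 * Q x) * (P x + 2 * ε * Q x))
    (F' := fun ε x => areaFun'' (u x + ε * P x + ε ^ 2 * Q x) * (P x + 2 * ε * Q x) *
      (P x + 2 * ε * Q x) + areaFun' (u x + ε * P x + ε ^ 2 * Q x) * (2 * Q x))
    -- For |δ| ≤ 1 one has (P + 2 δ Q)² ≤ 2 P² + 8 Q², while S'' ≤ 1 and |S'| ≤ 1. This is where P ∈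
    -- L² is needed.
    (bound := fun x => 2 * P x ^ 2 + 8 * Q x ^ 2 + 2 * |Q x|)
    (Eventually.of_forall hm) ?_ ?_ ?_ ?_ ?_).2
  · refine h.congr_deriv (integral_congr_ae (Eventually.of_forall fun x => ?_))
    simp
    ring
  · refine (hP.integrable one_le_two).abs.mono' (hm 0) (Eventually.of_forall fun x => ?_)
    rw [Real.norm_eq_abs, abs_mul]
    refine (mul_le_of_le_one_left (abs_nonneg _) (abs_areaFun'_le _)).trans ?_
    simp
  · have h1 : ∀ ε : ℝ, AEStronglyMeasurable (fun x => P x + 2 * ε * Q x) μ := fun ε =>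
      hP.1.add (hQ.1.const_mul (2 * ε))
    have h2 := (memLp_perturbation hu hP hQ 0).1
    exact (((continuous_areaFun''.comp_aestronglyMeasurable h2).mul (h1 0)).mul (h1 0)).add
      ((contDiff_areaFun'.continuous.comp_aestronglyMeasurable h2).mul (hQ.1.const_mul 2))
  · refine Eventually.of_forall fun x δ hδ => ?_
    have hδ1 : |δ| ≤ 1 := by
      rw [Metric.mem_ball, dist_zero_right, Real.norm_eq_abs] at hδ
      exact hδ.le
    set v := u x + δ * P x + δ ^ 2 * Q x
    refine (norm_add_le _ _).trans (add_le_add ?_ ?_)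
    · rw [Real.norm_eq_abs, mul_assoc, abs_mul, abs_mul_self, abs_of_nonneg (areaFun''_nonneg v)]
      refine (mul_le_of_le_one_left (mul_self_nonneg _) (areaFun''_le v)).trans ?_
      have hδ2 : δ ^ 2 ≤ 1 := (sq_le_one_iff_abs_le_one δ).2 hδ1
      have := mul_le_mul_of_nonneg_right hδ2 (sq_nonneg (Q x))
      nlinarith [sq_nonneg (P x - 2 * δ * Q x)]
    · rw [Real.norm_eq_abs, abs_mul, abs_mul, abs_two]
      exact mul_le_of_le_one_left (by positivity) (abs_areaFun'_le _)
  · exact ((hP.integrable_sq.const_mul 2).add (hQ.integrable_sq.const_mul 8)).add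
      ((hQ.integrable one_le_two).abs.const_mul 2)
  · refine Eventually.of_forall fun x δ _ => ?_
    have h1 := (hasDerivAt_areaFun' (u x + δ * P x + δ ^ 2 * Q x)).comp δ
      (hasDerivAt_perturbation (u x) (P x) (Q x) δ)
    have h2 : HasDerivAt (fun ε => P x + 2 * ε * Q x) (2 * Q x) δ := by
      simpa using (((hasDerivAt_id δ).const_mul 2).mul_const (Q x)).const_add (P x)
    exact h1.mul h2

end Variation

/-! ### Stability of the graphical strip -/

/-- The derivative of a test function along the parabolas of the strip. -/
noncomputable def stripTransport (φ : ℝ × ℝ → ℝ) (p : ℝ × ℝ) : ℝ :=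
  fderiv ℝ φ p (1, 0) + stripFun cantorStaircase p * fderiv ℝ φ p (0, 1)

/-- The first-order term of `ε ↦ ∇^{f + ε φ} (f + ε φ)`. -/
noncomputable def gradVariation (φ : ℝ × ℝ → ℝ) (p : ℝ × ℝ) : ℝ :=
  stripTransport φ p + φ p * stripDerivT p

section

variable {φ : ℝ × ℝ → ℝ}

theorem IsTestFunction.continuous_stripTransport (hφ : IsTestFunction univ φ) :
    Continuous (stripTransport φ) :=
  (hφ.continuous_fderiv_apply continuous_const).add
    (isProfile_cantorStaircase.continuous_stripFun.mul
      (hφ.continuous_fderiv_apply continuous_const))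

/-- The intrinsic gradient is quadratic in its argument, so the perturbed one is exactly a quadratic
polynomial in ε with constant term α. -/
theorem intrinsicGrad_add_ae_eq (hφ : IsTestFunction univ φ) (ε : ℝ) :
    intrinsicGrad (fun p => stripFun cantorStaircase p + ε * φ p) =ᵐ[volume]
      fun p => stripSlope cantorStaircase p + ε * gradVariation φ p +
        ε ^ 2 * (φ p * fderiv ℝ φ p (0, 1)) := by
  filter_upwards [(hasWeakDeriv_stripFun_fst.add_const_mul (hφ.hasWeakDeriv _) ε).weakDeriv_ae_eq,
    (hasWeakDeriv_stripFun_snd.add_const_mul (hφ.hasWeakDeriv _) ε).weakDeriv_ae_eq] with p h1 h2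
  simp only [intrinsicGrad, h1, h2, stripDerivY, gradVariation, stripTransport]
  ring

theorem areaDensity_add_ae_eq (hφ : IsTestFunction univ φ) (ε : ℝ) :
    areaDensity (fun p => stripFun cantorStaircase p + ε * φ p) =ᵐ[volume]
      fun p => areaFun (stripSlope cantorStaircase p + ε * gradVariation φ p +
        ε ^ 2 * (φ p * fderiv ℝ φ p (0, 1))) := by
  filter_upwards [intrinsicGrad_add_ae_eq hφ ε] with p h
  rw [areaDensity, h, areaFun]

theorem perturbedArea_eq (hφ : IsTestFunction univ φ) :
    perturbedArea (stripFun cantorStaircase) φ = fun ε =>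
      ∫ p in tsupport φ, areaFun (stripSlope cantorStaircase p + ε * gradVariation φ p +
        ε ^ 2 * (φ p * fderiv ℝ φ p (0, 1))) := by
  ext ε
  exact integral_congr_ae (ae_restrict_of_ae (areaDensity_add_ae_eq hφ ε))

theorem memLpLoc_gradVariation (hφ : IsTestFunction univ φ) :
    MemLpLoc 2 (gradVariation φ) := fun K hK =>
  (MemLpLoc.of_continuous hφ.continuous_stripTransport K hK).add
    (memLpLoc_mul_slopeDeriv hφ.continuous K hK)

theorem memLpLoc_mul_fderiv (hφ : IsTestFunction univ φ) :
    MemLpLoc 2 fun p => φ p * fderiv ℝ φ p (0, 1) :=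
  MemLpLoc.of_continuous (hφ.continuous.mul (hφ.continuous_fderiv_apply continuous_const))

theorem gradVariation_eq_zero {p : ℝ × ℝ} (hp : p ∉ tsupport φ) : gradVariation φ p = 0 := by
  simp [gradVariation, stripTransport, fderiv_of_notMem_tsupport ℝ hp, image_eq_zero_of_notMem_tsupport hp]

/-- Add the conservation law for B = S', tested with φ, to the integration by parts for S(α) against
y φ. The φ_t-terms combine through S - 1/S = α S', and the sum is S'(α) P. -/
theorem integral_first_variation (hφ : IsTestFunction univ φ) :
    ∫ p in tsupport φ, areaFun' (stripSlope cantorStaircase p) * gradVariation φ p = 0 := by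
  have hα := isProfile_cantorStaircase.continuous_stripSlope
  have hs := contDiff_areaFun.continuous.comp hα
  have hb := contDiff_areaFun'.continuous.comp hα
  rw [setIntegral_eq_integral_of_forall_compl_eq_zero fun p hp => by
    rw [gradVariation_eq_zero hp, mul_zero]]
  have hinv : ContDiff ℝ ∞ fun x => -(areaFun x)⁻¹ :=
    (contDiff_areaFun.inv fun x => (areaFun_pos x).ne').neg
  have h1 := conservation_law (contDiff_areaFun'.of_le (by simp)) (hinv.of_le (by simp))
    hasDerivAt_areaFun' hasDerivAt_neg_inv_areaFun hφ
  have hψ := hφ.mul_left (contDiff_fst (𝕜 := ℝ) (E := ℝ) (F := ℝ) (n := ∞))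
  have h2 := integral_slope_mul_fderiv hasDerivAt_areaFun contDiff_areaFun'.continuous hψ
  rw [← add_eq_zero_iff_eq_neg] at h2
  have i1 := hφ.integrable_mul_fderiv (μ := volume) (V := fun _ => ((1 : ℝ), (0 : ℝ))) hb
    continuous_const
  have i2 := hφ.integrable_mul_fderiv (μ := volume) (V := fun _ => ((0 : ℝ), (1 : ℝ)))
    (continuous_fst.mul (hinv.continuous.comp hα)) continuous_const
  have i3 := hψ.integrable_mul_fderiv (μ := volume) (V := fun _ => ((0 : ℝ), (1 : ℝ))) hs
    continuous_const
  have i4 := integrable_slopeDeriv_mul (hb.mul hψ.continuous) hψ.2.1.mul_left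
  have h3 := (integral_add (i1.add i2) (i3.add i4)).trans
    (congrArg₂ (· + ·) h1 ((integral_add i3 i4).trans h2))
  rw [add_zero] at h3
  rw [← h3]
  refine integral_congr_ae (Eventually.of_forall fun p => ?_)
  simp only [Pi.add_apply, Pi.mul_apply, Function.comp_apply, gradVariation, stripTransport,
    stripDerivT, stripFun, fderiv_fst_mul (hφ.differentiable _)]
  have h4 := areaFun_sq (stripSlope cantorStaircase p)
  have h5 := areaFun_pos (stripSlope cantorStaircase p)
  simp only [areaFun']
  field_simp
  linear_combination (-p.1 * fderiv ℝ φ p (0, 1)) * h4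

/-- The transported measure `∂_t (areaFun' α)` annihilates derivatives along the parabolas. -/
theorem integral_slopeDeriv_mul_stripTransport {ψ : ℝ × ℝ → ℝ} (hψ : IsTestFunction univ ψ) :
    ∫ p, slopeDeriv p * (areaFun'' (stripSlope cantorStaircase p) * stripTransport ψ p) = 0 := by
  have hα := isProfile_cantorStaircase.continuous_stripSlope
  have hb := contDiff_areaFun'.continuous.comp hα
  have hw := continuous_areaFun''.comp hα
  have hinv : ContDiff ℝ ∞ fun x => -(areaFun x)⁻¹ :=
    (contDiff_areaFun.inv fun x => (areaFun_pos x).ne').neg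
  have hψy := hψ.fderiv_apply (1, 0)
  have hψt := hψ.fderiv_apply (0, 1)
  have hyψt := hψt.mul_left (contDiff_fst (𝕜 := ℝ) (E := ℝ) (F := ℝ) (n := ∞))
  -- The law for B = S' is tested with ψ_t; moving one ∂_t from each second derivative of ψ onto
  -- functions of α produces the factor β in both terms.
  have h1 := conservation_law (contDiff_areaFun'.of_le (by simp)) (hinv.of_le (by simp))
    hasDerivAt_areaFun' hasDerivAt_neg_inv_areaFun hψt
  have h2 := integral_slope_mul_fderiv hasDerivAt_areaFun' continuous_areaFun'' hψy
  have h3 := integral_slope_mul_fderiv hasDerivAt_neg_inv_areaFun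
    (continuous_id.mul continuous_areaFun'') hyψt
  have hsymm : ∀ p, fderiv ℝ (fun q => fderiv ℝ ψ q (1, 0)) p (0, 1) =
      fderiv ℝ (fun q => fderiv ℝ ψ q (0, 1)) p (1, 0) := fun p => by
    have hs : IsSymmSndFDerivAt ℝ ψ p :=
      hψ.1.contDiffAt.isSymmSndFDerivAt (by
        simp only [minSmoothness_of_isRCLikeNormedField]; exact WithTop.coe_le_coe.2 le_top)
    have hd : DifferentiableAt ℝ (fderiv ℝ ψ) p :=
      (hψ.1.fderiv_right (m := 1) (WithTop.coe_le_coe.2 le_top)).differentiable one_ne_zero p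
    have e : ∀ v w : ℝ × ℝ, fderiv ℝ (fun q => fderiv ℝ ψ q v) p w =
        fderiv ℝ (fderiv ℝ ψ) p w v := fun v w => by
      rw [fderiv_clm_apply hd (differentiableAt_const v)]
      simp
    rw [e, e]
    exact hs.eq _ _
  simp only [hsymm] at h2
  simp only [fderiv_fst_mul (hψt.differentiable _), zero_mul, zero_add] at h3
  have i1 := hψt.integrable_mul_fderiv (μ := volume) (V := fun _ => ((1 : ℝ), (0 : ℝ))) hb
    continuous_const
  have i2 := hψt.integrable_mul_fderiv (μ := volume) (V := fun _ => ((0 : ℝ), (1 : ℝ)))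
    (continuous_fst.mul (hinv.continuous.comp hα)) continuous_const
  have i3 := integrable_slopeDeriv_mul (hw.mul hψy.continuous) hψy.2.1.mul_left
  have i4 := integrable_slopeDeriv_mul ((hα.mul hw).mul hyψt.continuous) hyψt.2.1.mul_left
  have h4 := (integral_add i1 i2).symm.trans h1
  have h5 : ∫ p, slopeDeriv p * (areaFun'' (stripSlope cantorStaircase p) * stripTransport ψ p) =
      _ := (integral_congr_ae (Eventually.of_forall fun p => by
        simp only [Pi.mul_apply, Function.comp_apply, stripTransport, stripFun]
        ring)).trans (integral_add i3 i4)
  rw [h5]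
  simp only [Pi.mul_apply, Function.comp_apply] at h2 h3 h4 ⊢
  have e2 : ∫ p : ℝ × ℝ, p.1 * -(areaFun (stripSlope cantorStaircase p))⁻¹ *
      fderiv ℝ (fun q => fderiv ℝ ψ q (0, 1)) p (0, 1) =
      ∫ p : ℝ × ℝ, -(areaFun (stripSlope cantorStaircase p))⁻¹ *
      (p.1 * fderiv ℝ (fun q => fderiv ℝ ψ q (0, 1)) p (0, 1)) :=
    integral_congr_ae (Eventually.of_forall fun p => by simp only; ring)
  rw [e2] at h4
  linarith

/-- Since D(y φ²) = φ² + 2 y φ D φ and y² β² = 2 β, one has P² = (D φ)² + β D(y φ²) + β φ². The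
transport identity removes the middle term, and the last one cancels 2 S'(α) φ φ_t = S'(α) ∂_t (φ²)
after integration by parts. -/
theorem integral_second_variation_nonneg (hφ : IsTestFunction univ φ) :
    0 ≤ ∫ p in tsupport φ, (areaFun'' (stripSlope cantorStaircase p) * gradVariation φ p ^ 2 +
      2 * areaFun' (stripSlope cantorStaircase p) * (φ p * fderiv ℝ φ p (0, 1))) := by
  have hα := isProfile_cantorStaircase.continuous_stripSlope
  have hb := contDiff_areaFun'.continuous.comp hα
  have hw := continuous_areaFun''.comp hα
  rw [setIntegral_eq_integral_of_forall_compl_eq_zero fun p hp => by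
    rw [gradVariation_eq_zero hp, image_eq_zero_of_notMem_tsupport hp]; simp]
  have hφ2 : IsTestFunction univ (fun p => φ p * φ p) := hφ.mul_left hφ.1
  have hψ := hφ2.mul_left (contDiff_fst (𝕜 := ℝ) (E := ℝ) (F := ℝ) (n := ∞))
  have h1 := integral_slopeDeriv_mul_stripTransport hψ
  have h2 := integral_slope_mul_fderiv hasDerivAt_areaFun' continuous_areaFun'' hφ2
  rw [← add_eq_zero_iff_eq_neg] at h2
  have i1 : Integrable fun p => areaFun'' (stripSlope cantorStaircase p) * stripTransport φ p ^ 2 := by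
    refine Continuous.integrable_of_hasCompactSupport
      (hw.mul (hφ.continuous_stripTransport.pow 2)) ?_
    refine hφ.2.1.of_isClosed_subset (isClosed_tsupport _)
      (closure_minimal (fun p hp => ?_) (isClosed_tsupport _))
    by_contra h
    exact hp (by simp [stripTransport, fderiv_of_notMem_tsupport ℝ h])
  have i2 : Integrable fun p => slopeDeriv p *
      (areaFun'' (stripSlope cantorStaircase p) * stripTransport (fun p => p.1 * (φ p * φ p)) p) := by
    refine integrable_slopeDeriv_mul (hw.mul hψ.continuous_stripTransport) ?_
    refine hψ.2.1.of_isClosed_subset (isClosed_tsupport _)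
      (closure_minimal (fun p hp => ?_) (isClosed_tsupport _))
    by_contra h
    exact hp (by simp [stripTransport, fderiv_of_notMem_tsupport ℝ h])
  have i3 := hφ2.integrable_mul_fderiv (μ := volume) (V := fun _ => ((0 : ℝ), (1 : ℝ))) hb
    continuous_const
  have i4 := integrable_slopeDeriv_mul (hw.mul hφ2.continuous) hφ2.2.1.mul_left
  have h3 : ∫ p, (areaFun'' (stripSlope cantorStaircase p) * gradVariation φ p ^ 2 +
      2 * areaFun' (stripSlope cantorStaircase p) * (φ p * fderiv ℝ φ p (0, 1))) =
      ∫ p, areaFun'' (stripSlope cantorStaircase p) * stripTransport φ p ^ 2 := by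
    have h4 := (integral_add i1 (i2.add (i3.add i4))).trans (congrArg₂ (· + ·) rfl
      ((integral_add i2 (i3.add i4)).trans (congrArg₂ (· + ·) h1
        ((integral_add i3 i4).trans h2))))
    rw [add_zero, add_zero] at h4
    rw [← h4]
    refine integral_congr_ae (Eventually.of_forall fun p => ?_)
    have h5 := sq_mul_slopeDeriv_sq p
    have hd := hφ.differentiable p
    have e : ∀ v, fderiv ℝ (fun q => φ q * φ q) p v = 2 * φ p * fderiv ℝ φ p v := fun v => by
      have : fderiv ℝ (fun q => φ q * φ q) p = _ := (hd.hasFDerivAt.mul hd.hasFDerivAt).fderiv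
      rw [this]
      simp
      ring
    simp only [Pi.add_apply, Pi.mul_apply, Function.comp_apply, gradVariation, stripTransport,
      stripDerivT, stripFun, fderiv_fst_mul (hφ2.differentiable _), e]
    linear_combination areaFun'' (stripSlope cantorStaircase p) * φ p ^ 2 * h5
  rw [h3]
  exact integral_nonneg fun p => mul_nonneg (areaFun''_nonneg _) (sq_nonneg _)

end

theorem isStableGraph_stripFun : IsStableGraph (stripFun cantorStaircase) := by
  have hα := isProfile_cantorStaircase.continuous_stripSlope
  have key : ∀ φ : ℝ × ℝ → ℝ, IsTestFunction univ φ →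
      (∀ ε, IntegrableOn (areaDensity (fun p => stripFun cantorStaircase p + ε * φ p))
        (tsupport φ)) ∧
      ∃ A' : ℝ → ℝ, (∀ ε, HasDerivAt (perturbedArea (stripFun cantorStaircase) φ) (A' ε) ε) ∧
        A' 0 = 0 ∧ ∃ c, HasDerivAt A' c 0 ∧ 0 ≤ c := by
    intro φ hφ
    have hK : IsCompact (tsupport φ) := hφ.2.1
    have : IsFiniteMeasure (volume.restrict (tsupport φ)) := ⟨by simpa using hK.measure_lt_top⟩
    have h1 := MemLpLoc.of_continuous (p := 2) hα _ hK
    have h2 := memLpLoc_gradVariation hφ _ hK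
    have h3 := memLpLoc_mul_fderiv hφ _ hK
    refine ⟨fun ε => ?_, _, fun ε => ?_, ?_, _, hasDerivAt_integral_areaFun' h1 h2 h3,
      integral_second_variation_nonneg hφ⟩
    · exact (integrable_areaFun (memLp_perturbation h1 h2 h3 ε)).congr
        (ae_restrict_of_ae (areaDensity_add_ae_eq hφ ε).symm)
    · rw [perturbedArea_eq hφ]
      exact hasDerivAt_integral_areaFun h1 h2 h3 ε
    · simpa using integral_first_variation hφ
  refine ⟨⟨memW1pLoc_stripFun.mono one_le_two, fun φ hφ => ?_⟩, fun φ hφ => ?_⟩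
  · obtain ⟨hi, A', hA, h0, -⟩ := key φ hφ
    exact ⟨Eventually.of_forall hi, by simpa only [h0] using hA 0⟩
  · obtain ⟨-, A', hA, -, c, hc, hc0⟩ := key φ hφ
    refine ⟨Eventually.of_forall fun ε => (hA ε).differentiableAt, c, ?_, hc0⟩
    rwa [show deriv (perturbedArea (stripFun cantorStaircase) φ) = A' from
      funext fun ε => (hA ε).deriv]

/-! ### The divergence theorem on subgraphs -/

/-- The shear `(r, w) ↦ (r + h w, w)`, which maps `{r ≤ 0}` to the subgraph of `h`. -/
def shear {E : Type*} [TopologicalSpace E] (h : E → ℝ) (hh : Continuous h) : ℝ × E ≃ₜ ℝ × E where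
  toFun q := (q.1 + h q.2, q.2)
  invFun q := (q.1 - h q.2, q.2)
  left_inv q := by simp
  right_inv q := by simp
  continuous_toFun := by fun_prop
  continuous_invFun := by fun_prop

theorem measurePreserving_shear {h : ℝ × ℝ → ℝ} (hh : Continuous h) :
    MeasurePreserving (shear h hh) (volume : Measure (ℝ × ℝ × ℝ)) volume := by
  have h1 : MeasurePreserving (Prod.swap : ℝ × ℝ × ℝ → (ℝ × ℝ) × ℝ) volume volume :=
    Measure.measurePreserving_swap
  have h2 : MeasurePreserving (fun q : (ℝ × ℝ) × ℝ => (q.1, q.2 + h q.1)) volume volume := by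
    refine MeasurePreserving.skew_product (g := fun w r => r + h w) (MeasurePreserving.id _)
      (by fun_prop) (Eventually.of_forall fun w => ?_)
    exact (measurePreserving_add_right volume (h w)).map_eq
  have h3 : MeasurePreserving (Prod.swap : (ℝ × ℝ) × ℝ → ℝ × ℝ × ℝ) volume volume :=
    Measure.measurePreserving_swap
  exact h3.comp (h2.comp h1)

theorem volume_graph_eq_zero {h : ℝ × ℝ → ℝ} (hh : Continuous h) :
    volume {q : ℝ × ℝ × ℝ | q.1 = h q.2} = 0 := by
  have hm : MeasurableSet {q : ℝ × ℝ × ℝ | q.1 = h q.2} :=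
    (isClosed_eq continuous_fst (hh.comp continuous_snd)).measurableSet
  rw [← (measurePreserving_shear hh).measure_preimage hm.nullMeasurableSet]
  have : shear h hh ⁻¹' {q : ℝ × ℝ × ℝ | q.1 = h q.2} = {0} ×ˢ univ := by
    ext q
    simp [shear]
  rw [this, Measure.volume_eq_prod, Measure.prod_prod]
  simp

/-- The subgraph `{(x, w) : x ≤ h w}`. -/
def subgraph (h : ℝ × ℝ → ℝ) : Set (ℝ × ℝ × ℝ) := {q | q.1 ≤ h q.2}

theorem isClosed_subgraph {h : ℝ × ℝ → ℝ} (hh : Continuous h) : IsClosed (subgraph h) :=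
  isClosed_le continuous_fst (hh.comp continuous_snd)

theorem setIntegral_subgraph {h : ℝ × ℝ → ℝ} (hh : Continuous h) (F : ℝ × ℝ × ℝ → ℝ) :
    ∫ q in subgraph h, F q = ∫ q in Iic (0 : ℝ) ×ˢ univ, F (q.1 + h q.2, q.2) := by
  rw [← (measurePreserving_shear hh).setIntegral_preimage_emb
    (shear h hh).measurableEmbedding F (subgraph h)]
  congr 2
  ext q
  simp [shear, subgraph]

section

variable {h : ℝ × ℝ → ℝ} {g F : ℝ × ℝ × ℝ → ℝ}

theorem integrable_comp_shear (hh : Continuous h) (hF : Continuous F) (hc : HasCompactSupport F) :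
    Integrable fun q : ℝ × ℝ × ℝ => F (q.1 + h q.2, q.2) :=
  ((measurePreserving_shear hh).integrable_comp_emb (shear h hh).measurableEmbedding).2
    (hF.integrable_of_hasCompactSupport hc)

theorem setIntegral_subgraph_eq_integral_integral (hh : Continuous h) (hF : Continuous F)
    (hc : HasCompactSupport F) :
    ∫ q in subgraph h, F q = ∫ r in Iic (0 : ℝ), ∫ w, F (r + h w, w) := by
  rw [setIntegral_subgraph hh, Measure.volume_eq_prod, setIntegral_prod]
  · simp
  · exact (integrable_comp_shear hh hF hc).integrableOn

theorem setIntegral_subgraph_eq_integral_integral' (hh : Continuous h) (hF : Continuous F)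
    (hc : HasCompactSupport F) :
    ∫ q in subgraph h, F q = ∫ w, ∫ r in Iic (0 : ℝ), F (r + h w, w) := by
  rw [setIntegral_subgraph_eq_integral_integral hh hF hc, integral_integral_swap]
  have := (integrable_comp_shear hh hF hc).integrableOn (s := Iic (0 : ℝ) ×ˢ univ)
  rw [IntegrableOn, Measure.volume_eq_prod, ← Measure.prod_restrict, Measure.restrict_univ] at this
  exact this

theorem setIntegral_subgraph_fderiv_fst (hh : Continuous h) (hg : IsTestFunction univ g) :
    ∫ q in subgraph h, fderiv ℝ g q (1, 0) = ∫ w, g (h w, w) := by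
  have hg' := hg.fderiv_apply (1, 0)
  rw [setIntegral_subgraph_eq_integral_integral' hh hg'.continuous hg'.2.1]
  refine integral_congr_ae (Eventually.of_forall fun w => ?_)
  have hd : ∀ r, HasDerivAt (fun r => g (r + h w, w)) (fderiv ℝ g (r + h w, w) (1, 0)) r := fun r =>
    (hg.differentiable _).hasFDerivAt.comp_hasDerivAt r
      (((hasDerivAt_id r).add_const (h w)).prodMk (hasDerivAt_const r w))
  have hs : ContDiff ℝ 1 fun r => g (r + h w, w) :=
    (hg.1.of_le (by simp)).comp ((contDiff_id.add contDiff_const).prodMk contDiff_const)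
  have hcs : HasCompactSupport fun r => g (r + h w, w) := by
    refine hg.2.1.comp_isClosedEmbedding (g := fun r : ℝ => (r + h w, w)) ?_
    exact (Isometry.of_dist_eq fun s t => by simp [Prod.dist_eq]).isClosedEmbedding
  have := hcs.integral_Iic_deriv_eq hs 0
  simp only [fun r => (hd r).deriv, zero_add] at this
  exact this

theorem IsTestFunction.integral_fderiv_eq_zero {E : Type*} [NormedAddCommGroup E] [NormedSpace ℝ E]
    [FiniteDimensional ℝ E] [MeasurableSpace E] [BorelSpace E] {ν : Measure E} [ν.IsAddHaarMeasure]
    {φ : E → ℝ} (hφ : IsTestFunction univ φ) (v : E) : ∫ p, fderiv ℝ φ p v ∂ν = 0 := by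
  have := hφ.integral_mul_fderiv (ν := ν) (contDiff_const (c := (1 : ℝ))) v
  simpa using this

/-- The field v + (∂_v h) ∂_x is tangent to every translate x = r + h(w), so its derivative of g
integrates to zero on each slice. The ∂_x-part is a boundary term by the previous formula, applied
to (∂_v h) g. -/
theorem setIntegral_subgraph_fderiv_snd (hh : ContDiff ℝ ∞ h) (hg : IsTestFunction univ g)
    (v : ℝ × ℝ) :
    ∫ q in subgraph h, fderiv ℝ g q (0, v) = - ∫ w, fderiv ℝ h w v * g (h w, w) := by
  have hdh : ContDiff ℝ ∞ fun q : ℝ × ℝ × ℝ => fderiv ℝ h q.2 v :=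
    ((hh.fderiv_right (by simp)).comp contDiff_snd).clm_apply contDiff_const
  have hk : IsTestFunction univ fun q => fderiv ℝ h q.2 v * g q := hg.mul_left hdh
  have e1 := setIntegral_subgraph_fderiv_fst hh.continuous hk
  have hk' : ∀ q, fderiv ℝ (fun q => fderiv ℝ h q.2 v * g q) q (1, 0) =
      fderiv ℝ h q.2 v * fderiv ℝ g q (1, 0) := fun q => by
    have hline : HasDerivAt (fun r : ℝ => (r, q.2)) ((1 : ℝ), (0 : ℝ × ℝ)) q.1 :=
      (hasDerivAt_id q.1).prodMk (hasDerivAt_const q.1 q.2)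
    have H : ∀ φ : ℝ × ℝ × ℝ → ℝ, DifferentiableAt ℝ φ q →
        HasDerivAt (fun r => φ (r, q.2)) (fderiv ℝ φ q (1, 0)) q.1 := fun φ hφ =>
      HasFDerivAt.comp_hasDerivAt (f := fun r : ℝ => (r, q.2)) q.1 hφ.hasFDerivAt hline
    have h1 := H _ (hk.differentiable q)
    have h2 := (H g (hg.differentiable q)).const_mul (fderiv ℝ h q.2 v)
    exact h1.unique h2
  simp only [hk'] at e1
  have i1 : Integrable fun q : ℝ × ℝ × ℝ => fderiv ℝ g q (0, v) :=
    (hg.fderiv_apply (0, v)).continuous.integrable_of_hasCompactSupport (hg.fderiv_apply _).2.1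
  have hg1 := (hg.fderiv_apply (1, 0)).mul_left hdh
  have i2 : Integrable fun q : ℝ × ℝ × ℝ => fderiv ℝ h q.2 v * fderiv ℝ g q (1, 0) :=
    hg1.continuous.integrable_of_hasCompactSupport hg1.2.1
  rw [← e1, ← add_eq_zero_iff_eq_neg, ← integral_add i1.integrableOn i2.integrableOn]
  refine (setIntegral_subgraph_eq_integral_integral hh.continuous
    ((hg.fderiv_apply (0, v)).continuous.add hg1.continuous)
    ((hg.fderiv_apply (0, v)).2.1.add hg1.2.1)).trans ?_
  refine (integral_congr_ae (Eventually.of_forall fun r => ?_)).trans (integral_zero _ _)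
  have hmap : ContDiff ℝ ∞ fun w : ℝ × ℝ => (r + h w, w) :=
    (contDiff_const.add hh).prodMk contDiff_id
  have hT : IsTestFunction univ fun w => g (r + h w, w) := by
    refine .of_compactSupport (hg.1.comp hmap) ?_
    refine HasCompactSupport.intro (hg.2.1.isCompact.image continuous_snd) fun w hw => ?_
    by_contra h0
    exact hw ⟨_, subset_tsupport _ h0, rfl⟩
  refine Eq.trans (integral_congr_ae (Eventually.of_forall fun w => ?_))
    (hT.integral_fderiv_eq_zero (ν := volume) v)
  have hd : HasFDerivAt (fun w => g (r + h w, w)) _ w :=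
    HasFDerivAt.comp (f := fun w : ℝ × ℝ => (r + h w, w)) w
      (hg.differentiable (r + h w, w)).hasFDerivAt
      (((hh.differentiable (by simp) w).hasFDerivAt.const_add r).prodMk (hasFDerivAt_id w))
  have e : ((fderiv ℝ h w v, v) : ℝ × ℝ × ℝ) = (0, v) + fderiv ℝ h w v • (1, 0) := by simp
  have e2 : fderiv ℝ (fun w => g (r + h w, w)) w v =
      fderiv ℝ g (r + h w, w) (fderiv ℝ h w v, v) := by
    rw [hd.fderiv]
    rfl
  rw [e2, e, map_add, map_smul, smul_eq_mul]
  rfl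

end

/-! ### The horizontal divergence on subgraphs of `b z * y` -/

/-- The horizontal divergence. -/
noncomputable def horizDiv (ψ₁ ψ₂ : ℝ × ℝ × ℝ → ℝ) (p : ℝ × ℝ × ℝ) : ℝ :=
  horizX ψ₁ p + horizY ψ₂ p

/-- The set `{x ≤ b z * y}`. -/
def stripSubgraph (b : ℝ → ℝ) : Set (ℝ × ℝ × ℝ) := subgraph fun w => b w.2 * w.1

theorem isClosed_stripSubgraph {b : ℝ → ℝ} (hb : Continuous b) : IsClosed (stripSubgraph b) :=
  isClosed_subgraph (by fun_prop)

theorem IsTestFunction.continuous_horizX {Ω : Set (ℝ × ℝ × ℝ)} {ψ : ℝ × ℝ × ℝ → ℝ}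
    (h : IsTestFunction Ω ψ) : Continuous (horizX ψ) :=
  h.continuous_fderiv_apply (V := fun p : ℝ × ℝ × ℝ => (1, 0, -p.2.1 / 2)) (by fun_prop)

theorem IsTestFunction.continuous_horizY {Ω : Set (ℝ × ℝ × ℝ)} {ψ : ℝ × ℝ × ℝ → ℝ}
    (h : IsTestFunction Ω ψ) : Continuous (horizY ψ) :=
  h.continuous_fderiv_apply (V := fun p : ℝ × ℝ × ℝ => (0, 1, p.1 / 2)) (by fun_prop)

theorem IsTestFunction.integrable_horizX {Ω : Set (ℝ × ℝ × ℝ)} {ψ : ℝ × ℝ × ℝ → ℝ}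
    (h : IsTestFunction Ω ψ) : Integrable (horizX ψ) :=
  h.continuous_horizX.integrable_of_hasCompactSupport (h.hasCompactSupport_fderiv_apply _)

theorem IsTestFunction.integrable_horizY {Ω : Set (ℝ × ℝ × ℝ)} {ψ : ℝ × ℝ × ℝ → ℝ}
    (h : IsTestFunction Ω ψ) : Integrable (horizY ψ) :=
  h.continuous_horizY.integrable_of_hasCompactSupport (h.hasCompactSupport_fderiv_apply _)

/-- On x = b y both components acquire the same factor 1 + b' y²/2. It is nonnegative for
nondecreasing b, so boundary integrals can be compared through ψ₁ - b ψ₂ alone. -/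
theorem setIntegral_horizDiv {b : ℝ → ℝ} (hb : ContDiff ℝ ∞ b) {ψ₁ ψ₂ : ℝ × ℝ × ℝ → ℝ}
    (h₁ : IsTestFunction univ ψ₁) (h₂ : IsTestFunction univ ψ₂) :
    ∫ q in stripSubgraph b, horizDiv ψ₁ ψ₂ q =
      ∫ w : ℝ × ℝ, (ψ₁ (b w.2 * w.1, w) - b w.2 * ψ₂ (b w.2 * w.1, w)) *
        (1 + deriv b w.2 * w.1 ^ 2 / 2) := by
  set h : ℝ × ℝ → ℝ := fun w => b w.2 * w.1 with hdef
  have hh : ContDiff ℝ ∞ h := (hb.comp contDiff_snd).mul contDiff_fst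
  have hdh : ∀ w, fderiv ℝ h w (0, 1) = deriv b w.2 * w.1 ∧ fderiv ℝ h w (1, 0) = b w.2 := by
    intro w
    have e1 : HasFDerivAt (fun w : ℝ × ℝ => b w.2)
        (deriv b w.2 • ContinuousLinearMap.snd ℝ ℝ ℝ) w :=
      HasDerivAt.comp_hasFDerivAt (f := Prod.snd) w
        (hb.differentiable (by simp) w.2).hasDerivAt hasFDerivAt_snd
    have e2 : HasFDerivAt h _ w := e1.mul hasFDerivAt_fst
    rw [e2.fderiv]
    constructor <;> simp
    ring
  have hy : ContDiff ℝ ∞ fun q : ℝ × ℝ × ℝ => q.2.1 / 2 := by fun_prop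
  have hx : ContDiff ℝ ∞ fun q : ℝ × ℝ × ℝ => q.1 / 2 := by fun_prop
  have t1 := h₁.mul_left hy
  have t2 := h₂.mul_left hx
  have f1 : ∀ q, fderiv ℝ (fun q : ℝ × ℝ × ℝ => q.2.1 / 2 * ψ₁ q) q (0, 0, 1) =
      q.2.1 / 2 * fderiv ℝ ψ₁ q (0, 0, 1) := fun q => by
    have : fderiv ℝ (fun q : ℝ × ℝ × ℝ => q.2.1 / 2 * ψ₁ q) q = _ :=
      ((hasFDerivAt_snd (𝕜 := ℝ) (p := q)).fst.mul_const (1 / 2) |>.mul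
        (h₁.differentiable q).hasFDerivAt |>.congr_of_eventuallyEq
        (Eventually.of_forall fun q => by simp [div_eq_mul_inv])).fderiv
    rw [this]
    simp [div_eq_mul_inv]
  have f2 : ∀ q, fderiv ℝ (fun q : ℝ × ℝ × ℝ => q.1 / 2 * ψ₂ q) q (0, 0, 1) =
      q.1 / 2 * fderiv ℝ ψ₂ q (0, 0, 1) := fun q => by
    have : fderiv ℝ (fun q : ℝ × ℝ × ℝ => q.1 / 2 * ψ₂ q) q = _ :=
      ((hasFDerivAt_fst (𝕜 := ℝ) (p := q)).mul_const (1 / 2) |>.mul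
        (h₂.differentiable q).hasFDerivAt |>.congr_of_eventuallyEq
        (Eventually.of_forall fun q => by simp [div_eq_mul_inv])).fderiv
    rw [this]
    simp [div_eq_mul_inv]
  have int : ∀ {ψ : ℝ × ℝ × ℝ → ℝ}, IsTestFunction univ ψ → ∀ v, IntegrableOn
      (fun q => fderiv ℝ ψ q v) (stripSubgraph b) := fun hψ v =>
    ((hψ.fderiv_apply v).continuous.integrable_of_hasCompactSupport
      (hψ.fderiv_apply v).2.1).integrableOn
  have intw : ∀ {ψ : ℝ × ℝ × ℝ → ℝ}, IsTestFunction univ ψ → ∀ {c : ℝ × ℝ → ℝ}, Continuous c →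
      Integrable (fun w => c w * ψ (h w, w)) := fun {ψ} hψ {c} hc => by
    refine Continuous.integrable_of_hasCompactSupport (hc.mul (hψ.continuous.comp
      (hh.continuous.prodMk continuous_id))) (HasCompactSupport.mul_left ?_)
    refine HasCompactSupport.intro (hψ.2.1.isCompact.image continuous_snd) fun w hw => ?_
    by_contra h0
    exact hw ⟨_, subset_tsupport _ h0, rfl⟩
  -- X and Y are divergence-free, so the coefficients y/2 and x/2 can be moved inside ∂_z.
  have eX : ∀ q, horizX ψ₁ q = fderiv ℝ ψ₁ q (1, 0) -
      fderiv ℝ (fun q : ℝ × ℝ × ℝ => q.2.1 / 2 * ψ₁ q) q (0, 0, 1) := fun q => by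
    have e : ((1, 0, -q.2.1 / 2) : ℝ × ℝ × ℝ) = (1, 0) - (q.2.1 / 2) • (0, 0, 1) := by
      ext <;> simp; ring
    rw [f1, horizX, e, map_sub, map_smul, smul_eq_mul]
  have eY : ∀ q, horizY ψ₂ q = fderiv ℝ ψ₂ q (0, 1, 0) +
      fderiv ℝ (fun q : ℝ × ℝ × ℝ => q.1 / 2 * ψ₂ q) q (0, 0, 1) := fun q => by
    have e : ((0, 1, q.1 / 2) : ℝ × ℝ × ℝ) = (0, 1, 0) + (q.1 / 2) • (0, 0, 1) := by
      ext <;> simp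
    rw [f2, horizY, e, map_add, map_smul, smul_eq_mul]
  have hb' : Continuous (deriv b) := hb.continuous_deriv (by simp)
  have c1 : Continuous fun w : ℝ × ℝ => fderiv ℝ h w (0, 1) :=
    (hh.continuous_fderiv (by simp)).clm_apply continuous_const
  have c2 : Continuous fun w : ℝ × ℝ => fderiv ℝ h w (1, 0) :=
    (hh.continuous_fderiv (by simp)).clm_apply continuous_const
  have j1 : Integrable fun w => ψ₁ (h w, w) := by
    simpa using intw h₁ (continuous_const (y := (1 : ℝ)))
  have k1 := intw t1 c1
  have k2 := intw h₂ c2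
  have k3 := intw t2 c1
  simp only [horizDiv, eX, eY]
  refine ((integral_add ((int h₁ (1, 0)).sub (int t1 (0, 0, 1)))
    ((int h₂ (0, 1, 0)).add (int t2 (0, 0, 1)))).trans (congrArg₂ (· + ·)
      (integral_sub (int h₁ (1, 0)) (int t1 (0, 0, 1)))
      (integral_add (int h₂ (0, 1, 0)) (int t2 (0, 0, 1))))).trans ?_
  have R := (integral_sub (j1.add k1) (k2.add k3)).trans
    (congrArg₂ (· - ·) (integral_add j1 k1) (integral_add k2 k3))
  rw [stripSubgraph, setIntegral_subgraph_fderiv_fst hh.continuous h₁,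
    setIntegral_subgraph_fderiv_snd hh t1, setIntegral_subgraph_fderiv_snd hh h₂,
    setIntegral_subgraph_fderiv_snd hh t2, sub_neg_eq_add, ← neg_add, ← sub_eq_add_neg]
  refine R.symm.trans (integral_congr_ae (Eventually.of_forall fun w => ?_))
  have hw : h w = b w.2 * w.1 := rfl
  simp only [Pi.add_apply, (hdh w).1, (hdh w).2, hw]
  ring

/-! ### Perimeter minimality from calibrations of smooth approximations -/

/-- The point (x, y, z) has plane coordinates (y, t) with t = z + x y / 2. Its foot satisfies τ - z
= (y/2) (x - y α), so the sign of x - y α orders τ and z, and monotonicity of a turns x ≤ y a(τ)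
into x ≤ y a(z) and back. -/
theorem intrinsicSubgraph_stripFun :
    intrinsicSubgraph (stripFun cantorStaircase) = stripSubgraph cantorStaircase := by
  have ha := isProfile_cantorStaircase
  have key : ∀ x y z : ℝ, x ≤ stripFun cantorStaircase (y, z + x * y / 2) ↔
      x ≤ cantorStaircase z * y := by
    intro x y z
    have h1 := ha.foot_add (y ^ 2 / 2, z + x * y / 2)
    set α := stripSlope cantorStaircase (y, z + x * y / 2) with hα
    set τ := foot cantorStaircase (y ^ 2 / 2, z + x * y / 2) with hτ
    have h2 : α = cantorStaircase τ := rfl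
    have h3 : τ - z = y / 2 * (x - y * α) := by
      have : burgers cantorStaircase (y ^ 2 / 2, z + x * y / 2) = α := rfl
      rw [this] at h1
      simp only at h1
      linear_combination h1
    have hf : stripFun cantorStaircase (y, z + x * y / 2) = y * α := rfl
    rw [hf]
    rcases le_total 0 y with hy | hy <;> constructor <;> intro h
    · have h4 : τ ≤ z := by nlinarith
      have := mul_le_mul_of_nonneg_left (ha.mono h4) hy
      rw [h2] at h
      linarith
    · by_contra! hlt
      have h4 : z ≤ τ := by nlinarith
      have := mul_le_mul_of_nonneg_left (ha.mono h4) hy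
      rw [h2] at hlt
      linarith
    · have h4 : z ≤ τ := by nlinarith
      have := mul_le_mul_of_nonpos_left (ha.mono h4) hy
      rw [h2] at h
      linarith
    · by_contra! hlt
      have h4 : τ ≤ z := by nlinarith
      have := mul_le_mul_of_nonpos_left (ha.mono h4) hy
      rw [h2] at hlt
      linarith
  ext ⟨x, y, z⟩
  simp only [intrinsicSubgraph, stripSubgraph, subgraph, Set.mem_ofPred_eq]
  rw [← key]
  constructor
  · rintro ⟨y', t, ξ, h, e⟩
    simp only [heisMul, Prod.mk.injEq, zero_add, add_zero, zero_mul, zero_sub] at e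
    obtain ⟨rfl, rfl, rfl⟩ := e
    convert h using 3
    ring
  · intro h
    refine ⟨y, z + x * y / 2, x, h, ?_⟩
    simp only [heisMul, Prod.mk.injEq]
    exact ⟨by ring, by ring, by ring⟩

theorem le_perimeter {G Ω : Set (ℝ × ℝ × ℝ)} {ψ₁ ψ₂ : ℝ × ℝ × ℝ → ℝ} (h₁ : IsTestFunction Ω ψ₁)
    (h₂ : IsTestFunction Ω ψ₂) (h : ∀ p, ψ₁ p ^ 2 + ψ₂ p ^ 2 ≤ 1) :
    ENNReal.ofReal (∫ p in G, horizDiv ψ₁ ψ₂ p) ≤ perimeter G Ω :=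
  le_sSup ⟨ψ₁, ψ₂, h₁, h₂, h, rfl⟩

theorem perimeter_le {G Ω : Set (ℝ × ℝ × ℝ)} {c : ENNReal}
    (h : ∀ ψ₁ ψ₂, IsTestFunction Ω ψ₁ → IsTestFunction Ω ψ₂ → (∀ p, ψ₁ p ^ 2 + ψ₂ p ^ 2 ≤ 1) →
      ENNReal.ofReal (∫ p in G, horizDiv ψ₁ ψ₂ p) ≤ c) : perimeter G Ω ≤ c := by
  refine sSup_le ?_
  rintro r ⟨ψ₁, ψ₂, h₁, h₂, h12, rfl⟩
  exact h ψ₁ ψ₂ h₁ h₂ h12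

theorem IsTestFunction.integrable_horizDiv {Ω : Set (ℝ × ℝ × ℝ)} {ψ₁ ψ₂ : ℝ × ℝ × ℝ → ℝ}
    (h₁ : IsTestFunction Ω ψ₁) (h₂ : IsTestFunction Ω ψ₂) : Integrable (horizDiv ψ₁ ψ₂) :=
  h₁.integrable_horizX.add h₂.integrable_horizY

/-! The subgraphs of the smooth staircases converge to the one of the Cantor staircase. -/

/-- The limit graph is null, and off it the strict inequality persists under pointwise convergence.
-/
theorem ae_eventually_mem_stripSubgraph_iff :
    ∀ᵐ q : ℝ × ℝ × ℝ, ∀ᶠ n in atTop,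
      (q ∈ stripSubgraph (smoothStaircase n) ↔ q ∈ stripSubgraph cantorStaircase) := by
  have hc := cantorStaircase_continuous
  have h0 := volume_graph_eq_zero (h := fun w : ℝ × ℝ => cantorStaircase w.2 * w.1) (by fun_prop)
  filter_upwards [measure_eq_zero_iff_ae_notMem.1 h0] with q hq
  have hlim := (tendsto_smoothStaircase q.2.2).mul_const q.2.1
  rcases lt_or_gt_of_ne (show q.1 ≠ cantorStaircase q.2.2 * q.2.1 from hq) with h | h
  · filter_upwards [hlim.eventually_const_lt h] with n hn
    exact ⟨fun _ => h.le, fun _ => hn.le⟩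
  · filter_upwards [hlim.eventually_lt_const h] with n hn
    exact ⟨fun h' => absurd (show q.1 ≤ _ from h') (not_le.2 hn),
      fun h' => absurd (show q.1 ≤ _ from h') (not_le.2 h)⟩

/-- The integrands may vary with n without converging; a common integrable bound is enough. This is
the form needed for calibrations that change with n. -/
theorem tendsto_setIntegral_stripSubgraph {F : ℕ → ℝ × ℝ × ℝ → ℝ} {B : ℝ × ℝ × ℝ → ℝ}
    (hF : ∀ n, AEStronglyMeasurable (F n)) (hB : Integrable B) (h : ∀ n q, |F n q| ≤ B q) :
    Tendsto (fun n => (∫ q in stripSubgraph (smoothStaircase n), F n q) -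
      ∫ q in stripSubgraph cantorStaircase, F n q) atTop (𝓝 0) := by
  classical
  have hm : ∀ n, MeasurableSet (stripSubgraph (smoothStaircase n)) := fun n =>
    (isClosed_stripSubgraph (smoothStaircase_contDiff n).continuous).measurableSet
  have hm' : MeasurableSet (stripSubgraph cantorStaircase) :=
    (isClosed_stripSubgraph cantorStaircase_continuous).measurableSet
  have hi : ∀ n, Integrable (F n) := fun n => hB.mono' (hF n) (Eventually.of_forall (h n))
  have e : ∀ n, (∫ q in stripSubgraph (smoothStaircase n), F n q) -
      ∫ q in stripSubgraph cantorStaircase, F n q =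
      ∫ q, ((stripSubgraph (smoothStaircase n)).indicator (F n) q -
        (stripSubgraph cantorStaircase).indicator (F n) q) := fun n => by
    rw [integral_sub ((hi n).indicator (hm n)) ((hi n).indicator hm'),
      integral_indicator (hm n), integral_indicator hm']
  simp only [e]
  rw [← integral_zero (ℝ × ℝ × ℝ) ℝ (μ := volume)]
  refine tendsto_integral_of_dominated_convergence B
    (fun n => ((hi n).indicator (hm n)).1.sub ((hi n).indicator hm').1) hB
    (fun n => Eventually.of_forall fun q => ?_) ?_
  · have h1 := h n q
    have h2 := (abs_nonneg _).trans h1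
    rw [Real.norm_eq_abs]
    simp only [indicator_apply]
    split_ifs <;> simp [h1, h2]
  · filter_upwards [ae_eventually_mem_stripSubgraph_iff] with q hq
    refine tendsto_const_nhds.congr' ?_
    filter_upwards [hq] with n hn
    simp only [indicator_apply, hn, sub_self]

theorem tendsto_setIntegral_horizDiv {ψ₁ ψ₂ : ℝ × ℝ × ℝ → ℝ} (h₁ : IsTestFunction univ ψ₁)
    (h₂ : IsTestFunction univ ψ₂) :
    Tendsto (fun n => ∫ q in stripSubgraph (smoothStaircase n), horizDiv ψ₁ ψ₂ q) atTop
      (𝓝 (∫ q in stripSubgraph cantorStaircase, horizDiv ψ₁ ψ₂ q)) := by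
  have hi := h₁.integrable_horizDiv h₂
  have := tendsto_setIntegral_stripSubgraph (F := fun _ => horizDiv ψ₁ ψ₂) (fun _ => hi.1) hi.abs
    fun _ _ => le_rfl
  simpa only [sub_add_cancel, zero_add] using
    this.add_const (∫ q in stripSubgraph cantorStaircase, horizDiv ψ₁ ψ₂ q)

/-! Perimeter bound. -/

theorem abs_le_one_of_sq_add_sq_le {x y : ℝ} (h : x ^ 2 + y ^ 2 ≤ 1) : |x| ≤ 1 ∧ |y| ≤ 1 :=
  ⟨(sq_le_one_iff_abs_le_one x).1 (by nlinarith [sq_nonneg y]),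
    (sq_le_one_iff_abs_le_one y).1 (by nlinarith [sq_nonneg x])⟩

/-- The bound does not depend on n: |ψ₁ - b ψ₂| ≤ 2, and b' ≥ 0 has total mass at most 1, however
steep b is. -/
theorem setIntegral_horizDiv_smoothStaircase_le {U : Set (ℝ × ℝ × ℝ)} {R : ℝ} (hR : 0 ≤ R)
    (hU : U ⊆ Metric.closedBall 0 R) (n : ℕ) {ψ₁ ψ₂ : ℝ × ℝ × ℝ → ℝ}
    (h₁ : IsTestFunction U ψ₁) (h₂ : IsTestFunction U ψ₂) (h : ∀ p, ψ₁ p ^ 2 + ψ₂ p ^ 2 ≤ 1) :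
    ∫ q in stripSubgraph (smoothStaircase n), horizDiv ψ₁ ψ₂ q ≤
      (2 * R) * (4 * R + R ^ 2) := by
  have hb := smoothStaircase_contDiff n
  have hbp := isProfile_smoothStaircase n
  set b := smoothStaircase n
  have hb' : Continuous (deriv b) := hb.continuous_deriv (by simp)
  have hb0 : ∀ z, 0 ≤ deriv b z := fun z => hbp.mono.deriv_nonneg
  rw [setIntegral_horizDiv hb h₁.toUniv h₂.toUniv]
  let g : ℝ → ℝ := fun z => 2 * (1 + deriv b z * (R ^ 2 / 2))
  have hg : Continuous g := by fun_prop
  let S : Set (ℝ × ℝ) := Icc (-R) R ×ˢ Icc (-R) R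
  have hS : MeasurableSet S := measurableSet_Icc.prod measurableSet_Icc
  have hint : IntegrableOn (fun w : ℝ × ℝ => 1 * g w.2) S :=
    (Continuous.continuousOn (by fun_prop)).integrableOn_compact (isCompact_Icc.prod isCompact_Icc)
  have hle : ‖∫ w : ℝ × ℝ, (ψ₁ (b w.2 * w.1, w) - b w.2 * ψ₂ (b w.2 * w.1, w)) *
      (1 + deriv b w.2 * w.1 ^ 2 / 2)‖ ≤ ∫ w, S.indicator (fun w : ℝ × ℝ => 1 * g w.2) w := by
    refine norm_integral_le_of_norm_le (hint.integrable_indicator hS)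
      (Eventually.of_forall fun w => ?_)
    by_cases hw : w ∈ S
    · rw [indicator_of_mem hw, Real.norm_eq_abs, abs_mul, one_mul]
      have hy : w.1 ^ 2 ≤ R ^ 2 := sq_le_sq' hw.1.1 hw.1.2
      have hd := mul_le_mul_of_nonneg_left hy (hb0 w.2)
      have hd' := mul_nonneg (hb0 w.2) (sq_nonneg w.1)
      refine mul_le_mul ?_ ?_ (abs_nonneg _) zero_le_two
      · obtain ⟨k1, k2⟩ := abs_le_one_of_sq_add_sq_le (h (b w.2 * w.1, w))
        have hbm := hbp.mem w.2
        refine (abs_sub _ _).trans ?_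
        rw [abs_mul, abs_of_nonneg hbm.1]
        nlinarith [hbm.1, hbm.2, abs_nonneg (ψ₂ (b w.2 * w.1, w))]
      · rw [abs_of_nonneg (by linarith)]
        linarith
    · have hnot : (b w.2 * w.1, w) ∉ U := fun hq => hw <| by
        have := hU hq
        rw [mem_closedBall_zero_iff, Prod.norm_def, Prod.norm_def, max_le_iff, max_le_iff] at this
        exact ⟨abs_le.1 this.2.1, abs_le.1 this.2.2⟩
      rw [indicator_of_notMem hw,
        image_eq_zero_of_notMem_tsupport fun h' => hnot (h₁.2.2 h'),
        image_eq_zero_of_notMem_tsupport fun h' => hnot (h₂.2.2 h')]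
      simp
  refine (le_abs_self _).trans (hle.trans ?_)
  rw [integral_indicator hS, Measure.volume_eq_prod, setIntegral_prod_mul (fun _ => (1 : ℝ)) g]
  have hR' : -R ≤ R := by linarith
  have i1 : ∫ _ in Icc (-R) R, (1 : ℝ) = 2 * R := by
    simp [hR]
    ring
  have i2 : ∫ z in Icc (-R) R, g z ≤ 4 * R + R ^ 2 := by
    rw [integral_Icc_eq_integral_Ioc, ← intervalIntegral.integral_of_le hR']
    have e : ∫ z in (-R)..R, deriv b z = b R - b (-R) :=
      intervalIntegral.integral_deriv_eq_sub (fun z _ => hb.differentiable (by simp) z)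
        (hb'.intervalIntegrable _ _)
    simp only [g]
    have hi : IntervalIntegrable (fun z => deriv b z * (R ^ 2 / 2)) volume (-R) R :=
      (hb'.mul continuous_const).intervalIntegrable _ _
    rw [intervalIntegral.integral_const_mul,
      intervalIntegral.integral_add intervalIntegrable_const hi,
      intervalIntegral.integral_mul_const, e]
    have k1 := (hbp.mem R).2
    have k2 := (hbp.mem (-R)).1
    have := mul_le_mul_of_nonneg_right (show b R - b (-R) ≤ 1 by linarith)
      (show 0 ≤ R ^ 2 / 2 by positivity)
    simp only [intervalIntegral.integral_const, smul_eq_mul]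
    linarith
  rw [i1]
  exact mul_le_mul_of_nonneg_left i2 (by linarith)

theorem perimeter_stripSubgraph_ne_top {U : Set (ℝ × ℝ × ℝ)} (hU : Bornology.IsBounded U) :
    perimeter (stripSubgraph cantorStaircase) U ≠ ⊤ := by
  obtain ⟨R, hR⟩ := hU.subset_closedBall 0
  have hR' : U ⊆ Metric.closedBall 0 |R| := hR.trans (Metric.closedBall_subset_closedBall (le_abs_self R))
  refine ne_top_of_le_ne_top (b := ENNReal.ofReal ((2 * |R|) * (4 * |R| + |R| ^ 2)))
    ENNReal.ofReal_ne_top (perimeter_le fun ψ₁ ψ₂ h₁ h₂ h => ENNReal.ofReal_le_ofReal ?_)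
  exact le_of_tendsto' (tendsto_setIntegral_horizDiv h₁.toUniv h₂.toUniv) fun n =>
    setIntegral_horizDiv_smoothStaircase_le (abs_nonneg R) hR' n h₁ h₂ h

/-! ### Calibrations -/

/-- A smooth horizontal vector field `ν` of length at most one on `U`, with zero horizontal
divergence, that is normal to the graph `x = b z * y` in `U`. -/
structure IsCalibration (b : ℝ → ℝ) (U : Set (ℝ × ℝ × ℝ)) (ν₁ ν₂ : ℝ × ℝ × ℝ → ℝ) : Prop where
  smooth_fst : ContDiffOn ℝ ∞ ν₁ U
  smooth_snd : ContDiffOn ℝ ∞ ν₂ U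
  sq_add_sq_le : ∀ q ∈ U, ν₁ q ^ 2 + ν₂ q ^ 2 ≤ 1
  horizDiv_eq_zero : ∀ q ∈ U, horizDiv ν₁ ν₂ q = 0
  normal : ∀ q ∈ U, q.1 = b q.2.2 * q.2.1 → ν₁ q - b q.2.2 * ν₂ q = areaFun (b q.2.2)

theorem IsTestFunction.add {E : Type*} [NormedAddCommGroup E] [NormedSpace ℝ E] {Ω : Set E}
    {φ ψ : E → ℝ} (hφ : IsTestFunction Ω φ) (hψ : IsTestFunction Ω ψ) :
    IsTestFunction Ω (fun p => φ p + ψ p) :=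
  ⟨hφ.1.add hψ.1, hφ.2.1.add hψ.2.1, (tsupport_add φ ψ).trans (union_subset hφ.2.2 hψ.2.2)⟩

theorem IsTestFunction.mul_contDiffOn {E : Type*} [NormedAddCommGroup E] [NormedSpace ℝ E]
    {Ω : Set E} (hΩ : IsOpen Ω) {χ ν : E → ℝ} (hχ : IsTestFunction Ω χ) (hν : ContDiffOn ℝ ∞ ν Ω) :
    IsTestFunction Ω (fun p => χ p * ν p) := by
  refine ⟨contDiff_iff_contDiffAt.2 fun p => ?_, hχ.2.1.mul_right,
    (tsupport_mul_subset_left).trans hχ.2.2⟩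
  by_cases hp : p ∈ tsupport χ
  · exact hχ.1.contDiffAt.mul (hν.contDiffAt (hΩ.mem_nhds (hχ.2.2 hp)))
  · refine (contDiffAt_const (c := (0 : ℝ))).congr_of_eventuallyEq ?_
    filter_upwards [(isClosed_tsupport χ).isOpen_compl.mem_nhds hp] with q hq
    rw [image_eq_zero_of_notMem_tsupport hq, zero_mul]

theorem horizX_mul {f g : ℝ × ℝ × ℝ → ℝ} {p : ℝ × ℝ × ℝ} (hf : DifferentiableAt ℝ f p)
    (hg : DifferentiableAt ℝ g p) :
    horizX (fun q => f q * g q) p = f p * horizX g p + horizX f p * g p := by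
  have : fderiv ℝ (fun q => f q * g q) p = _ := (hf.hasFDerivAt.mul hg.hasFDerivAt).fderiv
  rw [horizX, this]
  simp [horizX]
  ring

theorem horizY_mul {f g : ℝ × ℝ × ℝ → ℝ} {p : ℝ × ℝ × ℝ} (hf : DifferentiableAt ℝ f p)
    (hg : DifferentiableAt ℝ g p) :
    horizY (fun q => f q * g q) p = f p * horizY g p + horizY f p * g p := by
  have : fderiv ℝ (fun q => f q * g q) p = _ := (hf.hasFDerivAt.mul hg.hasFDerivAt).fderiv
  rw [horizY, this]
  simp [horizY]
  ring

theorem horizDiv_add {f₁ f₂ g₁ g₂ : ℝ × ℝ × ℝ → ℝ} {p : ℝ × ℝ × ℝ} (hf₁ : DifferentiableAt ℝ f₁ p)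
    (hf₂ : DifferentiableAt ℝ f₂ p) (hg₁ : DifferentiableAt ℝ g₁ p)
    (hg₂ : DifferentiableAt ℝ g₂ p) :
    horizDiv (fun q => f₁ q + g₁ q) (fun q => f₂ q + g₂ q) p =
      horizDiv f₁ f₂ p + horizDiv g₁ g₂ p := by
  have e1 : fderiv ℝ (fun q => f₁ q + g₁ q) p = _ := (hf₁.hasFDerivAt.add hg₁.hasFDerivAt).fderiv
  have e2 : fderiv ℝ (fun q => f₂ q + g₂ q) p = _ := (hf₂.hasFDerivAt.add hg₂.hasFDerivAt).fderiv
  simp only [horizDiv, horizX, horizY, e1, e2]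
  simp
  ring

theorem horizDiv_congr {f₁ f₂ g₁ g₂ : ℝ × ℝ × ℝ → ℝ} {p : ℝ × ℝ × ℝ} (h₁ : f₁ =ᶠ[𝓝 p] g₁)
    (h₂ : f₂ =ᶠ[𝓝 p] g₂) : horizDiv f₁ f₂ p = horizDiv g₁ g₂ p := by
  simp only [horizDiv, horizX, horizY, h₁.fderiv_eq, h₂.fderiv_eq]

/-- Smooth cutoff functions. -/
theorem exists_cutoff {K U : Set (ℝ × ℝ × ℝ)} (hK : IsCompact K) (hU : IsOpen U) (h : K ⊆ U) :
    ∃ χ : ℝ × ℝ × ℝ → ℝ, IsTestFunction U χ ∧ (∀ q, χ q ∈ Icc (0 : ℝ) 1) ∧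
      ∀ q ∈ K, ∀ᶠ q' in 𝓝 q, χ q' = 1 := by
  obtain ⟨L, hL, hKL, hLU⟩ := exists_compact_between hK hU h
  obtain ⟨χ, h1, h0, h01⟩ := exists_contMDiffMap_one_nhds_of_subset_interior
    (modelWithCornersSelf ℝ (ℝ × ℝ × ℝ)) (n := (⊤ : ℕ∞)) hK.isClosed hKL
  have hs : tsupport χ ⊆ L := closure_minimal (fun q hq => by
    by_contra h'
    exact hq (h0 q h')) hL.isClosed
  refine ⟨χ, ⟨χ.contMDiff.contDiff, hL.of_isClosed_subset (isClosed_tsupport _) hs,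
    hs.trans hLU⟩, h01, fun q hq => ?_⟩
  exact h1.filter_mono (nhds_le_nhdsSet hq)

section Competitor

variable {U : Set (ℝ × ℝ × ℝ)} {χ : ℝ × ℝ × ℝ → ℝ} {b : ℝ → ℝ} {ν₁ ν₂ ψ₁ ψ₂ : ℝ × ℝ × ℝ → ℝ}

/-- As ν is divergence-free, only derivatives of the cutoff survive, so the bound is independent of
ν. -/
theorem abs_horizDiv_mul_calibration_le (hU : IsOpen U) (hχ : IsTestFunction U χ)
    (hν : IsCalibration b U ν₁ ν₂) (q : ℝ × ℝ × ℝ) :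
    |horizDiv (fun p => χ p * ν₁ p) (fun p => χ p * ν₂ p) q| ≤ |horizX χ q| + |horizY χ q| := by
  by_cases hq : q ∈ U
  · have d1 := (hν.smooth_fst.contDiffAt (hU.mem_nhds hq)).differentiableAt (by simp)
    have d2 := (hν.smooth_snd.contDiffAt (hU.mem_nhds hq)).differentiableAt (by simp)
    have hd := hν.horizDiv_eq_zero q hq
    obtain ⟨k1, k2⟩ := abs_le_one_of_sq_add_sq_le (hν.sq_add_sq_le q hq)
    have e : horizDiv (fun p => χ p * ν₁ p) (fun p => χ p * ν₂ p) q =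
        horizX χ q * ν₁ q + horizY χ q * ν₂ q := by
      rw [horizDiv, horizX_mul (hχ.differentiable q) d1, horizY_mul (hχ.differentiable q) d2]
      rw [horizDiv] at hd
      linear_combination χ q * hd
    rw [e]
    refine (abs_add_le _ _).trans ?_
    rw [abs_mul, abs_mul]
    exact add_le_add (mul_le_of_le_one_right (abs_nonneg _) k1)
      (mul_le_of_le_one_right (abs_nonneg _) k2)
  · have e : ∀ ν : ℝ × ℝ × ℝ → ℝ, (fun p => χ p * ν p) =ᶠ[𝓝 q] fun _ => 0 := fun ν => by
      filter_upwards [(isClosed_tsupport χ).isOpen_compl.mem_nhds fun h => hq (hχ.2.2 h)] with p hp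
      rw [image_eq_zero_of_notMem_tsupport hp, zero_mul]
    rw [horizDiv_congr (e _) (e _)]
    simp only [horizDiv, horizX, horizY, fderiv_fun_const, Pi.zero_apply, zero_apply, add_zero,
      abs_zero]
    positivity

theorem sq_add_sq_interpolate_le {s x₁ x₂ y₁ y₂ : ℝ} (hs : s ∈ Icc (0 : ℝ) 1)
    (hx : x₁ ^ 2 + x₂ ^ 2 ≤ 1) (hy : y₁ ^ 2 + y₂ ^ 2 ≤ 1) :
    ((1 - s) * x₁ + s * y₁) ^ 2 + ((1 - s) * x₂ + s * y₂) ^ 2 ≤ 1 := by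
  have h1 := mul_le_mul_of_nonneg_left hx (sub_nonneg.2 hs.2)
  have h2 := mul_le_mul_of_nonneg_left hy hs.1
  have h3 := mul_nonneg (mul_nonneg hs.1 (sub_nonneg.2 hs.2))
    (add_nonneg (sq_nonneg (x₁ - y₁)) (sq_nonneg (x₂ - y₂)))
  nlinarith

/-- Cauchy–Schwarz with the vector (1, -c), whose length is S(c). -/
theorem sub_mul_le_areaFun {x₁ x₂ : ℝ} (hx : x₁ ^ 2 + x₂ ^ 2 ≤ 1) (c : ℝ) :
    x₁ - c * x₂ ≤ areaFun c := by
  refine Real.le_sqrt_of_sq_le ?_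
  nlinarith [sq_nonneg (c * x₁ + x₂), mul_le_mul_of_nonneg_left hx (show 0 ≤ 1 + c ^ 2 by positivity)]

end Competitor

/-- Existence of calibrations for all fine enough smooth staircases implies minimality for the
Cantor staircase. -/
theorem isPerimeterMinimizer_of_calibrations {U : Set (ℝ × ℝ × ℝ)} (hU : IsOpen U) {N : ℕ}
    (hcal : ∀ n ≥ N, ∃ ν₁ ν₂, IsCalibration (smoothStaircase n) U ν₁ ν₂) :
    IsPerimeterMinimizer (stripSubgraph cantorStaircase) U := by
  have hG := (isClosed_stripSubgraph cantorStaircase_continuous).measurableSet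
  refine ⟨hG.nullMeasurableSet, fun F hF hK hKU => perimeter_le fun ψ₁ ψ₂ h₁ h₂ h12 => ?_⟩
  obtain ⟨χ, hχ, hχ01, hχ1⟩ := exists_cutoff hK hU hKU
  choose! ν₁ ν₂ hν using hcal
  have hcut : ContDiff ℝ ∞ fun p => 1 - χ p := contDiff_const.sub hχ.1
  have c₁ := h₁.mul_left hcut
  have c₂ := h₂.mul_left hcut
  -- The given field away from the competitor's change, the calibration near it. Pointwise convex
  -- combinations stay in the unit disc; `max n N` only makes the fields available for all n.
  let Ψ₁ : ℕ → ℝ × ℝ × ℝ → ℝ := fun n p => (1 - χ p) * ψ₁ p + χ p * ν₁ (max n N) p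
  let Ψ₂ : ℕ → ℝ × ℝ × ℝ → ℝ := fun n p => (1 - χ p) * ψ₂ p + χ p * ν₂ (max n N) p
  have hν' : ∀ n, IsCalibration (smoothStaircase (max n N)) U (ν₁ (max n N)) (ν₂ (max n N)) :=
    fun n => hν _ (le_max_right n N)
  have m₁ : ∀ n, IsTestFunction U fun p => χ p * ν₁ (max n N) p := fun n =>
    hχ.mul_contDiffOn hU (hν' n).smooth_fst
  have m₂ : ∀ n, IsTestFunction U fun p => χ p * ν₂ (max n N) p := fun n =>
    hχ.mul_contDiffOn hU (hν' n).smooth_snd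
  have hΨ₁ : ∀ n, IsTestFunction U (Ψ₁ n) := fun n => c₁.add (m₁ n)
  have hΨ₂ : ∀ n, IsTestFunction U (Ψ₂ n) := fun n => c₂.add (m₂ n)
  have hΨ : ∀ n p, Ψ₁ n p ^ 2 + Ψ₂ n p ^ 2 ≤ 1 := fun n p => by
    by_cases hp : p ∈ U
    · exact sq_add_sq_interpolate_le (hχ01 p) (h12 p) ((hν' n).sq_add_sq_le p hp)
    · have : χ p = 0 := image_eq_zero_of_notMem_tsupport fun h => hp (hχ.2.2 h)
      simpa [Ψ₁, Ψ₂, this] using h12 p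
  -- the competitor does not change the integrals of these fields
  have hFG : ∀ n, ∫ q in F, horizDiv (Ψ₁ n) (Ψ₂ n) q =
      ∫ q in stripSubgraph cantorStaircase, horizDiv (Ψ₁ n) (Ψ₂ n) q := fun n => by
    rw [← integral_indicator₀ hF, ← integral_indicator hG]
    refine integral_congr_ae (Eventually.of_forall fun q => ?_)
    have hzero : q ∈ closure ((stripSubgraph cantorStaircase \ F) ∪
        (F \ stripSubgraph cantorStaircase)) → horizDiv (Ψ₁ n) (Ψ₂ n) q = 0 := fun hq => by
      rw [← (hν' n).horizDiv_eq_zero q (hKU hq)]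
      refine horizDiv_congr ?_ ?_ <;> filter_upwards [hχ1 q hq] with p hp <;> simp [Ψ₁, Ψ₂, hp]
    by_cases h1 : q ∈ F <;> by_cases h2 : q ∈ stripSubgraph cantorStaircase <;>
      simp only [indicator_of_mem, indicator_of_notMem, h1, h2, not_false_eq_true]
    · exact hzero (subset_closure (Or.inr ⟨h1, h2⟩))
    · exact (hzero (subset_closure (Or.inl ⟨h2, h1⟩))).symm
  -- on the smooth subgraphs they are at least those of `ψ`
  have hJ : ∀ n ≥ N, ∫ q in stripSubgraph (smoothStaircase n), horizDiv ψ₁ ψ₂ q ≤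
      ∫ q in stripSubgraph (smoothStaircase n), horizDiv (Ψ₁ n) (Ψ₂ n) q := fun n hn => by
    have hb := smoothStaircase_contDiff n
    rw [setIntegral_horizDiv hb h₁.toUniv h₂.toUniv,
      setIntegral_horizDiv hb (hΨ₁ n).toUniv (hΨ₂ n).toUniv]
    have hc := hb.continuous
    have hb' : Continuous (deriv (smoothStaircase n)) := hb.continuous_deriv (by simp)
    have hint : ∀ {φ₁ φ₂ : ℝ × ℝ × ℝ → ℝ}, IsTestFunction U φ₁ → IsTestFunction U φ₂ →
        Integrable fun w : ℝ × ℝ => (φ₁ (smoothStaircase n w.2 * w.1, w) -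
          smoothStaircase n w.2 * φ₂ (smoothStaircase n w.2 * w.1, w)) *
            (1 + deriv (smoothStaircase n) w.2 * w.1 ^ 2 / 2) := fun {φ₁ φ₂} k₁ k₂ => by
      have hk₁ := k₁.continuous
      have hk₂ := k₂.continuous
      refine Continuous.integrable_of_hasCompactSupport (by fun_prop) (HasCompactSupport.mul_right ?_)
      refine HasCompactSupport.intro
        ((k₁.2.1.isCompact.union k₂.2.1.isCompact).image continuous_snd) fun w hw => ?_
      have e₁ : φ₁ (smoothStaircase n w.2 * w.1, w) = 0 := by
        by_contra h0
        exact hw ⟨_, Or.inl (subset_tsupport _ h0), rfl⟩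
      have e₂ : φ₂ (smoothStaircase n w.2 * w.1, w) = 0 := by
        by_contra h0
        exact hw ⟨_, Or.inr (subset_tsupport _ h0), rfl⟩
      rw [e₁, e₂]
      simp
    refine integral_mono (hint h₁ h₂) (hint (hΨ₁ n) (hΨ₂ n)) fun w => ?_
    have hd : 0 ≤ deriv (smoothStaircase n) w.2 := (smoothStaircase_monotone n).deriv_nonneg
    refine mul_le_mul_of_nonneg_right ?_ (by positivity)
    set q : ℝ × ℝ × ℝ := (smoothStaircase n w.2 * w.1, w) with hq
    -- On the smooth graph the calibration attains the maximum S(b) of ψ₁ - b ψ₂ over the unit disc,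
    -- so interpolating toward it does not decrease the boundary integrand.
    have key : 0 ≤ χ q * ((ν₁ n q - smoothStaircase n w.2 * ν₂ n q) -
        (ψ₁ q - smoothStaircase n w.2 * ψ₂ q)) := by
      by_cases hqU : q ∈ U
      · refine mul_nonneg (hχ01 q).1 (sub_nonneg.2 ?_)
        have h3 := (hν n hn).normal q hqU rfl
        simp only [hq] at h3 ⊢
        rw [h3]
        exact sub_mul_le_areaFun (h12 _) _
      · rw [image_eq_zero_of_notMem_tsupport fun h => hqU (hχ.2.2 h), zero_mul]
    simp only [Ψ₁, Ψ₂, max_eq_left hn]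
    linarith
  have hlim : Tendsto (fun n => (∫ q in stripSubgraph (smoothStaircase n), horizDiv ψ₁ ψ₂ q) -
      ((∫ q in stripSubgraph (smoothStaircase n), horizDiv (Ψ₁ n) (Ψ₂ n) q) -
        ∫ q in stripSubgraph cantorStaircase, horizDiv (Ψ₁ n) (Ψ₂ n) q)) atTop
      (𝓝 ((∫ q in stripSubgraph cantorStaircase, horizDiv ψ₁ ψ₂ q) - 0)) := by
    refine (tendsto_setIntegral_horizDiv h₁.toUniv h₂.toUniv).sub
      (tendsto_setIntegral_stripSubgraph
        (B := fun q => |horizDiv (fun p => (1 - χ p) * ψ₁ p) (fun p => (1 - χ p) * ψ₂ p) q| +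
          (|horizX χ q| + |horizY χ q|))
        (fun n => ((hΨ₁ n).integrable_horizDiv (hΨ₂ n)).1)
        ((c₁.integrable_horizDiv c₂).abs.add
          (hχ.integrable_horizX.abs.add hχ.integrable_horizY.abs)) fun n q => ?_)
    rw [horizDiv_add (c₁.differentiable q) (c₂.differentiable q) ((m₁ n).differentiable q)
      ((m₂ n).differentiable q)]
    exact (abs_add_le _ _).trans (add_le_add le_rfl
      (abs_horizDiv_mul_calibration_le hU hχ (hν' n) q))
  rw [sub_zero] at hlim
  refine le_of_tendsto (ENNReal.tendsto_ofReal hlim) ?_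
  filter_upwards [eventually_ge_atTop N] with n hn
  refine (ENNReal.ofReal_le_ofReal ?_).trans (le_perimeter (hΨ₁ n) (hΨ₂ n) (hΨ n))
  rw [hFG n]
  linarith [hJ n hn]

/-! ### Local minimality -/

theorem inv_areaFun_sq_add (c : ℝ) : (areaFun c)⁻¹ ^ 2 + (-areaFun' c) ^ 2 = 1 := by
  have h1 := areaFun_sq c
  have : 0 < 1 + c ^ 2 := by positivity
  rw [areaFun', neg_sq, div_pow, inv_pow, h1]
  field_simp

theorem inv_areaFun_sub (c : ℝ) : (areaFun c)⁻¹ - c * -areaFun' c = areaFun c := by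
  have h0 := areaFun_pos c
  have h1 := areaFun_sq c
  rw [areaFun']
  field_simp
  linarith

theorem isCalibration_const {b : ℝ → ℝ} {U : Set (ℝ × ℝ × ℝ)} {c : ℝ}
    (h : ∀ q ∈ U, b q.2.2 = c) :
    IsCalibration b U (fun _ => (areaFun c)⁻¹) (fun _ => -areaFun' c) where
  smooth_fst := contDiffOn_const
  smooth_snd := contDiffOn_const
  sq_add_sq_le _ _ := (inv_areaFun_sq_add c).le
  horizDiv_eq_zero q _ := by simp [horizDiv, horizX, horizY]
  normal q hq _ := by
    rw [h q hq]
    exact inv_areaFun_sub c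

/-- Coordinates `(m, ℓ)` in which the graph `x = b z * y` consists of characteristics of
Burgers' equation with initial values `b`. -/
noncomputable def stripCoord (c : ℝ) (q : ℝ × ℝ × ℝ) : ℝ × ℝ :=
  ((c - q.2.1 / 2) * q.2.1, q.2.2 + (c - q.2.1 / 2) * q.1)

/-- X moves only ℓ and Y only m, both at speed c - y. The horizontal divergence of a field depending
on (m, ℓ) is therefore c - y times a planar divergence. -/
theorem differentiableAt_stripCoord (c : ℝ) (q : ℝ × ℝ × ℝ) :
    DifferentiableAt ℝ (stripCoord c) q ∧
    fderiv ℝ (stripCoord c) q (1, 0, -q.2.1 / 2) = (c - q.2.1) • (0, 1) ∧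
    fderiv ℝ (stripCoord c) q (0, 1, q.1 / 2) = (c - q.2.1) • (1, 0) := by
  have hx : HasFDerivAt (fun q : ℝ × ℝ × ℝ => q.1) (ContinuousLinearMap.fst ℝ ℝ (ℝ × ℝ)) q :=
    hasFDerivAt_fst
  have hy : HasFDerivAt (fun q : ℝ × ℝ × ℝ => q.2.1)
      ((ContinuousLinearMap.fst ℝ ℝ ℝ).comp (ContinuousLinearMap.snd ℝ ℝ (ℝ × ℝ))) q :=
    ((ContinuousLinearMap.fst ℝ ℝ ℝ).comp (ContinuousLinearMap.snd ℝ ℝ (ℝ × ℝ))).hasFDerivAt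
  have hz : HasFDerivAt (fun q : ℝ × ℝ × ℝ => q.2.2)
      ((ContinuousLinearMap.snd ℝ ℝ ℝ).comp (ContinuousLinearMap.snd ℝ ℝ (ℝ × ℝ))) q :=
    ((ContinuousLinearMap.snd ℝ ℝ ℝ).comp (ContinuousLinearMap.snd ℝ ℝ (ℝ × ℝ))).hasFDerivAt
  have hk := (hy.mul_const (2⁻¹ : ℝ)).const_sub c
  simp only [← div_eq_mul_inv] at hk
  have h : HasFDerivAt (stripCoord c) _ q := (hk.mul hy).prodMk (hz.add (hk.mul hx))
  refine ⟨h.differentiableAt, ?_, ?_⟩ <;> rw [h.fderiv] <;> ext <;> simp <;> ring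

theorem contDiff_stripCoord (c : ℝ) : ContDiff ℝ ∞ (stripCoord c) := by
  unfold stripCoord
  fun_prop

/-- With A = u(m, ℓ), the divergence of (1/S(A), -S'(A)) is -S''(A) (c - y) (u_m + u u_ℓ) = 0. On
the graph x = b(z) y one has ℓ = z + m b(z), so the foot is z and A = b(z). The sign condition m ≥ 0
avoids crossing characteristics for every n at once. -/
theorem isCalibration_burgers (n : ℕ) {U : Set (ℝ × ℝ × ℝ)} {c : ℝ}
    (h : ∀ q ∈ U, 0 ≤ (c - q.2.1 / 2) * q.2.1) :
    IsCalibration (smoothStaircase n) U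
      (fun q => (areaFun (burgers (smoothStaircase n) (stripCoord c q)))⁻¹)
      (fun q => -areaFun' (burgers (smoothStaircase n) (stripCoord c q))) := by
  have hA : ∀ q ∈ U, ContDiffAt ℝ ∞ (fun q => burgers (smoothStaircase n) (stripCoord c q)) q :=
    fun q hq => (contDiffAt_burgers_smoothStaircase n (p := stripCoord c q) (h q hq)).comp q
      (contDiff_stripCoord c).contDiffAt
  refine ⟨fun q hq => ?_, fun q hq => ?_, fun q _ => (inv_areaFun_sq_add _).le, fun q hq => ?_,
    fun q hq hg => ?_⟩
  · exact ((contDiff_areaFun.contDiffAt.comp q (hA q hq)).inv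
      (areaFun_pos _).ne').contDiffWithinAt
  · exact (contDiff_areaFun'.contDiffAt.comp q (hA q hq)).neg.contDiffWithinAt
  · set A := burgers (smoothStaircase n) (stripCoord c q) with hAq
    have hu := ((contDiffAt_burgers_smoothStaircase n (p := stripCoord c q) (h q hq)).differentiableAt
      (by simp)).hasFDerivAt
    obtain ⟨hs, hX, hY⟩ := differentiableAt_stripCoord c q
    have hcomp := hu.comp q hs.hasFDerivAt
    have h1 : HasFDerivAt
        (fun q => (areaFun (burgers (smoothStaircase n) (stripCoord c q)))⁻¹) _ q :=
      (((hasDerivAt_neg_inv_areaFun A).neg).comp_hasFDerivAt q hcomp).congr_of_eventuallyEq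
        (Eventually.of_forall fun q => by simp)
    have h2 : HasFDerivAt
        (fun q => -areaFun' (burgers (smoothStaircase n) (stripCoord c q))) _ q :=
      (((hasDerivAt_areaFun' A).neg).comp_hasFDerivAt q hcomp).congr_of_eventuallyEq
        (Eventually.of_forall fun q => by simp)
    have hb := fderiv_burgers_smoothStaircase n (p := stripCoord c q) (h q hq)
    rw [horizDiv, horizX, horizY, h1.fderiv, h2.fderiv]
    simp only [smul_apply, ContinuousLinearMap.comp_apply, hX, hY, map_smul,
      smul_eq_mul]
    rw [← hAq] at hb
    linear_combination (-(areaFun'' A * (c - q.2.1))) * hb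
  · have e : stripCoord c q = ((c - q.2.1 / 2) * q.2.1,
        q.2.2 + (c - q.2.1 / 2) * q.2.1 * smoothStaircase n q.2.2) := by
      rw [stripCoord, hg]
      ext <;> simp
      ring
    have hf : burgers (smoothStaircase n) (stripCoord c q) = smoothStaircase n q.2.2 := by
      rw [burgers, e, (isProfile_smoothStaircase n).foot_eq (h q hq)]
    simp only [hf]
    exact inv_areaFun_sub _

theorem isCalibration_zero {b : ℝ → ℝ} {U : Set (ℝ × ℝ × ℝ)}
    (h : ∀ q ∈ U, q.1 ≠ b q.2.2 * q.2.1) : IsCalibration b U (fun _ => 0) (fun _ => 0) where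
  smooth_fst := contDiffOn_const
  smooth_snd := contDiffOn_const
  sq_add_sq_le q _ := by simp
  horizDiv_eq_zero q _ := by simp [horizDiv, horizX, horizY]
  normal q hq hg := absurd hg (h q hq)

theorem mem_ball_prod_iff {p q : ℝ × ℝ × ℝ} {r : ℝ} :
    q ∈ Metric.ball p r ↔ |q.1 - p.1| < r ∧ |q.2.1 - p.2.1| < r ∧ |q.2.2 - p.2.2| < r := by
  simp [Metric.mem_ball, Prod.dist_eq, Real.dist_eq]

/-- Near every point off the vertical points over the Cantor set, the strips over the smooth
approximations of the staircase are calibrated. -/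
theorem exists_calibrated_nhd {p : ℝ × ℝ × ℝ} (hp : ¬ (p.1 = 0 ∧ p.2.1 = 0 ∧ p.2.2 ∈ cantorSet)) :
    ∃ U : Set (ℝ × ℝ × ℝ), IsOpen U ∧ p ∈ U ∧ Bornology.IsBounded U ∧
      (∀ q ∈ U, ¬ (q.1 = 0 ∧ q.2.1 = 0 ∧ q.2.2 ∈ cantorSet)) ∧
      ∃ N, ∀ n ≥ N, ∃ ν₁ ν₂, IsCalibration (smoothStaircase n) U ν₁ ν₂ := by
  by_cases hy : p.2.1 = 0
  · by_cases hx : p.1 = 0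
    · have hz : p.2.2 ∉ cantorSet := fun hz => hp ⟨hx, hy, hz⟩
      obtain ⟨N, hN⟩ := exists_eventually_smoothStaircase_eq hz
      have hC : ∀ᶠ z in 𝓝 p.2.2, z ∉ cantorSet :=
        isClosed_cantorSet.isOpen_compl.mem_nhds hz
      obtain ⟨r, hr, hball⟩ := Metric.eventually_nhds_iff.1 (hN.and hC)
      refine ⟨Metric.ball p r, Metric.isOpen_ball, Metric.mem_ball_self hr, Metric.isBounded_ball,
        fun q hq h => ?_, N, fun n hn => ⟨_, _, isCalibration_const (c := cantorStaircase p.2.2)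
          fun q hq => ?_⟩⟩
      · exact (hball (mem_ball_prod_iff.1 hq).2.2).2 h.2.2
      · exact (hball (mem_ball_prod_iff.1 hq).2.2).1.2 n hn
    · have hx' : 0 < |p.1| := abs_pos.2 hx
      -- Slopes lie in [0, 1], so every graph satisfies |x| ≤ |y| and misses this ball.
      have key : ∀ q ∈ Metric.ball p (|p.1| / 3), |q.2.1| < |q.1| := fun q hq => by
        obtain ⟨h1, h2, -⟩ := mem_ball_prod_iff.1 hq
        rw [hy, sub_zero] at h2
        have := abs_sub_abs_le_abs_sub p.1 q.1
        rw [abs_sub_comm] at this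
        linarith
      refine ⟨Metric.ball p (|p.1| / 3), Metric.isOpen_ball, Metric.mem_ball_self (by positivity),
        Metric.isBounded_ball, fun q hq h => ?_, 0, fun n _ => ⟨_, _, isCalibration_zero
          fun q hq h => ?_⟩⟩
      · have := key q hq
        rw [h.1, abs_zero] at this
        exact (abs_nonneg _).not_gt this
      · have h1 := key q hq
        obtain ⟨h2, h3⟩ := smoothStaircase_mem_Icc n q.2.2
        rw [h, abs_mul, abs_of_nonneg h2] at h1
        exact (mul_le_of_le_one_left (abs_nonneg _) h3).not_gt h1
  · have hy' : 0 < |p.2.1| := abs_pos.2 hy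
    -- With c the y-coordinate of p, the quantity m = (c - y/2) y is positive for y strictly between
    -- 0 and 2c, hence on this ball.
    have key : ∀ q ∈ Metric.ball p (|p.2.1| / 2), 0 < (p.2.1 - q.2.1 / 2) * q.2.1 := fun q hq => by
      have h := (mem_ball_prod_iff.1 hq).2.1
      rw [abs_lt] at h
      rcases lt_or_gt_of_ne hy with h0 | h0
      · rw [abs_of_neg h0] at h
        exact mul_pos_of_neg_of_neg (by linarith) (by linarith)
      · rw [abs_of_pos h0] at h
        exact mul_pos (by linarith) (by linarith)
    refine ⟨Metric.ball p (|p.2.1| / 2), Metric.isOpen_ball, Metric.mem_ball_self (by positivity),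
      Metric.isBounded_ball, fun q hq h => ?_, 0, fun n _ => ⟨_, _,
        isCalibration_burgers n fun q hq => (key q hq).le⟩⟩
    have := key q hq
    rw [h.2.1, mul_zero] at this
    exact this.false

theorem isLocalPerimeterMinimizer_stripSubgraph :
    IsLocalPerimeterMinimizer (stripSubgraph cantorStaircase)
      {p : ℝ × ℝ × ℝ | ¬ (p.1 = 0 ∧ p.2.1 = 0 ∧ p.2.2 ∈ cantorSet)} := fun p hp => by
  obtain ⟨U, hU, hpU, hb, hsub, N, hcal⟩ := exists_calibrated_nhd hp
  exact ⟨U, hU, hpU, hsub, perimeter_stripSubgraph_ne_top hb,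
    isPerimeterMinimizer_of_calibrations hU hcal⟩

theorem theorem1p4 :
    ∃ f : ℝ × ℝ → ℝ,
      -- `f` is the (only) function given by the graphical strip of the Cantor staircase
      IsGraphicalStrip cantorStaircase f ∧
      (∀ g : ℝ × ℝ → ℝ, IsGraphicalStrip cantorStaircase g → g = f) ∧
      -- regularity
      MemW1pLoc 2 f ∧
      IsIntrinsicC1 f ∧
      LocallyLipschitzOn (({(0 : ℝ)} : Set ℝ) ×ˢ cantorSet)ᶜ f ∧
      -- stability, without being an intrinsic plane
      IsStableGraph f ∧
      ¬ IsIntrinsicPlane (intrinsicGraph f) ∧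
      -- local minimality away from the vertical points over the Cantor set
      IsLocalPerimeterMinimizer (intrinsicSubgraph f)
        {p : ℝ × ℝ × ℝ | ¬ (p.1 = 0 ∧ p.2.1 = 0 ∧ p.2.2 ∈ cantorSet)} := by
  have ha := isProfile_cantorStaircase.isGraphicalStrip_stripFun
  refine ⟨stripFun cantorStaircase, ha, fun g hg => isProfile_cantorStaircase.eq_stripFun hg,
    memW1pLoc_stripFun, isIntrinsicC1_stripFun, locallyLipschitzOn_stripFun,
    isStableGraph_stripFun, not_isIntrinsicPlane_of_isGraphicalStrip ha, ?_⟩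
  rw [intrinsicSubgraph_stripFun]
  exact isLocalPerimeterMinimizer_stripSubgraph
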